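/- Let $M>0$, $|a|\le M$, $r_\pm=M\pm\sqrt{M^2-a^2}$, and let $\mathcal M=\mathbb R\times[r_+,\infty)\times\mathbb S^2$ be the Kerr exterior (including the event horizon $r=r_+$), with Kerr coordinates $(\bar t,r,\theta,\bar\phi)$, $\Delta=(r-r_+)(r-r_-)$, $\Sigma=r^2+a^2\cos^2\theta$ and metric $$g=-\Big(1-\frac{2Mr}{\Sigma}\Big)d\bar t^2+2\,d\bar t\,dr+\Sigma\,d\theta^2+\frac{(r^2+a^2)^2-\Delta a^2\sin^2\theta}{\Sigma}\sin^2\theta\,d\bar\phi^2-2a\sin^2\theta\,dr\,d\bar\phi-\frac{4aMr}{\Sigma}\sin^2\theta\,d\bar t\,d\bar\phi ,$$ with Levi-Civita connection $\nabla$. Let $$e_3=-\partial_r,\qquad e_4=\Sigma^{-1}\big(2(r^2+a^2)\partial_{\bar t}+\Delta\,\partial_r+2a\,\partial_{\bar\phi}\big)$$ be the algebraically special null vector fields, which satisfy $g(e_3,e_4)=-2$, and let $\mathfrak D=\langle e_3,e_4\rangle^\perp$ be the horizontal distribution. Horizontal one-forms are sections of $\mathfrak D^\star$, identified with the one-forms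 on $\mathcal M$ vanishing on $e_3,e_4$. Capital indices refer to a local orthonormal frame $(e_1,e_2)$ of $\mathfrak D$. Let $\slashed g$ be the induced metric on $\mathfrak D$, $\slashed\varepsilon=\sin\theta\,d\theta\wedge((r^2+a^2)d\bar\phi-a\,d\bar t)$ its volume form, and $\slashed\nabla$ the connection induced on $\mathfrak D$ by orthogonal projection of $\nabla$; write $\slashed\nabla_3=\slashed\nabla_{e_3}$, $\slashed\nabla_4=\slashed\nabla_{e_4}$, $(\slashed\nabla f)_A=e_A(f)$ for a scalar $f$. For horizontal one-forms $\varsigma,\tau$ and a horizontal two-tensor $\vartheta$ put ${}^\star\varsigma_A=\slashed\varepsilon_{AB}\varsigma^B$, $(\varsigma,\tau)=\varsigma^A\tau_A$, $\varsigma\wedge\tau=\slashed\varepsilon^{AB}\varsigma_A\tau_B$, $(\vartheta^{\sharp_2}\cdot\varsigma)_A=\vartheta_{AB}\varsigma^B$, $\mathrm{tr}\,\vartheta=\slashed g^{AB}\vartheta_{AB}$, $\slashed\varepsilon\cdot\vartheta=\slashed\varepsilon^{AB}\vartheta_{AB}$, $\slashed{\mathrm{div}}\,\varsigma=\slashed g^{AB}(\slashed\nabla_A\varsigma)_B$,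 $\slashed{\mathrm{curl}}\,\varsigma=\slashed\varepsilon^{AB}(\slashed\nabla_A\varsigma)_B$, and for a scalar $f$ write $(\slashed\nabla+2\tau)f=\slashed\nabla f+2f\tau$ and ${}^\star(\slashed\nabla+2\tau)f={}^\star(\slashed\nabla f+2f\tau)$. The connection coefficients are $\chi_{AB}=g(\nabla_{e_A}e_4,e_B)$, $\underline\chi_{AB}=g(\nabla_{e_A}e_3,e_B)$, $\eta_A=\frac12g(\nabla_{e_3}e_4,e_A)$, $\underline\eta_A=\frac12g(\nabla_{e_4}e_3,e_A)$, $\hat\omega=\frac12g(\nabla_{e_4}e_3,e_4)$. Let $U\subseteq\mathcal M$ be (relatively) open, for example $U=\mathcal M$, and let $(\alpha,\underline\alpha,\rho,\sigma)$ be a smooth solution on $U$ of the Maxwell system relative to this frame, that is, $\alpha,\underline\alpha$ are smooth horizontal one-forms and $\rho,\sigma$ smooth functions on $U$ with \begin{align*} \slashed\nabla_3\sigma+\mathrm{tr}\underline\chi\,\sigma&=-\slashed{\mathrm{curl}}\,\underline\alpha-(\slashed\varepsilon\cdot\underline\chi)\rho, & \slashed\nabla_3\rho+\mathrm{tr}\underline\chi\,\rho&=-\slashed{\mathrm{div}}\,\underline\alpha+(\slashed\varepsilon\cdot\underline\chi)\sigma,\\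 \slashed\nabla_4\sigma+\mathrm{tr}\chi\,\sigma&=-\slashed{\mathrm{curl}}\,\alpha-(\eta+\underline\eta)\wedge\alpha+(\slashed\varepsilon\cdot\chi)\rho, & \slashed\nabla_4\rho+\mathrm{tr}\chi\,\rho&=\slashed{\mathrm{div}}\,\alpha+(\eta+\underline\eta,\alpha)-(\slashed\varepsilon\cdot\chi)\sigma, \end{align*} \begin{align*} \slashed\nabla_3\alpha+\underline\chi^{\sharp_2}\cdot\alpha&=\slashed\nabla\rho+{}^\star\slashed\nabla\sigma+2\eta\,\rho+2\,{}^\star\eta\,\sigma,\\ \slashed\nabla_4\underline\alpha+\chi^{\sharp_2}\cdot\underline\alpha+\hat\omega\,\underline\alpha&=-\slashed\nabla\rho+{}^\star\slashed\nabla\sigma-2\underline\eta\,\rho+2\,{}^\star\underline\eta\,\sigma . \end{align*} (These are the components $\alpha(e_A)=F(e_A,e_4)$, $\underline\alpha(e_A)=F(e_A,e_3)$, $\rho=\frac12F(e_3,e_4)$, $\sigma=\frac12\slashed\varepsilon^{AB}F(e_A,e_B)$ of a source-free Maxwell field $F$.) Then on $U$ the following hold. Tensorial Teukolsky equations of spin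 $+1$ and $-1$: $$\Sigma\Big(\slashed\nabla_4+\tfrac32\mathrm{tr}\chi-\tfrac12(\slashed\varepsilon\cdot\chi){}^\star\Big)\Big(\slashed\nabla_3+\tfrac12\mathrm{tr}\underline\chi+\tfrac12(\slashed\varepsilon\cdot\underline\chi){}^\star\Big)\alpha-(\slashed\nabla+2\eta)\slashed{\mathrm{div}}(\Sigma\alpha)+{}^\star(\slashed\nabla+2\eta)\slashed{\mathrm{curl}}(\Sigma\alpha)=0,$$ $$\Big(\slashed\nabla_3+\tfrac32\mathrm{tr}\underline\chi-\tfrac12(\slashed\varepsilon\cdot\underline\chi){}^\star\Big)\Big(\slashed\nabla_4+\tfrac12\mathrm{tr}\chi+\tfrac12(\slashed\varepsilon\cdot\chi){}^\star+\hat\omega\Big)\underline\alpha-(\slashed\nabla+2\underline\eta)\slashed{\mathrm{div}}\,\underline\alpha+{}^\star(\slashed\nabla+2\underline\eta)\slashed{\mathrm{curl}}\,\underline\alpha=0.$$ Tensorial Teukolsky–Starobinsky identities: $$\frac1\Sigma\Big(\slashed\nabla_3+\tfrac12\mathrm{tr}\underline\chi+\tfrac32(\slashed\varepsilon\cdot\underline\chi){}^\star\Big)\Big[\Sigma\Big(\slashed\nabla_3+\tfrac12\mathrm{tr}\underline\chi+\tfrac12(\slashed\varepsilon\cdot\underline\chi){}^\star\Big)\alpha\Big]=-(\slashed\nabla+2\eta)\slashed{\mathrm{div}}\,\underline\alpha-{}^\star(\slashed\nabla+2\eta)\slashed{\mathrm{curl}}\,\underline\alpha,$$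 $$\Big(\slashed\nabla_4+\tfrac12\mathrm{tr}\chi+\tfrac32(\slashed\varepsilon\cdot\chi){}^\star\Big)\Big[\Sigma\Big(\slashed\nabla_4+\hat\omega+\tfrac12\mathrm{tr}\chi+\tfrac12(\slashed\varepsilon\cdot\chi){}^\star\Big)\underline\alpha\Big]=-(\slashed\nabla+2\underline\eta)\slashed{\mathrm{div}}(\Sigma\alpha)-{}^\star(\slashed\nabla+2\underline\eta)\slashed{\mathrm{curl}}(\Sigma\alpha).$$ -/

import Mathlib

open scoped ContDiff

/-! # Horizontal tensor calculus on the Kerr exterior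

The Kerr exterior `ℝ × [r₊, ∞) × 𝕊²`, with Kerr coordinates `(t, r, θ, φ)` (ingoing, regular
on the future event horizon `r = r₊`), is realised in one global chart through the diffeomorphism
`(t, r, ω) ↦ (t, r ω)` onto `{(t, x, y, z) : r = |(x, y, z)| ≥ r₊}`. Thus `x = r sin θ cos φ`,
`y = r sin θ sin φ`, `z = r cos θ`; the chart covers the horizon and the rotation axis.
Tensor fields are given by their components in the coordinates `(t, x, y, z)`. -/

namespace KerrMaxwell

/-- Points, with coordinates `(t, x, y, z)`. -/
abbrev Pt := Fin 4 → ℝ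

/-- Component functions of a one-form. -/
abbrev OneForm := Pt → Fin 4 → ℝ

/-- Component functions of a vector field. -/
abbrev VecField := Pt → Fin 4 → ℝ

/-- Component functions of a covariant two-tensor. -/
abbrev TwoTensor := Pt → Fin 4 → Fin 4 → ℝ

noncomputable section

/-! ### The manifold and the metric -/

/-- The radii `r₊` and `r₋`. -/
def rPlus (M a : ℝ) : ℝ := M + √(M ^ 2 - a ^ 2)

def rMinus (M a : ℝ) : ℝ := M - √(M ^ 2 - a ^ 2)

/-- The coordinate `r`. -/
def rad (p : Pt) : ℝ := √(p 1 ^ 2 + p 2 ^ 2 + p 3 ^ 2)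

/-- The function `cos θ`. -/
def cosTheta (p : Pt) : ℝ := p 3 / rad p

/-- The exterior as a manifold with boundary; the boundary `r = r₊` is the event horizon. -/
def exterior (M a : ℝ) : Set Pt := {p | rPlus M a ≤ rad p}

/-- `Δ = (r - r₊)(r - r₋)`. -/
def bigDelta (M a : ℝ) (p : Pt) : ℝ := (rad p - rPlus M a) * (rad p - rMinus M a)

/-- `Σ = r² + a² cos² θ`. -/
def bigSigma (a : ℝ) (p : Pt) : ℝ := rad p ^ 2 + a ^ 2 * cosTheta p ^ 2

/-- The one-form `dt`. -/
def dT : OneForm := fun _ => ![1, 0, 0, 0]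

/-- The one-form `dr`. -/
def dR : OneForm := fun p => ![0, p 1 / rad p, p 2 / rad p, p 3 / rad p]

/-- The one-form `sin² θ dφ = (x dy - y dx) / r²`, smooth across the axis. -/
def sinSqDPhi : OneForm := fun p => ![0, -p 2 / rad p ^ 2, p 1 / rad p ^ 2, 0]

/-- The unit round metric `dθ² + sin² θ dφ² = (dx² + dy² + dz² - dr²) / r²`. -/
def roundMetric : TwoTensor := fun p i j =>
  ((if i = j ∧ i ≠ 0 then 1 else 0) - dR p i * dR p j) / rad p ^ 2

/-- The Kerr metric in Kerr coordinates,
`-(1 - 2Mr/Σ) dt² + 2 dt dr + Σ dθ² + Σ⁻¹ ((r² + a²)² - Δ a² sin² θ) sin² θ dφ²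
  - 2 a sin² θ dr dφ - 4 a M r Σ⁻¹ sin² θ dt dφ`,
where `Σ dθ² + Σ⁻¹ ((r² + a²)² - Δ a² sin² θ) sin² θ dφ²` is rewritten as
`Σ (dθ² + sin² θ dφ²) + a² (1 + 2Mr/Σ) (sin² θ dφ)²` so that it is smooth across the axis. -/
def metric (M a : ℝ) (p : Pt) : Matrix (Fin 4) (Fin 4) ℝ := Matrix.of fun i j =>
  -(1 - 2 * M * rad p / bigSigma a p) * (dT p i * dT p j)
    + (dT p i * dR p j + dR p i * dT p j)
    + bigSigma a p * roundMetric p i j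
    + a ^ 2 * (1 + 2 * M * rad p / bigSigma a p) * (sinSqDPhi p i * sinSqDPhi p j)
    - a * (dR p i * sinSqDPhi p j + sinSqDPhi p i * dR p j)
    - 2 * a * M * rad p / bigSigma a p * (dT p i * sinSqDPhi p j + sinSqDPhi p i * dT p j)

/-- The inverse metric `g^{ij}`. -/
def metricInv (M a : ℝ) (p : Pt) : Matrix (Fin 4) (Fin 4) ℝ := (metric M a p)⁻¹

/-- Coordinate partial derivative `∂ᵢ f` on the exterior (one-sided at the boundary). -/
def pd (M a : ℝ) (i : Fin 4) (f : Pt → ℝ) (p : Pt) : ℝ :=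
  fderivWithin ℝ f (exterior M a) p (Pi.single i 1)

/-! ### The Levi-Civita connection -/

/-- Christoffel symbols `Γ^k_{ij}`. -/
def christoffel (M a : ℝ) (k i j : Fin 4) (p : Pt) : ℝ :=
  (1 / 2) * ∑ l, metricInv M a p k l *
    (pd M a i (fun q => metric M a q j l) p + pd M a j (fun q => metric M a q i l) p
      - pd M a l (fun q => metric M a q i j) p)

/-- `(∇ᵢ V)^k` for a vector field `V`. -/
def covVec (M a : ℝ) (V : VecField) (p : Pt) (i k : Fin 4) : ℝ :=
  pd M a i (fun q => V q k) p + ∑ j, christoffel M a k i j p * V p j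

/-- `(∇ᵢ ς)ⱼ` for a one-form `ς`. -/
def covForm (M a : ℝ) (ς : OneForm) (p : Pt) (i j : Fin 4) : ℝ :=
  pd M a i (fun q => ς q j) p - ∑ k, christoffel M a k i j p * ς p k

/-! ### The algebraically special frame and its horizontal distribution -/

/-- `e₃ = -∂_r`; in Boyer–Lindquist coordinates,
`e₃ = Δ⁻¹ (r² + a²) ∂_t - ∂_r + Δ⁻¹ a ∂_φ`. -/
def e3 : VecField := fun p => ![0, -(p 1 / rad p), -(p 2 / rad p), -(p 3 / rad p)]

/-- `e₄ = Σ⁻¹ (2 (r² + a²) ∂_t + Δ ∂_r + 2 a ∂_φ)`; in Boyer–Lindquist coordinates,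
`e₄ = Σ⁻¹ ((r² + a²) ∂_t + Δ ∂_r + a ∂_φ)`. -/
def e4 (M a : ℝ) : VecField := fun p =>
  (bigSigma a p)⁻¹ •
    ((2 * (rad p ^ 2 + a ^ 2)) • ![1, 0, 0, 0]
      + bigDelta M a p • ![0, p 1 / rad p, p 2 / rad p, p 3 / rad p]
      + (2 * a) • ![0, -p 2, p 1, 0])

/-- The inner product `g(u, v)` at `p`. -/
def inner4 (M a : ℝ) (p : Pt) (u v : Fin 4 → ℝ) : ℝ := ∑ i, ∑ j, metric M a p i j * u i * v j

/-- The one-form `g(V, ·)`. -/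
def flat (M a : ℝ) (V : VecField) : OneForm := fun p j => ∑ i, metric M a p i j * V p i

/-- The matrix `Π^i_j` of the orthogonal projection onto the horizontal distribution
`⟨e₃, e₄⟩^⊥` (recall `g(e₃, e₄) = -2`). -/
def proj (M a : ℝ) (p : Pt) (i j : Fin 4) : ℝ :=
  (if i = j then 1 else 0)
    + (1 / 2) * (e3 p i * flat M a (e4 M a) p j + e4 M a p i * flat M a e3 p j)

/-- Restriction of a one-form to the horizontal distribution. Horizontal tensors are
identified with their canonical extensions, the spacetime tensors which vanish as soon as
one argument is `e₃` or `e₄`. -/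
def horiz (M a : ℝ) (ς : OneForm) : OneForm := fun p j => ∑ k, ς p k * proj M a p k j

/-- `ς` is (the canonical extension of) a horizontal one-form on `U`. -/
def IsHorizontal (M a : ℝ) (U : Set Pt) (ς : OneForm) : Prop :=
  ∀ p ∈ U, ∑ i, ς p i * e3 p i = 0 ∧ ∑ i, ς p i * e4 M a p i = 0

/-- The inverse of the induced metric on the horizontal distribution. -/
def hInv (M a : ℝ) (p : Pt) (i j : Fin 4) : ℝ :=
  metricInv M a p i j + (1 / 2) * (e3 p i * e4 M a p j + e4 M a p i * e3 p j)

/-- The area form `sin θ dθ ∧ dφ` of the unit sphere. -/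
def roundArea : TwoTensor := fun p i j =>
  (!![0, 0, 0, 0;
      0, 0, p 3, -p 2;
      0, -p 3, 0, p 1;
      0, p 2, -p 1, 0] : Matrix (Fin 4) (Fin 4) ℝ) i j / rad p ^ 3

/-- The one-form `d(cos θ)`. -/
def dCosTheta : OneForm := fun p =>
  ![0, -(p 3 * p 1) / rad p ^ 3, -(p 3 * p 2) / rad p ^ 3, 1 / rad p - p 3 ^ 2 / rad p ^ 3]

/-- The horizontal volume form
`sin θ dθ ∧ ((r² + a²) dφ - a dt) = (r² + a²) sin θ dθ ∧ dφ + a d(cos θ) ∧ dt`.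
It vanishes on `e₃`, `e₄`, and equals `1` on the oriented orthonormal horizontal frame
`e₁ = Σ⁻¹ (a² sin θ cos θ ∂_t + r ∂_θ + a cot θ ∂_φ)`,
`e₂ = Σ⁻¹ (a r sin θ ∂_t - a cos θ ∂_θ + r (sin θ)⁻¹ ∂_φ)` away from the axis. -/
def eps (a : ℝ) : TwoTensor := fun p i j =>
  (rad p ^ 2 + a ^ 2) * roundArea p i j + a * (dCosTheta p i * dT p j - dT p i * dCosTheta p j)

/-! ### Horizontal algebra -/

/-- `(ς, τ) = g^{AB} ς_A τ_B`. -/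
def hDot (M a : ℝ) (ς τ : OneForm) (p : Pt) : ℝ := ∑ i, ∑ j, hInv M a p i j * ς p i * τ p j

/-- `ε^{AB}`. -/
def epsUp (M a : ℝ) (p : Pt) (i j : Fin 4) : ℝ :=
  ∑ k, ∑ l, hInv M a p i k * hInv M a p j l * eps a p k l

/-- `ς ∧ τ = ε^{AB} ς_A τ_B`. -/
def hWedge (M a : ℝ) (ς τ : OneForm) (p : Pt) : ℝ := ∑ i, ∑ j, epsUp M a p i j * ς p i * τ p j

/-- Horizontal Hodge dual `(⋆ς)_A = g^{BC} ε_{AC} ς_B`. -/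
def hStar (M a : ℝ) (ς : OneForm) : OneForm := fun p i =>
  ∑ j, ∑ k, eps a p i k * hInv M a p j k * ς p j

/-- `(θ^{♯₂} · ς)_A = g^{BC} θ_{AC} ς_B`. -/
def sharpDot (M a : ℝ) (θ : TwoTensor) (ς : OneForm) : OneForm := fun p i =>
  ∑ j, ∑ k, hInv M a p j k * θ p i k * ς p j

/-- The trace `g^{AB} θ_{AB}`. -/
def hTr (M a : ℝ) (θ : TwoTensor) (p : Pt) : ℝ := ∑ i, ∑ j, hInv M a p i j * θ p i j

/-- The antitrace `ε · θ = ε^{AB} θ_{AB}`. -/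
def epsDot (M a : ℝ) (θ : TwoTensor) (p : Pt) : ℝ := ∑ i, ∑ j, epsUp M a p i j * θ p i j

/-! ### Connection coefficients -/

/-- `∇_X V`. -/
def covAlong (M a : ℝ) (X V : VecField) : VecField := fun p k =>
  ∑ i, X p i * covVec M a V p i k

/-- `(A, B) ↦ g(∇_A V, e_B)` on the horizontal distribution. -/
def secondFund (M a : ℝ) (V : VecField) : TwoTensor := fun p i j =>
  ∑ k, ∑ l, ∑ m, proj M a p k i * proj M a p l j * metric M a p m l * covVec M a V p k m

/-- `χ_{AB} = g(∇_A e₄, e_B)`. -/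
def chi (M a : ℝ) : TwoTensor := secondFund M a (e4 M a)

/-- `χ̲_{AB} = g(∇_A e₃, e_B)`. -/
def chiBar (M a : ℝ) : TwoTensor := secondFund M a e3

def trChi (M a : ℝ) : Pt → ℝ := hTr M a (chi M a)

def trChiBar (M a : ℝ) : Pt → ℝ := hTr M a (chiBar M a)

def epsChi (M a : ℝ) : Pt → ℝ := epsDot M a (chi M a)

def epsChiBar (M a : ℝ) : Pt → ℝ := epsDot M a (chiBar M a)

/-- `η_A = ½ g(∇_{e₃} e₄, e_A)`. -/
def eta (M a : ℝ) : OneForm := fun p j =>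
  (1 / 2) * horiz M a (flat M a (covAlong M a e3 (e4 M a))) p j

/-- `η̲_A = ½ g(∇_{e₄} e₃, e_A)`. -/
def etaBar (M a : ℝ) : OneForm := fun p j =>
  (1 / 2) * horiz M a (flat M a (covAlong M a (e4 M a) e3)) p j

/-- `ω̂ = ½ g(∇_{e₄} e₃, e₄)`, so that `∇_{e₄} e₄ = ω̂ e₄`. -/
def omegaHat (M a : ℝ) (p : Pt) : ℝ :=
  (1 / 2) * inner4 M a p (covAlong M a (e4 M a) e3 p) (e4 M a p)

/-! ### Horizontal differential operators -/

/-- Derivative `X(f)` of a scalar. -/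
def dirDeriv (M a : ℝ) (X : VecField) (f : Pt → ℝ) (p : Pt) : ℝ := ∑ i, X p i * pd M a i f p

/-- Induced connection on horizontal one-forms:
`(∇̸_X ς)(Y) = X(ς(Y)) - ς(Π ∇_X Y)` for horizontal `Y`, that is `∇̸_X ς = (∇_X ς) ∘ Π`. -/
def nab (M a : ℝ) (X : VecField) (ς : OneForm) : OneForm :=
  horiz M a fun p j => ∑ i, X p i * covForm M a ς p i j

/-- Horizontal gradient `(∇̸ f)_A = e_A(f)`. -/
def grad (M a : ℝ) (f : Pt → ℝ) : OneForm := horiz M a fun p i => pd M a i f p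

/-- The horizontal two-tensor `(∇̸_A ς)_B`. -/
def nabTensor (M a : ℝ) (ς : OneForm) : TwoTensor := fun p i j =>
  ∑ k, ∑ l, proj M a p k i * proj M a p l j * covForm M a ς p k l

/-- `div ς = g^{AB} (∇̸_A ς)_B`. -/
def hDiv (M a : ℝ) (ς : OneForm) : Pt → ℝ := hTr M a (nabTensor M a ς)

/-- `curl ς = ε^{AB} (∇̸_A ς)_B`. -/
def hCurl (M a : ℝ) (ς : OneForm) : Pt → ℝ := epsDot M a (nabTensor M a ς)

/-- Multiplication of a one-form by a scalar function. -/
def scal (f : Pt → ℝ) (ς : OneForm) : OneForm := fun p => f p • ς p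

/-- `(∇̸₃ + c tr χ̲ + d (ε·χ̲) ⋆) ς`. -/
def op3 (M a c d : ℝ) (ς : OneForm) : OneForm := fun p =>
  nab M a e3 ς p + (c * trChiBar M a p) • ς p + (d * epsChiBar M a p) • hStar M a ς p

/-- `(∇̸₄ + c tr χ + d (ε·χ) ⋆) ς`. -/
def op4 (M a c d : ℝ) (ς : OneForm) : OneForm := fun p =>
  nab M a (e4 M a) ς p + (c * trChi M a p) • ς p + (d * epsChi M a p) • hStar M a ς p

/-- `(∇̸ + 2τ) f = ∇̸f + 2 f τ` for a scalar `f` and a horizontal one-form `τ`. -/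
def gradShift (M a : ℝ) (τ : OneForm) (f : Pt → ℝ) : OneForm := fun p =>
  grad M a f p + (2 * f p) • τ p

/-! ### The Maxwell equations -/

/-- `(α, α̲, ρ, σ)` is a smooth solution on `U` of the source-free Maxwell system relative to the
algebraically special frame. -/
structure IsMaxwellSolution (M a : ℝ) (U : Set Pt) (α αb : OneForm) (ρ σ : Pt → ℝ) : Prop where
  smooth_alpha : ContDiffOn ℝ ∞ α U
  smooth_alphaBar : ContDiffOn ℝ ∞ αb U
  smooth_rho : ContDiffOn ℝ ∞ ρ U
  smooth_sigma : ContDiffOn ℝ ∞ σ U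
  horizontal_alpha : IsHorizontal M a U α
  horizontal_alphaBar : IsHorizontal M a U αb
  e3_sigma : ∀ p ∈ U, dirDeriv M a e3 σ p + trChiBar M a p * σ p
    = -hCurl M a αb p - epsChiBar M a p * ρ p
  e3_rho : ∀ p ∈ U, dirDeriv M a e3 ρ p + trChiBar M a p * ρ p
    = -hDiv M a αb p + epsChiBar M a p * σ p
  e4_sigma : ∀ p ∈ U, dirDeriv M a (e4 M a) σ p + trChi M a p * σ p
    = -hCurl M a α p - hWedge M a (eta M a + etaBar M a) α p + epsChi M a p * ρ p
  e4_rho : ∀ p ∈ U, dirDeriv M a (e4 M a) ρ p + trChi M a p * ρ p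
    = hDiv M a α p + hDot M a (eta M a + etaBar M a) α p - epsChi M a p * σ p
  e3_alpha : ∀ p ∈ U, nab M a e3 α p + sharpDot M a (chiBar M a) α p
    = grad M a ρ p + hStar M a (grad M a σ) p
      + (2 * ρ p) • eta M a p + (2 * σ p) • hStar M a (eta M a) p
  e4_alphaBar : ∀ p ∈ U, nab M a (e4 M a) αb p + sharpDot M a (chi M a) αb p
      + omegaHat M a p • αb p
    = -grad M a ρ p + hStar M a (grad M a σ) p
      - (2 * ρ p) • etaBar M a p + (2 * σ p) • hStar M a (etaBar M a) p

end

end KerrMaxwell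

open KerrMaxwell

/-! Away from the rotation axis the horizontal distribution has an orthonormal frame (e₁, e₂), so a
horizontal one-form ς amounts to one complex function ς(e₁) + iς(e₂) (`cx`). In these terms ⋆ is
multiplication by -i, the induced connection is a derivative plus i times a real coefficient
(`cx_nab`), and with m = e₁ + ie₂ the gradient of a scalar is m, while div + i curl is m̄ plus a
zeroth-order term (`div_add_curl`). With ζ = r + ia cos θ one has ζζ̄ = Σ, and the coefficients that
are needed become rational in ζ, ζ̄, Δ and ia sin θ.

Because χ and χ̲ are shear-free, Maxwell's equations take the form (∇̸₃ + ...)α = (m + 2η)(ρ - iσ),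
(∇̸₄ + ω̂ + ...)α̲ = -(m + 2η̲)(ρ + iσ), while (div ± i curl)(Σα) is Σ times an e₄-transport
operator on ρ ∓ iσ, and (div ± i curl)α̲ is minus an e₃-transport operator on ρ ± iσ. So each of the
four claims compares two second-order expressions in a single function ψ, either ρ - iσ or ρ + iσ:
transport after m + 2τ against m + 2τ after transport. These agree for every smooth ψ, by the
commutators [e₃, m] = ζ⁻¹m and [e₄, m] (a combination of m and e₄). This is the content of
`e4_mShift_etaC`, `e3_mShift_etaBarC`, `e3_mShift_etaC` and `e4_mShift_etaBarC`.

The coefficients are not computed from Christoffel symbols. Koszul's formula (`connCoeff_eq`) gives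
them from the brackets of the null frame (`lieBracket_frame`), and these are computed in spherical
components, which depend on r and θ only. Frame indices 0, 1, 2, 3 stand for e₁, e₂, e₃, e₄.

The frame does not exist on the axis, and derivatives are one-sided on the horizon. The identities
are therefore proved on the dense set `region` and extended by continuity, which requires every term
to be smooth on all of U. -/

namespace KerrMaxwell

open scoped Matrix

/-! ### Spherical components and the null frame -/

section

/-- The distance `r sin θ` from the rotation axis. -/
noncomputable def axisDist (p : Pt) : ℝ := √(p 1 ^ 2 + p 2 ^ 2)

/-- The function `sin θ`. -/
noncomputable def sinTheta (p : Pt) : ℝ := axisDist p / rad p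

/-- The tangent vector with spherical components `(v^t, v^r, v^θ, v^φ)`. -/
noncomputable def sph (p : Pt) (v : Fin 4 → ℝ) : Fin 4 → ℝ :=
  ![v 0,
    v 1 * (p 1 / rad p) + v 2 * (p 3 * p 1 / axisDist p) - v 3 * p 2,
    v 1 * (p 2 / rad p) + v 2 * (p 3 * p 2 / axisDist p) + v 3 * p 1,
    v 1 * (p 3 / rad p) - v 2 * axisDist p]

section OffAxis

variable {p : Pt} (hp : 0 < p 1 ^ 2 + p 2 ^ 2)

include hp

theorem axisDist_pos : 0 < axisDist p := Real.sqrt_pos.2 hp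

theorem rad_pos_of_offAxis : 0 < rad p := Real.sqrt_pos.2 (by positivity)

end OffAxis

theorem axisDist_sq (p : Pt) : axisDist p ^ 2 = p 1 ^ 2 + p 2 ^ 2 :=
  Real.sq_sqrt (by positivity)

theorem rad_sq (p : Pt) : rad p ^ 2 = p 1 ^ 2 + p 2 ^ 2 + p 3 ^ 2 :=
  Real.sq_sqrt (by positivity)

theorem sinTheta_sq {p : Pt} (hr : 0 < rad p) : sinTheta p ^ 2 = 1 - cosTheta p ^ 2 := by
  have h1 := rad_sq p
  have h2 := axisDist_sq p
  unfold sinTheta cosTheta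
  field_simp
  linarith

theorem bigSigma_pos (a : ℝ) {p : Pt} (hr : 0 < rad p) : 0 < bigSigma a p := by
  unfold bigSigma; positivity

theorem dT_dotProduct (p : Pt) (v : Fin 4 → ℝ) : dT p ⬝ᵥ v = v 0 := by
  simp [dT, dotProduct, Fin.sum_univ_four]

variable {p : Pt}

theorem dR_sph (hp : 0 < p 1 ^ 2 + p 2 ^ 2) (v : Fin 4 → ℝ) : dR p ⬝ᵥ sph p v = v 1 := by
  have h1 := rad_sq p
  have h2 := axisDist_sq p
  have h3 := axisDist_pos hp
  have h4 := rad_pos_of_offAxis hp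
  simp only [dR, sph, dotProduct, Fin.sum_univ_four]
  simp
  field_simp
  linear_combination (-v 1 * axisDist p) * h1 - v 2 * rad p * p 3 * h2

theorem sinSqDPhi_sph (hp : 0 < p 1 ^ 2 + p 2 ^ 2) (v : Fin 4 → ℝ) :
    sinSqDPhi p ⬝ᵥ sph p v = sinTheta p ^ 2 * v 3 := by
  have h2 := axisDist_sq p
  have h3 := axisDist_pos hp
  have h4 := rad_pos_of_offAxis hp
  simp only [sinSqDPhi, sph, dotProduct, Fin.sum_univ_four, sinTheta]
  simp
  field_simp
  linear_combination (-v 3 * axisDist p * rad p) * h2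

/-- The metric is assembled from dt, dr, sin²θ dφ and the Euclidean product in (x, y, z), so
evaluating it on spherical components reduces to `dR_sph`, `sinSqDPhi_sph` and `sph_spatial`. -/
theorem inner4_eq (M a : ℝ) (p : Pt) (u v : Fin 4 → ℝ) :
    inner4 M a p u v =
      -(1 - 2 * M * rad p / bigSigma a p) * ((dT p ⬝ᵥ u) * (dT p ⬝ᵥ v))
      + ((dT p ⬝ᵥ u) * (dR p ⬝ᵥ v) + (dR p ⬝ᵥ u) * (dT p ⬝ᵥ v))
      + bigSigma a p * ((u 1 * v 1 + u 2 * v 2 + u 3 * v 3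
          - (dR p ⬝ᵥ u) * (dR p ⬝ᵥ v)) / rad p ^ 2)
      + a ^ 2 * (1 + 2 * M * rad p / bigSigma a p)
          * ((sinSqDPhi p ⬝ᵥ u) * (sinSqDPhi p ⬝ᵥ v))
      - a * ((dR p ⬝ᵥ u) * (sinSqDPhi p ⬝ᵥ v) + (sinSqDPhi p ⬝ᵥ u) * (dR p ⬝ᵥ v))
      - 2 * a * M * rad p / bigSigma a p
          * ((dT p ⬝ᵥ u) * (sinSqDPhi p ⬝ᵥ v) + (sinSqDPhi p ⬝ᵥ u) * (dT p ⬝ᵥ v)) := by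
  simp only [inner4, metric, Matrix.of_apply, roundMetric, dotProduct, Fin.sum_univ_four]
  simp
  ring

theorem sph_spatial (hp : 0 < p 1 ^ 2 + p 2 ^ 2) (u v : Fin 4 → ℝ) :
    sph p u 1 * sph p v 1 + sph p u 2 * sph p v 2 + sph p u 3 * sph p v 3 =
      u 1 * v 1 + rad p ^ 2 * (u 2 * v 2 + sinTheta p ^ 2 * (u 3 * v 3)) := by
  have h1 := rad_sq p
  have h2 := axisDist_sq p
  have h3 := axisDist_pos hp
  have h4 := rad_pos_of_offAxis hp
  simp only [sph, sinTheta]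
  simp
  have hz : p 3 ^ 2 = rad p ^ 2 - axisDist p ^ 2 := by linarith
  have hx : p 1 ^ 2 = axisDist p ^ 2 - p 2 ^ 2 := by linarith
  field_simp
  ring_nf
  simp only [hz, hx]
  ring

/-- The Kerr metric in spherical components. -/
theorem inner4_sph (M a : ℝ) (hp : 0 < p 1 ^ 2 + p 2 ^ 2) (u v : Fin 4 → ℝ) :
    inner4 M a p (sph p u) (sph p v) =
      -(1 - 2 * M * rad p / bigSigma a p) * (u 0 * v 0) + (u 0 * v 1 + u 1 * v 0)
      + bigSigma a p * (u 2 * v 2 + sinTheta p ^ 2 * (u 3 * v 3))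
      + a ^ 2 * (1 + 2 * M * rad p / bigSigma a p) * sinTheta p ^ 4 * (u 3 * v 3)
      - a * sinTheta p ^ 2 * (u 1 * v 3 + u 3 * v 1)
      - 2 * a * M * rad p / bigSigma a p * sinTheta p ^ 2 * (u 0 * v 3 + u 3 * v 0) := by
  have h4 := rad_pos_of_offAxis hp
  rw [inner4_eq, sph_spatial hp, dR_sph hp, dR_sph hp, sinSqDPhi_sph hp, sinSqDPhi_sph hp,
    dT_dotProduct, dT_dotProduct]
  simp only [sph, Matrix.cons_val_zero]
  field_simp
  ring

/-- The horizontal frame field `e₁`. -/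
noncomputable def e1Comp (a : ℝ) (p : Pt) : Fin 4 → ℝ :=
  ![a ^ 2 * sinTheta p * cosTheta p / bigSigma a p, 0, rad p / bigSigma a p,
    a * cosTheta p / (sinTheta p * bigSigma a p)]

noncomputable def e2Comp (a : ℝ) (p : Pt) : Fin 4 → ℝ :=
  ![a * rad p * sinTheta p / bigSigma a p, 0, -(a * cosTheta p / bigSigma a p),
    rad p / (sinTheta p * bigSigma a p)]

noncomputable def e3Comp : Fin 4 → ℝ := ![0, -1, 0, 0]

noncomputable def e4Comp (M a : ℝ) (p : Pt) : Fin 4 → ℝ :=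
  ![2 * (rad p ^ 2 + a ^ 2) / bigSigma a p, bigDelta M a p / bigSigma a p, 0,
    2 * a / bigSigma a p]

/-- Spherical components of the frame `(e₁, e₂, e₃, e₄)`. -/
noncomputable def frameComp (M a : ℝ) (b : Fin 4) (p : Pt) : Fin 4 → ℝ :=
  (![e1Comp a p, e2Comp a p, e3Comp, e4Comp M a p] : Fin 4 → Fin 4 → ℝ) b

/-- The frame `(e₁, e₂, e₃, e₄)`. -/
noncomputable def frame (M a : ℝ) (b : Fin 4) : VecField := fun p => sph p (frameComp M a b p)

theorem frame_two (M a : ℝ) : frame M a 2 = e3 := by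
  funext p i
  fin_cases i <;> simp [frame, frameComp, e3Comp, sph, e3]

theorem frame_three (M a : ℝ) : frame M a 3 = e4 M a := by
  funext p i
  fin_cases i <;> simp [frame, frameComp, e4Comp, sph, e4] <;> ring

/-- The components of the metric in the null frame. -/
def eta4 : Matrix (Fin 4) (Fin 4) ℝ :=
  !![1, 0, 0, 0; 0, 1, 0, 0; 0, 0, 0, -2; 0, 0, -2, 0]

/-- Here |a| ≤ M enters: it makes M² - a² nonnegative, so that the square root in r± squares back.
-/
theorem bigDelta_eq (M a : ℝ) (ha : |a| ≤ M) (p : Pt) :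
    bigDelta M a p = rad p ^ 2 - 2 * M * rad p + a ^ 2 := by
  have h : √(M ^ 2 - a ^ 2) ^ 2 = M ^ 2 - a ^ 2 :=
    Real.sq_sqrt (by nlinarith [abs_le.1 ha, sq_abs a, abs_nonneg a])
  unfold bigDelta rPlus rMinus
  linear_combination -h

theorem inner4_comm (M a : ℝ) (p : Pt) (u v : Fin 4 → ℝ) :
    inner4 M a p u v = inner4 M a p v u := by
  rw [inner4_eq, inner4_eq]; ring

theorem sinTheta_pos (hp : 0 < p 1 ^ 2 + p 2 ^ 2) : 0 < sinTheta p :=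
  div_pos (axisDist_pos hp) (rad_pos_of_offAxis hp)

theorem inner4_frame (M a : ℝ) (ha : |a| ≤ M) (hp : 0 < p 1 ^ 2 + p 2 ^ 2) (b c : Fin 4) :
    inner4 M a p (frame M a b p) (frame M a c p) = eta4 b c := by
  wlog h : b ≤ c generalizing b c
  · rw [inner4_comm, this c b (le_of_not_ge h)]
    fin_cases b <;> fin_cases c <;> simp [eta4]
  have hr := rad_pos_of_offAxis hp
  have hs := sinTheta_pos hp
  have hS := bigSigma_pos a hr
  have hSdef : bigSigma a p = rad p ^ 2 + a ^ 2 * (1 - sinTheta p ^ 2) := by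
    rw [sinTheta_sq hr, bigSigma]; ring
  have hc : cosTheta p ^ 2 = 1 - sinTheta p ^ 2 := by rw [sinTheta_sq hr]; ring
  have hD := bigDelta_eq M a ha p
  rw [frame, frame, inner4_sph M a hp]
  fin_cases b <;> fin_cases c <;> first | (exfalso; revert h; decide) | skip
  all_goals simp [frameComp, e1Comp, e2Comp, e3Comp, e4Comp, eta4]
  -- The functions r, sin θ, cos θ, Σ, Δ are replaced by indeterminates tied only by cos² = 1 - sin²
  -- and the formulas for Σ and Δ; each entry is then a rational identity modulo these relations.
  all_goals
    rw [← sub_eq_zero]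
    clear h
    generalize rad p = r at *
    generalize sinTheta p = s at *
    generalize cosTheta p = c' at *
    generalize bigSigma a p = S at *
    generalize bigDelta M a p = D at *
    subst hD
    have hs' := hs.ne'
    have hS' := hS.ne'
    clear hs hS hr ha hp
    field_simp
    first | done | grind

end

/-! ### Smoothness of the background tensors; the frame as a basis -/

section

variable {p : Pt}

section Smooth

variable {n : ℕ∞ω}

theorem contDiffAt_coord (i : Fin 4) : ContDiffAt ℝ n (fun q : Pt => q i) p :=
  contDiffAt_apply (𝕜 := ℝ) (E := ℝ) i p

theorem contDiffAt_rad (hr : 0 < rad p) : ContDiffAt ℝ n rad p := by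
  have h : p 1 ^ 2 + p 2 ^ 2 + p 3 ^ 2 ≠ 0 := by rw [← rad_sq]; positivity
  have h1 := contDiffAt_coord (p := p) (n := n) 1
  have h2 := contDiffAt_coord (p := p) (n := n) 2
  have h3 := contDiffAt_coord (p := p) (n := n) 3
  exact (((h1.pow 2).add (h2.pow 2)).add (h3.pow 2)).sqrt h

theorem contDiffAt_cosTheta (hr : 0 < rad p) : ContDiffAt ℝ n cosTheta p :=
  (contDiffAt_coord 3).div (contDiffAt_rad hr) hr.ne'

theorem contDiffAt_bigSigma (a : ℝ) (hr : 0 < rad p) : ContDiffAt ℝ n (bigSigma a) p :=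
  ((contDiffAt_rad hr).pow 2).add (contDiffAt_const.mul ((contDiffAt_cosTheta hr).pow 2))

theorem contDiffAt_bigDelta (M a : ℝ) (hr : 0 < rad p) : ContDiffAt ℝ n (bigDelta M a) p :=
  ((contDiffAt_rad hr).sub contDiffAt_const).mul ((contDiffAt_rad hr).sub contDiffAt_const)

theorem contDiffAt_dT (i : Fin 4) : ContDiffAt ℝ n (fun q => dT q i) p := contDiffAt_const

theorem contDiffAt_dR (hr : 0 < rad p) (i : Fin 4) : ContDiffAt ℝ n (fun q => dR q i) p := by
  fin_cases i
  · exact contDiffAt_const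
  all_goals exact (contDiffAt_coord _).div (contDiffAt_rad hr) hr.ne'

theorem contDiffAt_sinSqDPhi (hr : 0 < rad p) (i : Fin 4) :
    ContDiffAt ℝ n (fun q => sinSqDPhi q i) p := by
  have h2 : rad p ^ 2 ≠ 0 := by positivity
  fin_cases i
  · exact contDiffAt_const
  · exact (contDiffAt_coord _).neg.div ((contDiffAt_rad hr).pow 2) h2
  · exact (contDiffAt_coord _).div ((contDiffAt_rad hr).pow 2) h2
  · exact contDiffAt_const

theorem contDiffAt_roundMetric (hr : 0 < rad p) (i j : Fin 4) :
    ContDiffAt ℝ n (fun q => roundMetric q i j) p :=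
  (contDiffAt_const.sub ((contDiffAt_dR hr i).mul (contDiffAt_dR hr j))).div
    ((contDiffAt_rad hr).pow 2) (by positivity)

theorem contDiffAt_metric (M a : ℝ) (hr : 0 < rad p) (i j : Fin 4) :
    ContDiffAt ℝ n (fun q => metric M a q i j) p := by
  have hS := bigSigma_pos a hr
  have h1 := contDiffAt_rad (n := n) hr
  have h2 := contDiffAt_bigSigma (n := n) a hr
  have hT := fun i => contDiffAt_dT (n := n) (p := p) i
  have hR := fun i => contDiffAt_dR (n := n) hr i
  have hP := fun i => contDiffAt_sinSqDPhi (n := n) hr i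
  have h3 : ContDiffAt ℝ n (fun q => 2 * M * rad q / bigSigma a q) p :=
    (contDiffAt_const.mul h1).div h2 hS.ne'
  have h4 : ContDiffAt ℝ n (fun q => 2 * a * M * rad q / bigSigma a q) p :=
    (contDiffAt_const.mul h1).div h2 hS.ne'
  exact ((((((contDiffAt_const.sub h3).neg.mul ((hT i).mul (hT j))).add
    (((hT i).mul (hR j)).add ((hR i).mul (hT j)))).add
    (h2.mul (contDiffAt_roundMetric hr i j))).add
    ((contDiffAt_const.mul (contDiffAt_const.add h3)).mul ((hP i).mul (hP j)))).sub
    (contDiffAt_const.mul (((hR i).mul (hP j)).add ((hP i).mul (hR j))))).sub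
    (h4.mul (((hT i).mul (hP j)).add ((hP i).mul (hT j))))

theorem contDiffAt_e3 (hr : 0 < rad p) (i : Fin 4) : ContDiffAt ℝ n (fun q => e3 q i) p := by
  fin_cases i
  · exact contDiffAt_const
  all_goals exact ((contDiffAt_coord _).div (contDiffAt_rad hr) hr.ne').neg

theorem contDiffAt_e4 (M a : ℝ) (hr : 0 < rad p) (i : Fin 4) :
    ContDiffAt ℝ n (fun q => e4 M a q i) p := by
  have h1 := contDiffAt_rad (n := n) hr
  have hR := contDiffAt_dR (n := n) hr i
  have hphi : ContDiffAt ℝ n (fun q : Pt => (![0, -q 2, q 1, 0] : Fin 4 → ℝ) i) p := by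
    fin_cases i
    · exact contDiffAt_const
    · exact (contDiffAt_coord _).neg
    · exact contDiffAt_coord _
    · exact contDiffAt_const
  have hS := (contDiffAt_bigSigma (n := n) a hr).inv (bigSigma_pos a hr).ne'
  exact hS.mul ((((contDiffAt_const.mul ((h1.pow 2).add contDiffAt_const)).mul
    contDiffAt_const).add ((contDiffAt_bigDelta M a hr).mul hR)).add (contDiffAt_const.mul hphi))

theorem contDiffAt_roundArea (hr : 0 < rad p) (i j : Fin 4) :
    ContDiffAt ℝ n (fun q => roundArea q i j) p := by
  refine ContDiffAt.div ?_ ((contDiffAt_rad hr).pow 3) (by positivity)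
  fin_cases i <;> fin_cases j <;>
    first
    | exact contDiffAt_const
    | exact contDiffAt_coord _
    | exact (contDiffAt_coord _).neg

theorem contDiffAt_dCosTheta (hr : 0 < rad p) (i : Fin 4) :
    ContDiffAt ℝ n (fun q => dCosTheta q i) p := by
  have h1 := contDiffAt_rad (n := n) hr
  have h3 := h1.pow 3
  have h3' : rad p ^ 3 ≠ 0 := by positivity
  fin_cases i
  · exact contDiffAt_const
  · exact ((contDiffAt_coord _).mul (contDiffAt_coord _)).neg.div h3 h3'
  · exact ((contDiffAt_coord _).mul (contDiffAt_coord _)).neg.div h3 h3'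
  · exact (contDiffAt_const.div h1 hr.ne').sub (((contDiffAt_coord _).pow 2).div h3 h3')

theorem contDiffAt_eps (a : ℝ) (hr : 0 < rad p) (i j : Fin 4) :
    ContDiffAt ℝ n (fun q => eps a q i j) p := by
  have h1 := contDiffAt_rad (n := n) hr
  exact (((h1.pow 2).add contDiffAt_const).mul (contDiffAt_roundArea hr i j)).add
    (contDiffAt_const.mul (((contDiffAt_dCosTheta hr i).mul (contDiffAt_dT j)).sub
      ((contDiffAt_dT i).mul (contDiffAt_dCosTheta hr j))))

end Smooth

theorem metric_comm (M a : ℝ) (p : Pt) (i j : Fin 4) : metric M a p i j = metric M a p j i := by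
  simp only [metric, Matrix.of_apply, roundMetric, eq_comm (a := i) (b := j)]
  by_cases h : j = i
  · subst h; ring
  · simp [h]; ring

/-- The part of the exterior off the horizon and off the rotation axis. -/
def region (M a : ℝ) : Set Pt := {p | rPlus M a < rad p ∧ 0 < p 1 ^ 2 + p 2 ^ 2}

theorem continuous_rad : Continuous rad := by unfold rad; fun_prop

theorem isOpen_region (M a : ℝ) : IsOpen (region M a) :=
  (isOpen_lt continuous_const continuous_rad).inter
    (isOpen_lt continuous_const (by fun_prop : Continuous fun p : Pt => p 1 ^ 2 + p 2 ^ 2))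

theorem region_subset (M a : ℝ) : region M a ⊆ exterior M a := fun _ h => h.1.le

variable {M a : ℝ}

/-- Points of `region` are interior to the exterior, so the one-sided derivative is the ordinary
one. This is why the horizon is excluded from `region`. -/
theorem pd_eq_fderiv (hp : p ∈ region M a) (i : Fin 4) (f : Pt → ℝ) :
    pd M a i f p = fderiv ℝ f p (Pi.single i 1) := by
  rw [pd, fderivWithin_of_mem_nhds]
  exact Filter.mem_of_superset ((isOpen_region M a).mem_nhds hp) (region_subset M a)

theorem clm_apply_eq_sum {E : Type*} [NormedAddCommGroup E] [NormedSpace ℝ E]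
    (L : Pt →L[ℝ] E) (v : Fin 4 → ℝ) :
    L v = ∑ i, v i • L (Pi.single i 1) := by
  conv_lhs => rw [pi_eq_sum_univ' v]
  simp only [map_sum, map_smul]

theorem dirDeriv_eq_fderiv (hp : p ∈ region M a) (X : VecField) (f : Pt → ℝ) :
    dirDeriv M a X f p = fderiv ℝ f p (X p) := by
  rw [clm_apply_eq_sum (fderiv ℝ f p) (X p)]
  simp [dirDeriv, pd_eq_fderiv hp]

/-- The matrix whose columns are the frame. -/
noncomputable def frameMatrix (M a : ℝ) (p : Pt) : Matrix (Fin 4) (Fin 4) ℝ :=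
  Matrix.of fun i b => frame M a b p i

noncomputable def eta4Inv : Matrix (Fin 4) (Fin 4) ℝ :=
  !![1, 0, 0, 0; 0, 1, 0, 0; 0, 0, 0, -(1 / 2); 0, 0, -(1 / 2), 0]

theorem eta4Inv_mul : eta4Inv * eta4 = 1 := by
  ext i j
  fin_cases i <;> fin_cases j <;> simp [eta4Inv, eta4, Matrix.mul_apply, Fin.sum_univ_four]

section Frame

theorem gram (ha : |a| ≤ M) (hp : 0 < p 1 ^ 2 + p 2 ^ 2) :
    (frameMatrix M a p)ᵀ * metric M a p * frameMatrix M a p = eta4 := by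
  ext b c
  rw [← inner4_frame M a ha hp b c]
  simp only [Matrix.mul_apply, Matrix.transpose_apply, frameMatrix, Matrix.of_apply, inner4,
    Finset.sum_mul]
  rw [Finset.sum_comm]
  exact Finset.sum_congr rfl fun i _ => Finset.sum_congr rfl fun j _ => by ring

/-- Write F for the frame matrix and η for `eta4`. The Gram relation FᵀgF = η says that η⁻¹Fᵀg is a
left inverse of F; for square matrices it is also a right inverse. Both g⁻¹ = Fη⁻¹Fᵀ and the
expansion of vectors in the frame follow. -/
theorem frameMatrix_completeness (ha : |a| ≤ M) (hp : 0 < p 1 ^ 2 + p 2 ^ 2) :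
    frameMatrix M a p * (eta4Inv * (frameMatrix M a p)ᵀ * metric M a p) = 1 := by
  rw [mul_eq_one_comm]
  calc _ = eta4Inv * ((frameMatrix M a p)ᵀ * metric M a p * frameMatrix M a p) := by
        simp only [Matrix.mul_assoc]
    _ = 1 := by rw [gram ha hp, eta4Inv_mul]

theorem metricInv_eq (ha : |a| ≤ M) (hp : 0 < p 1 ^ 2 + p 2 ^ 2) :
    metricInv M a p = frameMatrix M a p * (eta4Inv * (frameMatrix M a p)ᵀ) := by
  refine Matrix.inv_eq_left_inv ?_
  rw [Matrix.mul_assoc]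
  exact frameMatrix_completeness ha hp

theorem metric_mul_metricInv (ha : |a| ≤ M) (hp : 0 < p 1 ^ 2 + p 2 ^ 2) :
    metric M a p * metricInv M a p = 1 := by
  rw [metricInv_eq ha hp, mul_eq_one_comm, Matrix.mul_assoc]
  exact frameMatrix_completeness ha hp

/-- The null part of g⁻¹ is -½(e₃ ⊗ e₄ + e₄ ⊗ e₃), exactly what the definition of `hInv` adds back.
-/
theorem hInv_eq (ha : |a| ≤ M) (hp : 0 < p 1 ^ 2 + p 2 ^ 2) (i j : Fin 4) :
    hInv M a p i j = frame M a 0 p i * frame M a 0 p j + frame M a 1 p i * frame M a 1 p j := by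
  rw [hInv, metricInv_eq ha hp, ← frame_two M a, ← frame_three M a]
  simp [Matrix.mul_apply, Fin.sum_univ_four, eta4Inv, frameMatrix, Matrix.vecMul, dotProduct]
  ring

/-- Expansion of a tangent vector in the null frame. -/
theorem frame_expansion (ha : |a| ≤ M) (hp : 0 < p 1 ^ 2 + p 2 ^ 2) (v : Fin 4 → ℝ) :
    v = inner4 M a p v (frame M a 0 p) • frame M a 0 p
      + inner4 M a p v (frame M a 1 p) • frame M a 1 p
      - (inner4 M a p v (e4 M a p) / 2) • e3 p - (inner4 M a p v (e3 p) / 2) • e4 M a p := by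
  have h := congrArg (fun A => A *ᵥ v) (frameMatrix_completeness ha hp)
  simp only [Matrix.one_mulVec, ← Matrix.mulVec_mulVec] at h
  have key : ∀ b, ((frameMatrix M a p)ᵀ *ᵥ (metric M a p *ᵥ v)) b
      = inner4 M a p v (frame M a b p) := by
    intro b
    rw [inner4_comm]
    simp only [Matrix.mulVec, dotProduct, Matrix.transpose_apply, frameMatrix, Matrix.of_apply,
      inner4, Finset.mul_sum]
    exact Finset.sum_congr rfl fun i _ => Finset.sum_congr rfl fun j _ => by ring
  conv_lhs => rw [← h]
  ext i
  simp only [Matrix.mulVec, dotProduct] at key ⊢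
  simp only [key]
  simp [Fin.sum_univ_four, eta4Inv, frameMatrix, frame_two, frame_three]
  ring

theorem oneForm_ext (ha : |a| ≤ M) (hp : 0 < p 1 ^ 2 + p 2 ^ 2) {u v : Fin 4 → ℝ}
    (h : ∀ b, u ⬝ᵥ frame M a b p = v ⬝ᵥ frame M a b p) : u = v := by
  have h1 : u ᵥ* frameMatrix M a p = v ᵥ* frameMatrix M a p := funext h
  have h2 := congrArg (fun w => w ᵥ* (eta4Inv * (frameMatrix M a p)ᵀ * metric M a p)) h1
  simpa only [Matrix.vecMul_vecMul, frameMatrix_completeness ha hp, Matrix.vecMul_one] using h2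

theorem eps_sph (hp : 0 < p 1 ^ 2 + p 2 ^ 2) (u v : Fin 4 → ℝ) :
    ∑ i, ∑ j, eps a p i j * sph p u i * sph p v j =
      sinTheta p * (u 2 * ((rad p ^ 2 + a ^ 2) * v 3 - a * v 0)
        - v 2 * ((rad p ^ 2 + a ^ 2) * u 3 - a * u 0)) := by
  have h1 := rad_sq p
  have h2 := axisDist_sq p
  have h3 := axisDist_pos hp
  have h4 := rad_pos_of_offAxis hp
  have hround : ∑ i, ∑ j, roundArea p i j * sph p u i * sph p v j =
      sinTheta p * (u 2 * v 3 - u 3 * v 2) := by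
    simp only [roundArea, sph, Fin.sum_univ_four, sinTheta]
    simp
    field_simp
    grind
  have hcos : ∀ w, dCosTheta p ⬝ᵥ sph p w = -(sinTheta p * w 2) := by
    intro w
    simp only [dCosTheta, sph, dotProduct, Fin.sum_univ_four, sinTheta]
    simp
    field_simp
    grind
  have hT : ∀ w, dT p ⬝ᵥ sph p w = w 0 := by
    intro w
    rw [dT_dotProduct]; simp [sph]
  calc _ = (rad p ^ 2 + a ^ 2) * ∑ i, ∑ j, roundArea p i j * sph p u i * sph p v j
      + a * ((dCosTheta p ⬝ᵥ sph p u) * (dT p ⬝ᵥ sph p v)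
        - (dT p ⬝ᵥ sph p u) * (dCosTheta p ⬝ᵥ sph p v)) := by
        simp only [eps, dotProduct, Fin.sum_univ_four]; ring
    _ = _ := by rw [hround, hcos, hcos, hT, hT]; ring

/-- The components of the horizontal volume form in the null frame. -/
def area4 : Matrix (Fin 4) (Fin 4) ℝ :=
  !![0, 1, 0, 0; -1, 0, 0, 0; 0, 0, 0, 0; 0, 0, 0, 0]

theorem eps_frame (M : ℝ) (hp : 0 < p 1 ^ 2 + p 2 ^ 2) (b c : Fin 4) :
    ∑ i, ∑ j, eps a p i j * frame M a b p i * frame M a c p j = area4 b c := by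
  have hr := rad_pos_of_offAxis hp
  have hs := sinTheta_pos hp
  have hS := bigSigma_pos a hr
  have hSdef : bigSigma a p = rad p ^ 2 + a ^ 2 * (1 - sinTheta p ^ 2) := by
    rw [sinTheta_sq hr, bigSigma]; ring
  have hc : cosTheta p ^ 2 = 1 - sinTheta p ^ 2 := by rw [sinTheta_sq hr]; ring
  simp only [frame]
  rw [eps_sph hp]
  fin_cases b <;> fin_cases c <;> simp [frameComp, e1Comp, e2Comp, e3Comp, e4Comp, area4]
  all_goals
    rw [← sub_eq_zero]
    generalize rad p = r at *
    generalize sinTheta p = s at *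
    generalize cosTheta p = c' at *
    generalize bigSigma a p = S at *
    have hs' := hs.ne'
    have hS' := hS.ne'
    clear hs hS hr hp
    field_simp
    first | done | grind

end Frame

end

/-! ### Derivatives in spherical components and the brackets of the frame -/

section

variable {p : Pt} {M a : ℝ}

theorem differentiableAt_div {E 𝕜 : Type*} [NormedAddCommGroup E] [NormedSpace ℝ E] [RCLike 𝕜]
    {f g : E → 𝕜} {x : E} (hf : DifferentiableAt ℝ f x) (hg : DifferentiableAt ℝ g x)
    (h : g x ≠ 0) : DifferentiableAt ℝ (fun q => f q / g q) x := by
  simpa only [div_eq_mul_inv] using hf.fun_mul (hg.fun_inv h)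

/-- `f` is differentiable at `p` and `df = fr dr + fθ dθ` there. -/
structure HasSphDeriv {E : Type*} [NormedAddCommGroup E] [NormedSpace ℝ E]
    (f : Pt → E) (fr fθ : E) (p : Pt) : Prop where
  differentiableAt : DifferentiableAt ℝ f p
  hasDerivAt : ∀ u : Fin 4 → ℝ,
    HasDerivAt (fun t : ℝ => f (p + t • sph p u)) (u 1 • fr + u 2 • fθ) 0

namespace HasSphDeriv

section Module

variable {E : Type*} [NormedAddCommGroup E] [NormedSpace ℝ E] {f g : Pt → E} {fr fθ gr gθ : E}

theorem fderiv_sph (h : HasSphDeriv f fr fθ p) (u : Fin 4 → ℝ) :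
    fderiv ℝ f p (sph p u) = u 1 • fr + u 2 • fθ := by
  rw [← h.differentiableAt.lineDeriv_eq_fderiv, lineDeriv, (h.hasDerivAt u).deriv]

theorem congr (h : HasSphDeriv f fr fθ p) (hr : fr = gr) (hθ : fθ = gθ) :
    HasSphDeriv f gr gθ p := hr ▸ hθ ▸ h

theorem const (c : E) : HasSphDeriv (fun _ => c) 0 0 p :=
  ⟨differentiableAt_const c, fun u => by simpa using hasDerivAt_const (0 : ℝ) c⟩

theorem add (hf : HasSphDeriv f fr fθ p) (hg : HasSphDeriv g gr gθ p) :
    HasSphDeriv (fun q => f q + g q) (fr + gr) (fθ + gθ) p :=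
  ⟨hf.1.fun_add hg.1, fun u => ((hf.2 u).fun_add (hg.2 u)).congr_deriv (by module)⟩

theorem sub (hf : HasSphDeriv f fr fθ p) (hg : HasSphDeriv g gr gθ p) :
    HasSphDeriv (fun q => f q - g q) (fr - gr) (fθ - gθ) p :=
  ⟨hf.1.fun_sub hg.1, fun u => ((hf.2 u).fun_sub (hg.2 u)).congr_deriv (by module)⟩

theorem neg (hf : HasSphDeriv f fr fθ p) : HasSphDeriv (fun q => -f q) (-fr) (-fθ) p :=
  ⟨hf.1.fun_neg, fun u => ((hf.2 u).fun_neg).congr_deriv (by module)⟩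

end Module

section Field

variable {𝕜 : Type*} [RCLike 𝕜] {f g : Pt → 𝕜} {fr fθ gr gθ : 𝕜}

theorem mul (hf : HasSphDeriv f fr fθ p) (hg : HasSphDeriv g gr gθ p) :
    HasSphDeriv (fun q => f q * g q) (fr * g p + f p * gr) (fθ * g p + f p * gθ) p :=
  ⟨hf.1.fun_mul hg.1, fun u => ((hf.2 u).fun_mul (hg.2 u)).congr_deriv (by
    simp [Algebra.smul_def]; ring)⟩

theorem sq (hf : HasSphDeriv f fr fθ p) :
    HasSphDeriv (fun q => f q ^ 2) (2 * f p * fr) (2 * f p * fθ) p := by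
  simp only [_root_.sq]
  exact (hf.mul hf).congr (by ring) (by ring)

theorem const_mul (c : 𝕜) (hf : HasSphDeriv f fr fθ p) :
    HasSphDeriv (fun q => c * f q) (c * fr) (c * fθ) p :=
  ((const c).mul hf).congr (by ring) (by ring)

theorem div (hf : HasSphDeriv f fr fθ p) (hg : HasSphDeriv g gr gθ p) (h : g p ≠ 0) :
    HasSphDeriv (fun q => f q / g q) ((fr * g p - f p * gr) / g p ^ 2)
      ((fθ * g p - f p * gθ) / g p ^ 2) p :=
  ⟨differentiableAt_div hf.1 hg.1 h, fun u =>
    ((hf.2 u).fun_div (hg.2 u) (by simpa using h)).congr_deriv (by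
      simp [Algebra.smul_def]; ring)⟩

end Field

theorem ofReal {f : Pt → ℝ} {fr fθ : ℝ} (hf : HasSphDeriv f fr fθ p) :
    HasSphDeriv (fun q => (f q : ℂ)) (fr : ℂ) (fθ : ℂ) p :=
  ⟨Complex.ofRealCLM.differentiableAt.comp p hf.1, fun u =>
    ((hf.2 u).ofReal_comp).congr_deriv (by simp)⟩

end HasSphDeriv

theorem hasDerivAt_coord (w : Fin 4 → ℝ) (i : Fin 4) :
    HasDerivAt (fun t : ℝ => (p + t • w) i) (w i) 0 := by
  have := ((hasDerivAt_id (0 : ℝ)).mul_const (w i)).const_add (p i)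
  simpa using this

section OffAxis

variable (hp : 0 < p 1 ^ 2 + p 2 ^ 2)

include hp

theorem hasSphDeriv_rad : HasSphDeriv rad 1 0 p := by
  have hr := rad_pos_of_offAxis hp
  refine ⟨(contDiffAt_rad (n := 1) hr).differentiableAt one_ne_zero, fun u => ?_⟩
  have h := fun i => hasDerivAt_coord (p := p) (sph p u) i
  have h0 : p 1 ^ 2 + p 2 ^ 2 + p 3 ^ 2 ≠ 0 := by rw [← rad_sq]; positivity
  have h1 := (((h 1).pow 2).add ((h 2).pow 2)).add ((h 3).pow 2) |>.sqrt (by simpa using h0)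
  refine h1.congr_deriv ?_
  have h5 : dR p ⬝ᵥ sph p u = u 1 := dR_sph hp u
  have h6 : √(p 1 ^ 2 + p 2 ^ 2 + p 3 ^ 2) = rad p := rfl
  simp [dR, dotProduct, Fin.sum_univ_four] at h5
  simp [h6]
  rw [← h5]
  field_simp

theorem hasSphDeriv_cosTheta : HasSphDeriv cosTheta 0 (-sinTheta p) p := by
  have hr := rad_pos_of_offAxis hp
  refine ⟨(contDiffAt_cosTheta (n := 1) hr).differentiableAt one_ne_zero, fun u => ?_⟩
  refine ((hasDerivAt_coord (p := p) (sph p u) 3).fun_div ((hasSphDeriv_rad hp).2 u)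
    (by simpa using hr.ne')).congr_deriv ?_
  simp [sph, sinTheta]
  field_simp
  ring

theorem contDiffAt_axisDist {n : ℕ∞ω} : ContDiffAt ℝ n axisDist p :=
  (((contDiffAt_coord 1).pow 2).add ((contDiffAt_coord 2).pow 2)).sqrt hp.ne'

theorem hasDerivAt_axisDist (u : Fin 4 → ℝ) :
    HasDerivAt (fun t : ℝ => axisDist (p + t • sph p u)) (u 1 * sinTheta p + u 2 * p 3) 0 := by
  have h := fun i => hasDerivAt_coord (p := p) (sph p u) i
  have h1 := ((h 1).pow 2).add ((h 2).pow 2) |>.sqrt (by simpa using hp.ne')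
  have h3 := axisDist_pos hp
  have h4 := rad_pos_of_offAxis hp
  refine h1.congr_deriv ?_
  have h6 : √(p 1 ^ 2 + p 2 ^ 2) = axisDist p := rfl
  have h7 := axisDist_sq p
  simp [h6, sph, sinTheta]
  field_simp
  linear_combination (-u 1 * axisDist p - u 2 * rad p * p 3) * h7

theorem hasSphDeriv_sinTheta : HasSphDeriv sinTheta 0 (cosTheta p) p := by
  have hr := rad_pos_of_offAxis hp
  refine ⟨((contDiffAt_axisDist (n := 1) hp).div (contDiffAt_rad hr) hr.ne').differentiableAt
    one_ne_zero, fun u => ?_⟩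
  refine ((hasDerivAt_axisDist hp u).fun_div ((hasSphDeriv_rad hp).2 u)
    (by simpa using hr.ne')).congr_deriv ?_
  simp [sinTheta, cosTheta]
  field_simp
  ring

theorem hasSphDeriv_bigSigma (a : ℝ) :
    HasSphDeriv (bigSigma a) (2 * rad p) (-2 * a ^ 2 * sinTheta p * cosTheta p) p :=
  ((hasSphDeriv_rad hp).sq.add ((hasSphDeriv_cosTheta hp).sq.const_mul (a ^ 2))).congr
    (by ring) (by ring)

theorem hasSphDeriv_bigDelta (M a : ℝ) :
    HasSphDeriv (bigDelta M a) (2 * rad p - 2 * M) 0 p :=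
  (((hasSphDeriv_rad hp).sub (.const (rPlus M a))).mul
    ((hasSphDeriv_rad hp).sub (.const (rMinus M a)))).congr
    (by unfold rPlus rMinus; ring) (by ring)

end OffAxis

/-- The second derivatives of the spherical coordinate map. -/
noncomputable def sphHess (p : Pt) (u v : Fin 4 → ℝ) : Fin 4 → ℝ :=
  ![0,
    v 1 * ((sph p u 1 * rad p - p 1 * u 1) / rad p ^ 2)
      + v 2 * (((sph p u 3 * p 1 + p 3 * sph p u 1) * axisDist p
        - p 3 * p 1 * (u 1 * sinTheta p + u 2 * p 3)) / axisDist p ^ 2) - v 3 * sph p u 2,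
    v 1 * ((sph p u 2 * rad p - p 2 * u 1) / rad p ^ 2)
      + v 2 * (((sph p u 3 * p 2 + p 3 * sph p u 2) * axisDist p
        - p 3 * p 2 * (u 1 * sinTheta p + u 2 * p 3)) / axisDist p ^ 2) + v 3 * sph p u 1,
    v 1 * ((sph p u 3 * rad p - p 3 * u 1) / rad p ^ 2)
      - v 2 * (u 1 * sinTheta p + u 2 * p 3)]

/-- Second derivatives of the coordinate map commute; hence they cancel from Lie brackets. -/
theorem sphHess_comm (hp : 0 < p 1 ^ 2 + p 2 ^ 2) (u v : Fin 4 → ℝ) :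
    sphHess p u v = sphHess p v u := by
  have h3 := axisDist_pos hp
  have h4 := rad_pos_of_offAxis hp
  funext i
  fin_cases i <;> simp [sphHess, sph, sinTheta]
  all_goals field_simp
  all_goals ring

theorem differentiableAt_sph (hp : 0 < p 1 ^ 2 + p 2 ^ 2) {v : Pt → Fin 4 → ℝ}
    (hv : ∀ i, DifferentiableAt ℝ (fun q => v q i) p) :
    DifferentiableAt ℝ (fun q => sph q (v q)) p := by
  have hr := (contDiffAt_rad (n := 1) (rad_pos_of_offAxis hp)).differentiableAt one_ne_zero
  have hw := (contDiffAt_axisDist (n := 1) hp).differentiableAt one_ne_zero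
  have hr0 := (rad_pos_of_offAxis hp).ne'
  have hw0 := (axisDist_pos hp).ne'
  have hx := fun i => (contDiffAt_coord (p := p) (n := 1) i).differentiableAt one_ne_zero
  have hd := fun {f g : Pt → ℝ} => differentiableAt_div (f := f) (g := g) (x := p)
  refine differentiableAt_pi.2 fun i => ?_
  fin_cases i
  · exact hv 0
  · exact (((hv 1).mul (hd (hx 1) hr hr0)).add ((hv 2).mul (hd ((hx 3).mul (hx 1)) hw hw0))).sub
      ((hv 3).mul (hx 2))
  · exact (((hv 1).mul (hd (hx 2) hr hr0)).add ((hv 2).mul (hd ((hx 3).mul (hx 2)) hw hw0))).add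
      ((hv 3).mul (hx 1))
  · exact ((hv 1).mul (hd (hx 3) hr hr0)).sub ((hv 2).mul hw)

theorem sph_add (p : Pt) (u v : Fin 4 → ℝ) : sph p (u + v) = sph p u + sph p v := by
  funext i
  fin_cases i <;> simp [sph] <;> ring

theorem sph_smul (p : Pt) (c : ℝ) (v : Fin 4 → ℝ) : sph p (c • v) = c • sph p v := by
  funext i
  fin_cases i <;> simp [sph] <;> ring

theorem sph_sub (p : Pt) (u v : Fin 4 → ℝ) : sph p (u - v) = sph p u - sph p v := by
  funext i
  fin_cases i <;> simp [sph] <;> ring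

/-- Leibniz rule: one term differentiates the components, the other the coordinate basis itself. -/
theorem fderiv_sph_apply (hp : 0 < p 1 ^ 2 + p 2 ^ 2) {v : Pt → Fin 4 → ℝ} {vr vθ : Fin 4 → ℝ}
    (hv : ∀ i, HasSphDeriv (fun q => v q i) (vr i) (vθ i) p) (u : Fin 4 → ℝ) :
    fderiv ℝ (fun q => sph q (v q)) p (sph p u)
      = sph p (u 1 • vr + u 2 • vθ) + sphHess p u (v p) := by
  have hd := differentiableAt_sph hp fun i => (hv i).1
  have hr0 := (rad_pos_of_offAxis hp).ne'
  have hw0 := (axisDist_pos hp).ne'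
  rw [← hd.lineDeriv_eq_fderiv, lineDeriv]
  refine HasDerivAt.deriv (hasDerivAt_pi.2 fun i => ?_)
  have hx := fun i => hasDerivAt_coord (p := p) (sph p u) i
  have hr := (hasSphDeriv_rad hp).2 u
  have hw := hasDerivAt_axisDist hp u
  have hr0' : rad (p + (0 : ℝ) • sph p u) ≠ 0 := by simpa using hr0
  have hw0' : axisDist (p + (0 : ℝ) • sph p u) ≠ 0 := by simpa using hw0
  have hv' := fun i => (hv i).2 u
  fin_cases i
  · exact (hv' 0).congr_deriv (by simp [sph, sphHess])
  · exact ((((hv' 1).fun_mul ((hx 1).fun_div hr hr0')).fun_add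
      ((hv' 2).fun_mul (((hx 3).fun_mul (hx 1)).fun_div hw hw0'))).fun_sub
      ((hv' 3).fun_mul (hx 2))).congr_deriv (by simp only [zero_smul, add_zero]; simp [sph, sphHess]; ring)
  · exact ((((hv' 1).fun_mul ((hx 2).fun_div hr hr0')).fun_add
      ((hv' 2).fun_mul (((hx 3).fun_mul (hx 2)).fun_div hw hw0'))).fun_add
      ((hv' 3).fun_mul (hx 1))).congr_deriv (by simp only [zero_smul, add_zero]; simp [sph, sphHess]; ring)
  · exact (((hv' 1).fun_mul ((hx 3).fun_div hr hr0')).fun_sub ((hv' 2).fun_mul hw)).congr_deriv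
      (by simp only [zero_smul, add_zero]; simp [sph, sphHess]; ring)

/-- The Lie bracket in spherical components, for fields whose components only depend on
`r` and `θ`. -/
theorem lieBracket_sph (hp : 0 < p 1 ^ 2 + p 2 ^ 2) {u v : Pt → Fin 4 → ℝ}
    {ur uθ vr vθ : Fin 4 → ℝ}
    (hu : ∀ i, HasSphDeriv (fun q => u q i) (ur i) (uθ i) p)
    (hv : ∀ i, HasSphDeriv (fun q => v q i) (vr i) (vθ i) p) :
    VectorField.lieBracket ℝ (fun q => sph q (u q)) (fun q => sph q (v q)) p
      = sph p (u p 1 • vr + u p 2 • vθ - (v p 1 • ur + v p 2 • uθ)) := by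
  rw [VectorField.lieBracket, fderiv_sph_apply hp hv, fderiv_sph_apply hp hu,
    sphHess_comm hp (v p), sph_sub]
  abel

/-- The `r`-derivatives of the spherical components of the frame. -/
noncomputable def frameCompR (M a : ℝ) (p : Pt) (b : Fin 4) : Fin 4 → ℝ :=
  let r := rad p; let s := sinTheta p; let c := cosTheta p; let S := bigSigma a p
  let D := bigDelta M a p
  (![![-(2 * a ^ 2 * r * s * c) / S ^ 2, 0, (S - 2 * r ^ 2) / S ^ 2, -(2 * a * r * c) / (s * S ^ 2)],
    ![a * s * (S - 2 * r ^ 2) / S ^ 2, 0, 2 * a * r * c / S ^ 2, (S - 2 * r ^ 2) / (s * S ^ 2)],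
    ![0, 0, 0, 0],
    ![4 * r * (S - (r ^ 2 + a ^ 2)) / S ^ 2, ((2 * r - 2 * M) * S - 2 * r * D) / S ^ 2, 0,
      -(4 * a * r) / S ^ 2]] : Fin 4 → Fin 4 → ℝ) b

/-- The `θ`-derivatives of the spherical components of the frame. -/
noncomputable def frameCompTheta (M a : ℝ) (p : Pt) (b : Fin 4) : Fin 4 → ℝ :=
  let r := rad p; let s := sinTheta p; let c := cosTheta p; let S := bigSigma a p
  let D := bigDelta M a p
  (![![a ^ 2 * ((c ^ 2 - s ^ 2) * S + 2 * a ^ 2 * s ^ 2 * c ^ 2) / S ^ 2, 0,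
      2 * a ^ 2 * r * s * c / S ^ 2,
      a * (-(s ^ 2 + c ^ 2) * S + 2 * a ^ 2 * s ^ 2 * c ^ 2) / (s ^ 2 * S ^ 2)],
    ![a * r * c * (S + 2 * a ^ 2 * s ^ 2) / S ^ 2, 0, a * s * (S - 2 * a ^ 2 * c ^ 2) / S ^ 2,
      r * c * (-S + 2 * a ^ 2 * s ^ 2) / (s ^ 2 * S ^ 2)],
    ![0, 0, 0, 0],
    ![4 * a ^ 2 * (r ^ 2 + a ^ 2) * s * c / S ^ 2, 2 * a ^ 2 * D * s * c / S ^ 2, 0,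
      4 * a ^ 3 * s * c / S ^ 2]] : Fin 4 → Fin 4 → ℝ) b

theorem hasSphDeriv_frameComp (M a : ℝ) (hp : 0 < p 1 ^ 2 + p 2 ^ 2) (b i : Fin 4) :
    HasSphDeriv (fun q => frameComp M a b q i) (frameCompR M a p b i)
      (frameCompTheta M a p b i) p := by
  have hr0 := rad_pos_of_offAxis hp
  have hs0 := sinTheta_pos hp
  have hS0 := bigSigma_pos a hr0
  have hr := hasSphDeriv_rad hp
  have hs := hasSphDeriv_sinTheta hp
  have hc := hasSphDeriv_cosTheta hp
  have hS := hasSphDeriv_bigSigma hp a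
  have hD := hasSphDeriv_bigDelta hp M a
  fin_cases b <;> fin_cases i
  · exact (((hs.const_mul (a ^ 2)).mul hc).div hS hS0.ne').congr
      (by simp [frameCompR]; ring) (by simp [frameCompTheta]; ring)
  · exact .const 0
  · exact (hr.div hS hS0.ne').congr
      (by simp [frameCompR]; ring) (by simp [frameCompTheta]; ring)
  · exact ((hc.const_mul a).div (hs.mul hS) (by positivity)).congr
      (by simp [frameCompR]; field_simp) (by simp [frameCompTheta]; field_simp; ring)
  · exact (((hr.const_mul a).mul hs).div hS hS0.ne').congr
      (by simp [frameCompR]; ring) (by simp [frameCompTheta]; ring)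
  · exact .const 0
  · exact ((hc.const_mul a).div hS hS0.ne').neg.congr
      (by simp [frameCompR]; ring) (by simp [frameCompTheta]; ring)
  · exact (hr.div (hs.mul hS) (by positivity)).congr
      (by simp [frameCompR]; field_simp) (by simp [frameCompTheta]; field_simp; ring)
  · exact .const 0
  · exact .const (-1)
  · exact .const 0
  · exact .const 0
  · exact (((hr.sq.add (.const (a ^ 2))).const_mul 2).div hS hS0.ne').congr
      (by simp [frameCompR]; ring) (by simp [frameCompTheta]; ring)
  · exact (hD.div hS hS0.ne').congr
      (by simp [frameCompR]; ring) (by simp [frameCompTheta]; ring)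
  · exact .const 0
  · exact ((HasSphDeriv.const (2 * a)).div hS hS0.ne').congr
      (by simp [frameCompR]; ring) (by simp [frameCompTheta]; ring)

theorem differentiableAt_frame (M a : ℝ) (hp : 0 < p 1 ^ 2 + p 2 ^ 2) (b : Fin 4) :
    DifferentiableAt ℝ (frame M a b) p :=
  differentiableAt_sph hp fun i => (hasSphDeriv_frameComp M a hp b i).1

/-- The components `[e_b, e_c]^d` of the brackets of the frame fields, for `b` and `c` among
the pairs that determine all others by antisymmetry. -/
noncomputable def structureConst (M a : ℝ) (p : Pt) (b c : Fin 4) : Fin 4 → ℝ :=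
  let r := rad p; let s := sinTheta p; let c' := cosTheta p; let S := bigSigma a p
  let D := bigDelta M a p
  let K := r ^ 2 + a ^ 2 + a ^ 2 * s ^ 2
  -- The names carry zero-based frame indices: `c01` is [e₁, e₂], `c20` is [e₃, e₁], `c30` is [e₄,
  -- e₁], `c23` is [e₃, e₄].
  let c01 : Fin 4 → ℝ := ![a * s / S - a * c' ^ 2 * K / (s * S ^ 2), -(r * c' * K) / (s * S ^ 2),
    a * c' * D / S ^ 2, a * c' / S]
  let c20 : Fin 4 → ℝ := ![r / S, a * c' / S, 0, 0]
  let c21 : Fin 4 → ℝ := ![-(a * c') / S, r / S, 0, 0]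
  let c30 : Fin 4 → ℝ := ![-(D * r) / S ^ 2, -(D * a * c') / S ^ 2, 0,
    -(2 * a ^ 2 * r * s * c') / S ^ 2]
  let c31 : Fin 4 → ℝ := ![D * a * c' / S ^ 2, -(D * r) / S ^ 2, 0,
    2 * a ^ 3 * s * c' ^ 2 / S ^ 2]
  let c23 : Fin 4 → ℝ := ![4 * a ^ 2 * r * s * c' / S ^ 2, 4 * a * r ^ 2 * s / S ^ 2,
    ((2 * r - 2 * M) * S - 2 * r * D) / S ^ 2, 0]
  (![![0, c01, -c20, -c30], ![-c01, 0, -c21, -c31], ![c20, c21, 0, c23], ![c30, c31, -c23, 0]]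
    : Fin 4 → Fin 4 → Fin 4 → ℝ) b c

theorem lieBracket_frame (ha : |a| ≤ M) (hp : 0 < p 1 ^ 2 + p 2 ^ 2) (b c : Fin 4) :
    VectorField.lieBracket ℝ (frame M a b) (frame M a c) p
      = ∑ d, structureConst M a p b c d • frame M a d p := by
  have hr := rad_pos_of_offAxis hp
  have hs := sinTheta_pos hp
  have hS := bigSigma_pos a hr
  have hSdef : bigSigma a p = rad p ^ 2 + a ^ 2 * (1 - sinTheta p ^ 2) := by
    rw [sinTheta_sq hr, bigSigma]; ring
  have hc : cosTheta p ^ 2 = 1 - sinTheta p ^ 2 := by rw [sinTheta_sq hr]; ring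
  have hD := bigDelta_eq M a ha p
  -- These are six ordered pairs, one for each unordered pair of distinct indices, in the
  -- orientation in which `structureConst` lists the brackets without a sign.
  wlog h : (b = 0 ∧ c = 1) ∨ (b = 2 ∧ c ≠ 2) ∨ (b = 3 ∧ (c = 0 ∨ c = 1)) generalizing b c
  · by_cases hbc : b = c
    · subst hbc
      rw [VectorField.lieBracket_self]
      fin_cases b <;> simp [structureConst]
    · have hanti : structureConst M a p b c = -structureConst M a p c b := by
        fin_cases b <;> fin_cases c <;> simp [structureConst]
      rw [VectorField.lieBracket_swap, this c b (by clear this hanti; revert b c; decide), hanti]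
      simp
  have key : ∀ w : Fin 4 → ℝ, ∑ d, w d • frame M a d p
      = sph p (∑ d, w d • frameComp M a d p) := by
    intro w
    simp only [Fin.sum_univ_four, sph_add, sph_smul, frame]
  rw [key]
  refine (lieBracket_sph hp (hasSphDeriv_frameComp M a hp b)
    (hasSphDeriv_frameComp M a hp c)).trans (congrArg (sph p) ?_)
  funext i
  fin_cases b <;> fin_cases c <;> first | (exfalso; revert h; decide) | skip
  all_goals fin_cases i
  all_goals
    simp [Fin.sum_univ_four, frameComp, e1Comp, e2Comp, e3Comp, e4Comp, frameCompR,
      frameCompTheta, structureConst]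
  all_goals
    rw [← sub_eq_zero]
    clear h key
    generalize rad p = r at *
    generalize sinTheta p = s at *
    generalize cosTheta p = c' at *
    generalize bigSigma a p = S at *
    generalize bigDelta M a p = D at *
    have hs' := hs.ne'
    have hS' := hS.ne'
    clear hs hS hr ha hp
    field_simp
    first | done | grind

end

/-! ### Regularity up to the horizon and across the axis, and density -/

section

variable {p : Pt} {M a : ℝ} {U : Set Pt}

theorem rPlus_pos (hM : 0 < M) : 0 < rPlus M a := add_pos_of_pos_of_nonneg hM (Real.sqrt_nonneg _)

theorem rad_pos_of_mem (hM : 0 < M) (hp : p ∈ exterior M a) : 0 < rad p :=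
  (rPlus_pos hM).trans_le hp

/-- Cauchy–Schwarz; the three squares are those of Lagrange's identity. -/
theorem inner_le_rad (b : Fin 4 → ℝ) (hb : b 1 ^ 2 + b 2 ^ 2 + b 3 ^ 2 = 1) (q : Pt) :
    b 1 * q 1 + b 2 * q 2 + b 3 * q 3 ≤ rad q := by
  refine Real.le_sqrt_of_sq_le ?_
  nlinarith [sq_nonneg (b 1 * q 2 - b 2 * q 1), sq_nonneg (b 1 * q 3 - b 3 * q 1),
    sq_nonneg (b 2 * q 3 - b 3 * q 2)]

/-- The exterior is not convex, but by Cauchy–Schwarz it contains the half-space of points whose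
component in the radial direction of p is at least r₊. That half-space contains p and is convex with
nonempty interior, which suffices. -/
theorem uniqueDiffOn_exterior (hM : 0 < M) : UniqueDiffOn ℝ (exterior M a) := by
  intro p hp
  have hr := rad_pos_of_mem hM hp
  have hsq := rad_sq p
  set H : Set Pt := {q | rPlus M a ≤ p 1 / rad p * q 1 + p 2 / rad p * q 2 + p 3 / rad p * q 3}
    with hH
  have hval : p 1 / rad p * p 1 + p 2 / rad p * p 2 + p 3 / rad p * p 3 = rad p := by
    field_simp; linarith
  have hsub : H ⊆ exterior M a := fun q hq => le_trans hq
    (inner_le_rad (fun i => p i / rad p) (by field_simp; linarith) q)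
  refine UniqueDiffWithinAt.mono ?_ hsub
  let L : Pt →ₗ[ℝ] ℝ := (p 1 / rad p) • LinearMap.proj 1 + (p 2 / rad p) • LinearMap.proj 2
    + (p 3 / rad p) • LinearMap.proj 3
  have hconv : Convex ℝ H := by
    have : H = {q | rPlus M a ≤ L q} := by ext q; simp [hH, L]
    rw [this]
    exact convex_halfSpace_ge L.isLinear _
  have hint : (interior H).Nonempty := by
    let H' : Set Pt :=
      {q | rPlus M a < p 1 / rad p * q 1 + p 2 / rad p * q 2 + p 3 / rad p * q 3}
    have hH' : IsOpen H' := isOpen_lt continuous_const (by fun_prop)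
    -- At 2p the linear form takes the value 2r, which exceeds r₊ because r ≥ r₊ and r > 0.
    have hmem : (fun i => 2 * p i) ∈ H' := by
      have h2 : rPlus M a ≤ rad p := hp
      change _ < p 1 / rad p * (2 * p 1) + p 2 / rad p * (2 * p 2) + p 3 / rad p * (2 * p 3)
      linarith
    have hH'H : H' ⊆ H := by
      intro q hq
      simp only [hH, H', Set.mem_ofPred_eq] at hq ⊢
      exact hq.le
    exact ⟨_, interior_maximal hH'H hH' hmem⟩
  exact uniqueDiffOn_convex hconv hint p (show rPlus M a ≤ _ from hval.symm ▸ hp)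

/-- Relatively open subsets of the exterior. -/
def IsRelOpen (M a : ℝ) (U : Set Pt) : Prop := ∃ V : Set Pt, IsOpen V ∧ U = V ∩ exterior M a

theorem IsRelOpen.subset (hU : IsRelOpen M a U) : U ⊆ exterior M a := by
  obtain ⟨V, -, rfl⟩ := hU
  exact Set.inter_subset_right

theorem IsRelOpen.uniqueDiffOn (hM : 0 < M) (hU : IsRelOpen M a U) : UniqueDiffOn ℝ U := by
  obtain ⟨V, hV, rfl⟩ := hU
  rw [Set.inter_comm]
  exact (uniqueDiffOn_exterior hM).inter hV

/-- `pd` differentiates within the whole exterior, whereas smoothness is only assumed on U. Being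
local, the derivative may be taken within U, so smoothness on U passes to all iterated derivatives.
-/
theorem IsRelOpen.fderivWithin_eq (hU : IsRelOpen M a U) (hp : p ∈ U) (f : Pt → ℝ) :
    fderivWithin ℝ f (exterior M a) p = fderivWithin ℝ f U p := by
  obtain ⟨V, hV, rfl⟩ := hU
  rw [Set.inter_comm, fderivWithin_inter (hV.mem_nhds hp.1)]

theorem contDiffOn_pd (hM : 0 < M) (hU : IsRelOpen M a U) {f : Pt → ℝ} (hf : ContDiffOn ℝ ∞ f U)
    (i : Fin 4) : ContDiffOn ℝ ∞ (pd M a i f) U := by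
  have h := hf.fderivWithin (m := ∞) (hU.uniqueDiffOn hM) (by simp)
  exact (h.clm_apply contDiffOn_const).congr fun p hp => by rw [pd, hU.fderivWithin_eq hp]

theorem contDiffOn_det {A : Pt → Matrix (Fin 4) (Fin 4) ℝ}
    (hA : ∀ i j, ContDiffOn ℝ ∞ (fun p => A p i j) U) : ContDiffOn ℝ ∞ (fun p => (A p).det) U := by
  simp only [Matrix.det_apply]
  exact ContDiffOn.sum fun σ _ => (contDiffOn_prod fun i _ => hA _ _).const_smul _

theorem contDiffOn_adjugate {A : Pt → Matrix (Fin 4) (Fin 4) ℝ}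
    (hA : ∀ i j, ContDiffOn ℝ ∞ (fun p => A p i j) U) (i j : Fin 4) :
    ContDiffOn ℝ ∞ (fun p => (A p).adjugate i j) U := by
  simp only [Matrix.adjugate_apply]
  refine contDiffOn_det fun k l => ?_
  by_cases h : k = j
  · subst h; simpa using contDiffOn_const
  · simpa [Matrix.updateRow_ne h] using hA k l

/-- Off the axis the Gram relation already makes g invertible. On the axis there is no frame, but
the matrix is explicit: a (t, z) block with off-diagonal entries z/r = ±1, and Σ/r² twice. -/
theorem det_metric_ne_zero (ha : |a| ≤ M) (hr : 0 < rad p) : (metric M a p).det ≠ 0 := by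
  rcases (show 0 ≤ p 1 ^ 2 + p 2 ^ 2 by positivity).eq_or_lt with h | h
  · have h1 : p 1 = 0 := by nlinarith [sq_nonneg (p 1), sq_nonneg (p 2)]
    have h2 : p 2 = 0 := by nlinarith [sq_nonneg (p 1), sq_nonneg (p 2)]
    have h3 : p 3 ^ 2 = rad p ^ 2 := by rw [rad_sq, h1, h2]; ring
    have h3' : p 3 ≠ 0 := by
      intro h0
      rw [h0] at h3
      nlinarith
    have hS := bigSigma_pos a hr
    have key : metric M a p = !![-(1 - 2 * M * rad p / bigSigma a p), 0, 0, p 3 / rad p;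
        0, bigSigma a p / rad p ^ 2, 0, 0; 0, 0, bigSigma a p / rad p ^ 2, 0;
        p 3 / rad p, 0, 0, 0] := by
      ext i j
      fin_cases i <;> fin_cases j <;>
        simp [metric, dT, dR, sinSqDPhi, roundMetric, h1, h2]
      · field_simp
      · field_simp
      · right; left; field_simp; linarith
    rw [key]
    simp [Matrix.det_succ_row_zero, Fin.sum_univ_succ, Fin.succAbove, h3', hr.ne', hS.ne']
  · have h1 := congrArg Matrix.det (metric_mul_metricInv ha h)
    rw [Matrix.det_mul, Matrix.det_one] at h1
    exact left_ne_zero_of_mul_eq_one h1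

section Smooth

variable (hM : 0 < M) (ha : |a| ≤ M) (hU : IsRelOpen M a U)

include hM hU

theorem contDiffOn_of_rad_pos {f : Pt → ℝ} (hf : ∀ p, 0 < rad p → ContDiffAt ℝ ∞ f p) :
    ContDiffOn ℝ ∞ f U := fun p hp =>
  (hf p (rad_pos_of_mem hM (hU.subset hp))).contDiffWithinAt

theorem contDiffOn_metric (i j : Fin 4) : ContDiffOn ℝ ∞ (fun p => metric M a p i j) U :=
  contDiffOn_of_rad_pos hM hU fun _ hr => contDiffAt_metric M a hr i j

theorem contDiffOn_e3 (i : Fin 4) : ContDiffOn ℝ ∞ (fun p => e3 p i) U :=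
  contDiffOn_of_rad_pos hM hU fun _ hr => contDiffAt_e3 hr i

theorem contDiffOn_e4 (i : Fin 4) : ContDiffOn ℝ ∞ (fun p => e4 M a p i) U :=
  contDiffOn_of_rad_pos hM hU fun _ hr => contDiffAt_e4 M a hr i

theorem contDiffOn_eps (i j : Fin 4) : ContDiffOn ℝ ∞ (fun p => eps a p i j) U :=
  contDiffOn_of_rad_pos hM hU fun _ hr => contDiffAt_eps a hr i j

theorem contDiffOn_bigSigma : ContDiffOn ℝ ∞ (bigSigma a) U :=
  contDiffOn_of_rad_pos hM hU fun _ hr => contDiffAt_bigSigma a hr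

include ha

theorem contDiffOn_metricInv (i j : Fin 4) : ContDiffOn ℝ ∞ (fun p => metricInv M a p i j) U := by
  have h := contDiffOn_metric hM hU
  simp only [metricInv, Matrix.inv_def, Matrix.smul_apply, smul_eq_mul, Ring.inverse_eq_inv']
  exact ((contDiffOn_det h).inv fun p hp =>
    det_metric_ne_zero ha (rad_pos_of_mem hM (hU.subset hp))).mul (contDiffOn_adjugate h i j)

theorem contDiffOn_christoffel (k i j : Fin 4) : ContDiffOn ℝ ∞ (christoffel M a k i j) U :=
  contDiffOn_const.mul (ContDiffOn.sum fun l _ => (contDiffOn_metricInv hM ha hU k l).mul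
    (((contDiffOn_pd hM hU (contDiffOn_metric hM hU j l) i).add
      (contDiffOn_pd hM hU (contDiffOn_metric hM hU i l) j)).sub
      (contDiffOn_pd hM hU (contDiffOn_metric hM hU i j) l)))

theorem contDiffOn_covVec {V : VecField} (hV : ∀ i, ContDiffOn ℝ ∞ (fun p => V p i) U)
    (i k : Fin 4) : ContDiffOn ℝ ∞ (fun p => covVec M a V p i k) U :=
  (contDiffOn_pd hM hU (hV k) i).add (ContDiffOn.sum fun j _ =>
    (contDiffOn_christoffel hM ha hU k i j).mul (hV j))

theorem contDiffOn_covForm {ς : OneForm} (hς : ∀ i, ContDiffOn ℝ ∞ (fun p => ς p i) U)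
    (i j : Fin 4) : ContDiffOn ℝ ∞ (fun p => covForm M a ς p i j) U :=
  (contDiffOn_pd hM hU (hς j) i).sub (ContDiffOn.sum fun k _ =>
    (contDiffOn_christoffel hM ha hU k i j).mul (hς k))

omit ha in
theorem contDiffOn_flat {V : VecField} (hV : ∀ i, ContDiffOn ℝ ∞ (fun p => V p i) U)
    (j : Fin 4) : ContDiffOn ℝ ∞ (fun p => flat M a V p j) U :=
  ContDiffOn.sum fun i _ => (contDiffOn_metric hM hU i j).mul (hV i)

omit ha in
theorem contDiffOn_proj (i j : Fin 4) : ContDiffOn ℝ ∞ (fun p => proj M a p i j) U :=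
  contDiffOn_const.add (contDiffOn_const.mul
    (((contDiffOn_e3 hM hU i).mul (contDiffOn_flat hM hU (contDiffOn_e4 hM hU) j)).add
      ((contDiffOn_e4 hM hU i).mul (contDiffOn_flat hM hU (contDiffOn_e3 hM hU) j))))

omit ha in
theorem contDiffOn_horiz {ς : OneForm} (hς : ∀ i, ContDiffOn ℝ ∞ (fun p => ς p i) U)
    (j : Fin 4) : ContDiffOn ℝ ∞ (fun p => horiz M a ς p j) U :=
  ContDiffOn.sum fun k _ => (hς k).mul (contDiffOn_proj hM hU k j)

theorem contDiffOn_hInv (i j : Fin 4) : ContDiffOn ℝ ∞ (fun p => hInv M a p i j) U :=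
  (contDiffOn_metricInv hM ha hU i j).add (contDiffOn_const.mul
    (((contDiffOn_e3 hM hU i).mul (contDiffOn_e4 hM hU j)).add
      ((contDiffOn_e4 hM hU i).mul (contDiffOn_e3 hM hU j))))

theorem contDiffOn_epsUp (i j : Fin 4) : ContDiffOn ℝ ∞ (fun p => epsUp M a p i j) U :=
  ContDiffOn.sum fun k _ => ContDiffOn.sum fun l _ =>
    ((contDiffOn_hInv hM ha hU i k).mul (contDiffOn_hInv hM ha hU j l)).mul
      (contDiffOn_eps hM hU k l)

theorem contDiffOn_hStar {ς : OneForm} (hς : ∀ i, ContDiffOn ℝ ∞ (fun p => ς p i) U)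
    (i : Fin 4) : ContDiffOn ℝ ∞ (fun p => hStar M a ς p i) U :=
  ContDiffOn.sum fun j _ => ContDiffOn.sum fun k _ =>
    ((contDiffOn_eps hM hU i k).mul (contDiffOn_hInv hM ha hU j k)).mul (hς j)

theorem contDiffOn_hTr {θ : TwoTensor} (hθ : ∀ i j, ContDiffOn ℝ ∞ (fun p => θ p i j) U) :
    ContDiffOn ℝ ∞ (hTr M a θ) U :=
  ContDiffOn.sum fun i _ => ContDiffOn.sum fun j _ => (contDiffOn_hInv hM ha hU i j).mul (hθ i j)

theorem contDiffOn_epsDot {θ : TwoTensor} (hθ : ∀ i j, ContDiffOn ℝ ∞ (fun p => θ p i j) U) :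
    ContDiffOn ℝ ∞ (epsDot M a θ) U :=
  ContDiffOn.sum fun i _ => ContDiffOn.sum fun j _ => (contDiffOn_epsUp hM ha hU i j).mul (hθ i j)

theorem contDiffOn_covAlong {X V : VecField} (hX : ∀ i, ContDiffOn ℝ ∞ (fun p => X p i) U)
    (hV : ∀ i, ContDiffOn ℝ ∞ (fun p => V p i) U) (k : Fin 4) :
    ContDiffOn ℝ ∞ (fun p => covAlong M a X V p k) U :=
  ContDiffOn.sum fun i _ => (hX i).mul (contDiffOn_covVec hM ha hU hV i k)

theorem contDiffOn_secondFund {V : VecField} (hV : ∀ i, ContDiffOn ℝ ∞ (fun p => V p i) U)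
    (i j : Fin 4) : ContDiffOn ℝ ∞ (fun p => secondFund M a V p i j) U :=
  ContDiffOn.sum fun k _ => ContDiffOn.sum fun l _ => ContDiffOn.sum fun m _ =>
    (((contDiffOn_proj hM hU k i).mul (contDiffOn_proj hM hU l j)).mul
      (contDiffOn_metric hM hU m l)).mul (contDiffOn_covVec hM ha hU hV k m)

theorem contDiffOn_trChi : ContDiffOn ℝ ∞ (trChi M a) U :=
  contDiffOn_hTr hM ha hU (contDiffOn_secondFund hM ha hU (contDiffOn_e4 hM hU))

theorem contDiffOn_trChiBar : ContDiffOn ℝ ∞ (trChiBar M a) U :=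
  contDiffOn_hTr hM ha hU (contDiffOn_secondFund hM ha hU (contDiffOn_e3 hM hU))

theorem contDiffOn_epsChi : ContDiffOn ℝ ∞ (epsChi M a) U :=
  contDiffOn_epsDot hM ha hU (contDiffOn_secondFund hM ha hU (contDiffOn_e4 hM hU))

theorem contDiffOn_epsChiBar : ContDiffOn ℝ ∞ (epsChiBar M a) U :=
  contDiffOn_epsDot hM ha hU (contDiffOn_secondFund hM ha hU (contDiffOn_e3 hM hU))

theorem contDiffOn_eta (i : Fin 4) : ContDiffOn ℝ ∞ (fun p => eta M a p i) U :=
  contDiffOn_const.mul (contDiffOn_horiz hM hU (contDiffOn_flat hM hU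
    (contDiffOn_covAlong hM ha hU (contDiffOn_e3 hM hU) (contDiffOn_e4 hM hU))) i)

theorem contDiffOn_etaBar (i : Fin 4) : ContDiffOn ℝ ∞ (fun p => etaBar M a p i) U :=
  contDiffOn_const.mul (contDiffOn_horiz hM hU (contDiffOn_flat hM hU
    (contDiffOn_covAlong hM ha hU (contDiffOn_e4 hM hU) (contDiffOn_e3 hM hU))) i)

theorem contDiffOn_omegaHat : ContDiffOn ℝ ∞ (omegaHat M a) U :=
  contDiffOn_const.mul (ContDiffOn.sum fun i _ => ContDiffOn.sum fun j _ =>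
    ((contDiffOn_metric hM hU i j).mul (contDiffOn_covAlong hM ha hU (contDiffOn_e4 hM hU)
      (contDiffOn_e3 hM hU) i)).mul (contDiffOn_e4 hM hU j))

theorem contDiffOn_nab {X : VecField} {ς : OneForm} (hX : ∀ i, ContDiffOn ℝ ∞ (fun p => X p i) U)
    (hς : ∀ i, ContDiffOn ℝ ∞ (fun p => ς p i) U) (j : Fin 4) :
    ContDiffOn ℝ ∞ (fun p => nab M a X ς p j) U :=
  contDiffOn_horiz hM hU (fun j => ContDiffOn.sum fun i _ =>
    (hX i).mul (contDiffOn_covForm hM ha hU hς i j)) j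

omit ha in
theorem contDiffOn_grad {f : Pt → ℝ} (hf : ContDiffOn ℝ ∞ f U) (j : Fin 4) :
    ContDiffOn ℝ ∞ (fun p => grad M a f p j) U :=
  contDiffOn_horiz hM hU (contDiffOn_pd hM hU hf) j

theorem contDiffOn_nabTensor {ς : OneForm} (hς : ∀ i, ContDiffOn ℝ ∞ (fun p => ς p i) U)
    (i j : Fin 4) : ContDiffOn ℝ ∞ (fun p => nabTensor M a ς p i j) U :=
  ContDiffOn.sum fun k _ => ContDiffOn.sum fun l _ =>
    ((contDiffOn_proj hM hU k i).mul (contDiffOn_proj hM hU l j)).mul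
      (contDiffOn_covForm hM ha hU hς k l)

theorem contDiffOn_hDiv {ς : OneForm} (hς : ∀ i, ContDiffOn ℝ ∞ (fun p => ς p i) U) :
    ContDiffOn ℝ ∞ (hDiv M a ς) U :=
  contDiffOn_hTr hM ha hU (contDiffOn_nabTensor hM ha hU hς)

theorem contDiffOn_hCurl {ς : OneForm} (hς : ∀ i, ContDiffOn ℝ ∞ (fun p => ς p i) U) :
    ContDiffOn ℝ ∞ (hCurl M a ς) U :=
  contDiffOn_epsDot hM ha hU (contDiffOn_nabTensor hM ha hU hς)

omit hM ha hU in
theorem contDiffOn_scal {f : Pt → ℝ} {ς : OneForm} (hf : ContDiffOn ℝ ∞ f U)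
    (hς : ∀ i, ContDiffOn ℝ ∞ (fun p => ς p i) U) (i : Fin 4) :
    ContDiffOn ℝ ∞ (fun p => scal f ς p i) U := hf.mul (hς i)

theorem contDiffOn_op3 (c d : ℝ) {ς : OneForm} (hς : ∀ i, ContDiffOn ℝ ∞ (fun p => ς p i) U)
    (i : Fin 4) : ContDiffOn ℝ ∞ (fun p => op3 M a c d ς p i) U :=
  ((contDiffOn_nab hM ha hU (contDiffOn_e3 hM hU) hς i).add
    ((contDiffOn_const.mul (contDiffOn_trChiBar hM ha hU)).mul (hς i))).add
    ((contDiffOn_const.mul (contDiffOn_epsChiBar hM ha hU)).mul (contDiffOn_hStar hM ha hU hς i))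

theorem contDiffOn_op4 (c d : ℝ) {ς : OneForm} (hς : ∀ i, ContDiffOn ℝ ∞ (fun p => ς p i) U)
    (i : Fin 4) : ContDiffOn ℝ ∞ (fun p => op4 M a c d ς p i) U :=
  ((contDiffOn_nab hM ha hU (contDiffOn_e4 hM hU) hς i).add
    ((contDiffOn_const.mul (contDiffOn_trChi hM ha hU)).mul (hς i))).add
    ((contDiffOn_const.mul (contDiffOn_epsChi hM ha hU)).mul (contDiffOn_hStar hM ha hU hς i))

omit ha in
theorem contDiffOn_gradShift {τ : OneForm} {f : Pt → ℝ}
    (hτ : ∀ i, ContDiffOn ℝ ∞ (fun p => τ p i) U) (hf : ContDiffOn ℝ ∞ f U) (i : Fin 4) :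
    ContDiffOn ℝ ∞ (fun p => gradShift M a τ f p i) U :=
  (contDiffOn_grad hM hU hf i).add ((contDiffOn_const.mul hf).mul (hτ i))

end Smooth

/-- The region off the horizon and the axis is dense in relatively open sets. -/
theorem mem_closure_inter_region (hM : 0 < M) (hU : IsRelOpen M a U) (hp : p ∈ U) :
    p ∈ closure (U ∩ region M a) := by
  obtain ⟨V, hV, rfl⟩ := hU
  have hr := rad_pos_of_mem hM hp.2
  have hsq := rad_sq p
  -- From an axis point move in the x-direction; from any other point dilate by 1 + t. Either curve
  -- increases r at once and stays off the axis for t > 0.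
  have key : ∃ γ : ℝ → Pt, Continuous γ ∧ γ 0 = p ∧ ∀ t > 0, γ t ∈ region M a := by
    have hp2 : rPlus M a ≤ rad p := hp.2
    rcases (show 0 ≤ p 1 ^ 2 + p 2 ^ 2 by positivity).eq_or_lt with h | h
    · have h1 : p 1 = 0 := by nlinarith [sq_nonneg (p 1), sq_nonneg (p 2)]
      have h2 : p 2 = 0 := by nlinarith [sq_nonneg (p 1), sq_nonneg (p 2)]
      refine ⟨fun t => ![p 0, t, 0, p 3], by fun_prop, ?_, fun t ht => ⟨?_, ?_⟩⟩
      · funext i; fin_cases i <;> simp [h1, h2]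
      · refine hp2.trans_lt (Real.sqrt_lt_sqrt (by positivity) ?_)
        simp [h1, h2]; positivity
      · simp; positivity
    · refine ⟨fun t => fun i => (1 + t) * p i, by fun_prop, by simp, fun t ht => ⟨?_, ?_⟩⟩
      · refine hp2.trans_lt (Real.sqrt_lt_sqrt (by positivity) ?_)
        have : 0 < p 1 ^ 2 + p 2 ^ 2 + p 3 ^ 2 := by positivity
        nlinarith [mul_pos ht this, mul_pos (mul_pos ht ht) this]
      · change 0 < ((1 + t) * p 1) ^ 2 + ((1 + t) * p 2) ^ 2
        have : 0 < (1 + t) ^ 2 * (p 1 ^ 2 + p 2 ^ 2) := by positivity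
        nlinarith
  obtain ⟨γ, hγ, h0, hreg⟩ := key
  have hlim : Filter.Tendsto γ (nhdsWithin 0 (Set.Ioi 0)) (nhds p) :=
    h0 ▸ hγ.continuousAt.tendsto.mono_left nhdsWithin_le_nhds
  refine mem_closure_of_tendsto hlim ?_
  filter_upwards [hlim (hV.mem_nhds hp.1), self_mem_nhdsWithin] with t ht1 ht2
  exact ⟨⟨ht1, region_subset M a (hreg t ht2)⟩, hreg t ht2⟩

theorem eq_zero_of_eq_zero_on_region (hM : 0 < M) (hU : IsRelOpen M a U) {f : Pt → ℝ}
    (hf : ContDiffOn ℝ ∞ f U) (h : ∀ q ∈ U ∩ region M a, f q = 0) (hp : p ∈ U) : f p = 0 := by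
  have h1 : ContinuousWithinAt f (U ∩ region M a) p :=
    (hf.continuousOn p hp).mono Set.inter_subset_left
  have h2 := h1.mem_closure_image (mem_closure_inter_region hM hU hp)
  have h3 : f '' (U ∩ region M a) ⊆ {0} := by
    rintro _ ⟨q, hq, rfl⟩
    exact h q hq
  simpa using closure_mono h3 h2

end

/-! ### The Levi-Civita connection and Koszul's formula -/

section

variable {p : Pt} {M a : ℝ}

theorem metric_mul_christoffel (ha : |a| ≤ M) (hp : 0 < p 1 ^ 2 + p 2 ^ 2) (l i j : Fin 4) :
    ∑ k, metric M a p l k * christoffel M a k i j p =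
      (1 / 2) * (pd M a i (fun q => metric M a q j l) p + pd M a j (fun q => metric M a q i l) p
        - pd M a l (fun q => metric M a q i j) p) := by
  set w : Fin 4 → ℝ := fun l => pd M a i (fun q => metric M a q j l) p
    + pd M a j (fun q => metric M a q i l) p - pd M a l (fun q => metric M a q i j) p with hw
  have h1 : (metric M a p * metricInv M a p) *ᵥ w = w := by
    rw [metric_mul_metricInv ha hp, Matrix.one_mulVec]
  have h2 := congrFun h1 l
  rw [← Matrix.mulVec_mulVec] at h2
  change _ = (1 / 2) * w l
  rw [← h2]
  simp only [Matrix.mulVec, dotProduct, christoffel, Finset.mul_sum, hw]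
  exact Finset.sum_congr rfl fun _ _ => Finset.sum_congr rfl fun _ _ => by ring

theorem christoffel_comm (M a : ℝ) (k i j : Fin 4) (p : Pt) :
    christoffel M a k i j p = christoffel M a k j i p := by
  have : (fun q => metric M a q i j) = fun q => metric M a q j i :=
    funext fun q => metric_comm M a q i j
  simp only [christoffel]
  congr 1
  refine Finset.sum_congr rfl fun l _ => ?_
  rw [this]; ring

variable (hp : p ∈ region M a)

include hp

theorem covAlong_apply (X : VecField) {Y : VecField} (hY : DifferentiableAt ℝ Y p) (k : Fin 4) :
    covAlong M a X Y p k = fderiv ℝ Y p (X p) k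
      + ∑ i, ∑ j, X p i * christoffel M a k i j p * Y p j := by
  have h : fderiv ℝ Y p (X p) k = ∑ i, X p i * pd M a i (fun q => Y q k) p := by
    have h1 : fderiv ℝ Y p (X p) k = fderiv ℝ (fun q => Y q k) p (X p) := by
      rw [fderiv_apply hY]; rfl
    rw [h1, clm_apply_eq_sum (fderiv ℝ (fun q => Y q k) p)]
    simp [pd_eq_fderiv hp]
  rw [h, ← Finset.sum_add_distrib]
  refine Finset.sum_congr rfl fun i _ => ?_
  rw [covVec, mul_add, Finset.mul_sum]
  exact congrArg _ (Finset.sum_congr rfl fun j _ => by ring)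

/-- Vanishing torsion, from the symmetry of the Christoffel symbols in their lower indices. -/
theorem covAlong_sub_covAlong {X Y : VecField} (hX : DifferentiableAt ℝ X p)
    (hY : DifferentiableAt ℝ Y p) :
    covAlong M a X Y p - covAlong M a Y X p = VectorField.lieBracket ℝ X Y p := by
  funext k
  rw [Pi.sub_apply, covAlong_apply hp X hY, covAlong_apply hp Y hX, VectorField.lieBracket,
    Pi.sub_apply]
  have : ∑ i, ∑ j, Y p i * christoffel M a k i j p * X p j
      = ∑ i, ∑ j, X p i * christoffel M a k i j p * Y p j := by
    rw [Finset.sum_comm]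
    refine Finset.sum_congr rfl fun i _ => Finset.sum_congr rfl fun j _ => ?_
    rw [christoffel_comm]; ring
  rw [this]; ring

/-- Pairing with g lowers the upper index, so the inverse metric disappears and only Christoffel
symbols of the first kind remain. -/
theorem inner4_covAlong (ha : |a| ≤ M) (X : VecField) {Y : VecField} (hY : DifferentiableAt ℝ Y p)
    (w : Fin 4 → ℝ) :
    inner4 M a p (covAlong M a X Y p) w = inner4 M a p (fderiv ℝ Y p (X p)) w
      + ∑ i, ∑ j, ∑ l, X p i * Y p j * w l * ((1 / 2) *
        (pd M a i (fun q => metric M a q j l) p + pd M a j (fun q => metric M a q i l) p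
        - pd M a l (fun q => metric M a q i j) p)) := by
  have h1 : ∀ u, inner4 M a p u w = ∑ l, w l * ∑ k, metric M a p l k * u k := by
    intro u
    rw [inner4, Finset.sum_comm]
    refine Finset.sum_congr rfl fun l _ => ?_
    rw [Finset.mul_sum]
    refine Finset.sum_congr rfl fun k _ => ?_
    rw [metric_comm]; ring
  have h2 : ∀ l, ∑ k, metric M a p l k * ∑ i, ∑ j, X p i * christoffel M a k i j p * Y p j
      = ∑ i, ∑ j, X p i * Y p j * ((1 / 2) *
        (pd M a i (fun q => metric M a q j l) p + pd M a j (fun q => metric M a q i l) p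
        - pd M a l (fun q => metric M a q i j) p)) := by
    intro l
    simp only [← metric_mul_christoffel ha hp.2, Finset.mul_sum]
    rw [Finset.sum_comm]
    refine Finset.sum_congr rfl fun i _ => ?_
    rw [Finset.sum_comm]
    exact Finset.sum_congr rfl fun j _ => Finset.sum_congr rfl fun k _ => by ring
  rw [h1, h1]
  simp only [covAlong_apply hp X hY, mul_add, Finset.sum_add_distrib]
  congr 1
  rw [Finset.sum_congr rfl fun l _ => congrArg (w l * ·) (h2 l)]
  simp only [Finset.mul_sum]
  rw [Finset.sum_comm]
  refine Finset.sum_congr rfl fun i _ => ?_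
  rw [Finset.sum_comm]
  exact Finset.sum_congr rfl fun j _ => Finset.sum_congr rfl fun l _ => by ring

/-- Metric compatibility of the Levi-Civita connection. -/
theorem fderiv_inner4 (ha : |a| ≤ M) (X : VecField) {Y Z : VecField}
    (hY : DifferentiableAt ℝ Y p) (hZ : DifferentiableAt ℝ Z p) :
    fderiv ℝ (fun q => inner4 M a q (Y q) (Z q)) p (X p)
      = inner4 M a p (covAlong M a X Y p) (Z p) + inner4 M a p (Y p) (covAlong M a X Z p) := by
  have hg : ∀ i j, DifferentiableAt ℝ (fun q => metric M a q i j) p := fun i j =>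
    (contDiffAt_metric (n := 1) M a (rad_pos_of_offAxis hp.2) i j).differentiableAt one_ne_zero
  have hY' := fun i => differentiableAt_pi.1 hY i
  have hZ' := fun i => differentiableAt_pi.1 hZ i
  have hsum : fderiv ℝ (fun q => inner4 M a q (Y q) (Z q)) p (X p) = ∑ i, ∑ j,
      (fderiv ℝ (fun q => metric M a q i j) p (X p) * Y p i * Z p j
      + metric M a p i j * fderiv ℝ Y p (X p) i * Z p j
      + metric M a p i j * Y p i * fderiv ℝ Z p (X p) j) := by
    simp only [inner4]
    have hterm : ∀ i j, DifferentiableAt ℝ (fun q => metric M a q i j * Y q i * Z q j) p :=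
      fun i j => ((hg i j).mul (hY' i)).mul (hZ' j)
    rw [fderiv_fun_sum fun i _ => DifferentiableAt.fun_sum fun j _ => hterm i j,
      sum_apply]
    refine Finset.sum_congr rfl fun i _ => ?_
    rw [fderiv_fun_sum fun j _ => hterm i j, sum_apply]
    refine Finset.sum_congr rfl fun j _ => ?_
    have h1 : fderiv ℝ Y p (X p) i = fderiv ℝ (fun q => Y q i) p (X p) := by
      rw [fderiv_apply hY]; rfl
    have h2 : fderiv ℝ Z p (X p) j = fderiv ℝ (fun q => Z q j) p (X p) := by
      rw [fderiv_apply hZ]; rfl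
    rw [fderiv_fun_mul ((hg i j).fun_mul (hY' i)) (hZ' j), fderiv_fun_mul (hg i j) (hY' i), h1, h2]
    simp
    ring
  have hX : ∀ i j, fderiv ℝ (fun q => metric M a q i j) p (X p)
      = ∑ m, X p m * pd M a m (fun q => metric M a q i j) p := by
    intro i j
    rw [clm_apply_eq_sum (fderiv ℝ (fun q => metric M a q i j) p)]
    simp [pd_eq_fderiv hp]
  have hsym : ∀ m i j, pd M a m (fun q => metric M a q i j) p
      = pd M a m (fun q => metric M a q j i) p := by
    intro m i j
    congr 1
    exact funext fun q => metric_comm M a q i j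
  rw [inner4_comm M a p (Y p), inner4_covAlong hp ha X hY, inner4_covAlong hp ha X hZ, hsum,
    inner4_comm M a p (fderiv ℝ Z p (X p))]
  simp only [Finset.sum_add_distrib, hX]
  have e1 : ∑ i, ∑ j, metric M a p i j * fderiv ℝ Y p (X p) i * Z p j
      = inner4 M a p (fderiv ℝ Y p (X p)) (Z p) := rfl
  have e2 : ∑ i, ∑ j, metric M a p i j * Y p i * fderiv ℝ Z p (X p) j
      = inner4 M a p (Y p) (fderiv ℝ Z p (X p)) := rfl
  have e3 : ∑ i, ∑ j, (∑ m, X p m * pd M a m (fun q => metric M a q i j) p) * Y p i * Z p j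
      = ∑ i, ∑ j, ∑ l, X p i * Y p j * Z p l * pd M a i (fun q => metric M a q j l) p := by
    simp only [Finset.sum_mul]
    have : ∀ i, ∑ j, ∑ m, X p m * pd M a m (fun q => metric M a q i j) p * Y p i * Z p j
        = ∑ m, ∑ j, X p m * pd M a m (fun q => metric M a q i j) p * Y p i * Z p j :=
      fun i => Finset.sum_comm
    simp only [this]
    rw [Finset.sum_comm]
    exact Finset.sum_congr rfl fun i _ => Finset.sum_congr rfl fun j _ =>
      Finset.sum_congr rfl fun l _ => by ring
  have e4 : ∑ i, ∑ j, ∑ l, X p i * Z p j * Y p l * ((1 / 2) *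
        (pd M a i (fun q => metric M a q j l) p + pd M a j (fun q => metric M a q i l) p
        - pd M a l (fun q => metric M a q i j) p))
      = ∑ i, ∑ j, ∑ l, X p i * Y p j * Z p l * ((1 / 2) *
        (pd M a i (fun q => metric M a q j l) p + pd M a l (fun q => metric M a q i j) p
        - pd M a j (fun q => metric M a q i l) p)) := by
    refine Finset.sum_congr rfl fun i _ => ?_
    rw [Finset.sum_comm]
    refine Finset.sum_congr rfl fun j _ => Finset.sum_congr rfl fun l _ => ?_
    rw [hsym i l j]; ring
  rw [e1, e2, e3, e4]
  -- The two first-kind Christoffel symbols obtained by exchanging j and l add up to ∂ᵢg_{jl}.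
  have e5 : ∑ i, ∑ j, ∑ l, X p i * Y p j * Z p l * pd M a i (fun q => metric M a q j l) p
      = ∑ i, ∑ j, ∑ l, X p i * Y p j * Z p l * ((1 / 2) *
        (pd M a i (fun q => metric M a q j l) p + pd M a j (fun q => metric M a q i l) p
        - pd M a l (fun q => metric M a q i j) p))
      + ∑ i, ∑ j, ∑ l, X p i * Y p j * Z p l * ((1 / 2) *
        (pd M a i (fun q => metric M a q j l) p + pd M a l (fun q => metric M a q i j) p
        - pd M a j (fun q => metric M a q i l) p)) := by
    simp only [← Finset.sum_add_distrib]
    exact Finset.sum_congr rfl fun i _ => Finset.sum_congr rfl fun j _ =>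
      Finset.sum_congr rfl fun l _ => by ring
  rw [e5]; ring

omit hp in
theorem inner4_sub_left (M a : ℝ) (p : Pt) (u v w : Fin 4 → ℝ) :
    inner4 M a p (u - v) w = inner4 M a p u w - inner4 M a p v w := by
  simp only [inner4, Pi.sub_apply, ← Finset.sum_sub_distrib]
  exact Finset.sum_congr rfl fun _ _ => Finset.sum_congr rfl fun _ _ => by ring

omit hp in
theorem inner4_sum_smul_left (M a : ℝ) (p : Pt) (f : Fin 4 → ℝ) (v : Fin 4 → Fin 4 → ℝ)
    (w : Fin 4 → ℝ) :
    inner4 M a p (∑ d, f d • v d) w = ∑ d, f d * inner4 M a p (v d) w := by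
  simp only [inner4, Finset.sum_apply, Pi.smul_apply, smul_eq_mul, Fin.sum_univ_four]
  ring

/-- The connection coefficients `g(∇_{e_b} e_c, e_d)` of the frame. -/
noncomputable def connCoeff (M a : ℝ) (p : Pt) (b c d : Fin 4) : ℝ :=
  inner4 M a p (covAlong M a (frame M a b) (frame M a c) p) (frame M a d p)

/-- Koszul's formula in the null frame. -/
theorem connCoeff_eq (ha : |a| ≤ M) (b c d : Fin 4) :
    connCoeff M a p b c d = (1 / 2) * (∑ f, structureConst M a p b c f * eta4 f d
      - ∑ f, structureConst M a p b d f * eta4 f c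
      - ∑ f, structureConst M a p c d f * eta4 f b) := by
  have hd := fun b => differentiableAt_frame M a hp.2 b
  -- The inner products of the frame fields are constant near p, so metric compatibility reads 0 on
  -- the left and leaves antisymmetry in the last two indices.
  have hcompat : ∀ b c d, connCoeff M a p b c d + connCoeff M a p b d c = 0 := by
    intro b c d
    have h := fderiv_inner4 hp ha (frame M a b) (hd c) (hd d)
    rw [inner4_comm M a p (frame M a c p)] at h
    rw [connCoeff, connCoeff, ← h]
    have : (fun q => inner4 M a q (frame M a c q) (frame M a d q)) =ᶠ[nhds p]
        fun _ => eta4 c d := by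
      filter_upwards [(isOpen_region M a).mem_nhds hp] with q hq
      exact inner4_frame M a ha hq.2 c d
    rw [this.fderiv_eq]
    simp
  have htors : ∀ b c d, connCoeff M a p b c d - connCoeff M a p c b d
      = ∑ f, structureConst M a p b c f * eta4 f d := by
    intro b c d
    rw [connCoeff, connCoeff, ← inner4_sub_left, covAlong_sub_covAlong hp (hd b) (hd c),
      lieBracket_frame ha hp.2, inner4_sum_smul_left]
    simp only [inner4_frame M a ha hp.2]
  rw [← htors, ← htors, ← htors]
  -- After the bracket terms are replaced by differences of coefficients, three instances of
  -- antisymmetry remove everything except twice the coefficient sought.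
  linear_combination (1 / 2) * (hcompat b c d + hcompat c b d - hcompat d b c)

end

/-! ### Horizontal operations in the null frame, and their complex form -/

section

variable {p : Pt} {M a : ℝ}

/-- The value `B(u, v)` of a bilinear form given by its components. -/
def bil (B : Fin 4 → Fin 4 → ℝ) (u v : Fin 4 → ℝ) : ℝ := ∑ i, ∑ j, B i j * u i * v j

/-- The orthogonal projection of a vector onto the horizontal distribution. -/
noncomputable def hproj (M a : ℝ) (p : Pt) (w : Fin 4 → ℝ) : Fin 4 → ℝ := fun i =>
  ∑ j, proj M a p i j * w j

theorem hproj_eq (M a : ℝ) (p : Pt) (w : Fin 4 → ℝ) :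
    hproj M a p w = w + (inner4 M a p (e4 M a p) w / 2) • e3 p
      + (inner4 M a p (e3 p) w / 2) • e4 M a p := by
  have hflat : ∀ V : VecField, inner4 M a p (V p) w = ∑ j, flat M a V p j * w j := by
    intro V
    simp only [inner4, flat, Finset.sum_mul]
    rw [Finset.sum_comm]
  funext i
  rw [hflat, hflat]
  simp only [hproj, proj, Fin.sum_univ_four, Pi.add_apply, Pi.smul_apply, smul_eq_mul]
  fin_cases i <;> simp <;> ring

section Pointwise

variable (ha : |a| ≤ M) (hp : 0 < p 1 ^ 2 + p 2 ^ 2)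

include ha hp

theorem hproj_frame (b : Fin 4) :
    hproj M a p (frame M a b p) = if b = 0 ∨ b = 1 then frame M a b p else 0 := by
  have h := fun b c => inner4_frame M a ha hp b c
  rw [hproj_eq]
  simp only [← frame_three, ← frame_two M a, h]
  fin_cases b <;> simp [eta4]

theorem horiz_dotProduct (ς : OneForm) (b : Fin 4) :
    horiz M a ς p ⬝ᵥ frame M a b p = if b = 0 ∨ b = 1 then ς p ⬝ᵥ frame M a b p else 0 := by
  have h : horiz M a ς p ⬝ᵥ frame M a b p = ς p ⬝ᵥ hproj M a p (frame M a b p) := by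
    simp only [horiz, dotProduct, hproj, Finset.mul_sum, Finset.sum_mul]
    rw [Finset.sum_comm]
    exact Finset.sum_congr rfl fun j _ => Finset.sum_congr rfl fun i _ => by ring
  rw [h, hproj_frame ha hp]
  split_ifs <;> simp

/-- The projection fixes e₁ and e₂, so the projections built into `secondFund` and `nabTensor` are
invisible on them. -/
theorem bil_proj (B : Fin 4 → Fin 4 → ℝ) (b c : Fin 4) (hb : b = 0 ∨ b = 1) (hc : c = 0 ∨ c = 1) :
    bil (fun i j => ∑ k, ∑ l, proj M a p k i * proj M a p l j * B k l) (frame M a b p)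
      (frame M a c p) = bil B (frame M a b p) (frame M a c p) := by
  have h : ∀ u v, bil (fun i j => ∑ k, ∑ l, proj M a p k i * proj M a p l j * B k l) u v
      = bil B (hproj M a p u) (hproj M a p v) := by
    intro u v
    have h1 : ∀ (B : Matrix (Fin 4) (Fin 4) ℝ) (u v : Fin 4 → ℝ), bil B u v = u ⬝ᵥ (B *ᵥ v) := by
      intro B u v
      simp only [bil, dotProduct, Matrix.mulVec, Finset.mul_sum]
      exact Finset.sum_congr rfl fun _ _ => Finset.sum_congr rfl fun _ _ => by ring
    let P : Matrix (Fin 4) (Fin 4) ℝ := Matrix.of (proj M a p)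
    have h2 : (fun i j => ∑ k, ∑ l, proj M a p k i * proj M a p l j * B k l)
        = Pᵀ * Matrix.of B * P := by
      funext i j
      simp only [Matrix.mul_apply, Matrix.transpose_apply, Matrix.of_apply, P, Finset.sum_mul]
      rw [Finset.sum_comm]
      exact Finset.sum_congr rfl fun _ _ => Finset.sum_congr rfl fun _ _ => by ring
    have h3 : ∀ w, hproj M a p w = P *ᵥ w := fun w => rfl
    rw [h2, h1, show bil B = bil (Matrix.of B) from rfl, h1, h3, h3, ← Matrix.mulVec_mulVec,
      ← Matrix.mulVec_mulVec, Matrix.dotProduct_mulVec, Matrix.vecMul_transpose]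
  rw [h, hproj_frame ha hp, hproj_frame ha hp, if_pos hb, if_pos hc]

theorem hTr_eq (θ : TwoTensor) :
    hTr M a θ p = bil (θ p) (frame M a 0 p) (frame M a 0 p)
      + bil (θ p) (frame M a 1 p) (frame M a 1 p) := by
  simp only [hTr, hInv_eq ha hp, bil, ← Finset.sum_add_distrib]
  exact Finset.sum_congr rfl fun _ _ => Finset.sum_congr rfl fun _ _ => by ring

theorem epsUp_eq (i j : Fin 4) : epsUp M a p i j =
    frame M a 0 p i * frame M a 1 p j - frame M a 1 p i * frame M a 0 p j := by
  have h := fun b c => eps_frame (a := a) M hp b c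
  have h1 : epsUp M a p i j = ∑ b ∈ {0, 1}, ∑ c ∈ {0, 1}, frame M a b p i * frame M a c p j
      * ∑ k, ∑ l, eps a p k l * frame M a b p k * frame M a c p l := by
    simp only [epsUp, hInv_eq ha hp, Finset.mul_sum, ← Finset.sum_add_distrib,
      Finset.sum_pair (show (0 : Fin 4) ≠ 1 by decide)]
    exact Finset.sum_congr rfl fun _ _ => Finset.sum_congr rfl fun _ _ => by ring
  rw [h1]
  simp only [h, Finset.sum_pair (show (0 : Fin 4) ≠ 1 by decide)]
  simp [area4]
  ring

theorem epsDot_eq (θ : TwoTensor) :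
    epsDot M a θ p = bil (θ p) (frame M a 0 p) (frame M a 1 p)
      - bil (θ p) (frame M a 1 p) (frame M a 0 p) := by
  simp only [epsDot, epsUp_eq ha hp, bil, ← Finset.sum_sub_distrib]
  exact Finset.sum_congr rfl fun _ _ => Finset.sum_congr rfl fun _ _ => by ring

theorem hDot_eq (ς τ : OneForm) :
    hDot M a ς τ p = (ς p ⬝ᵥ frame M a 0 p) * (τ p ⬝ᵥ frame M a 0 p)
      + (ς p ⬝ᵥ frame M a 1 p) * (τ p ⬝ᵥ frame M a 1 p) := by
  simp only [hDot, hInv_eq ha hp, dotProduct, Finset.sum_mul_sum, ← Finset.sum_add_distrib]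
  exact Finset.sum_congr rfl fun _ _ => Finset.sum_congr rfl fun _ _ => by ring

theorem hWedge_eq (ς τ : OneForm) :
    hWedge M a ς τ p = (ς p ⬝ᵥ frame M a 0 p) * (τ p ⬝ᵥ frame M a 1 p)
      - (ς p ⬝ᵥ frame M a 1 p) * (τ p ⬝ᵥ frame M a 0 p) := by
  simp only [hWedge, epsUp_eq ha hp, dotProduct, Finset.sum_mul_sum, ← Finset.sum_sub_distrib]
  exact Finset.sum_congr rfl fun _ _ => Finset.sum_congr rfl fun _ _ => by ring

theorem sharpDot_dotProduct (θ : TwoTensor) (ς : OneForm) (w : Fin 4 → ℝ) :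
    sharpDot M a θ ς p ⬝ᵥ w = bil (θ p) w (frame M a 0 p) * (ς p ⬝ᵥ frame M a 0 p)
      + bil (θ p) w (frame M a 1 p) * (ς p ⬝ᵥ frame M a 1 p) := by
  have h : ∀ i, sharpDot M a θ ς p i
      = (∑ k, θ p i k * frame M a 0 p k) * (ς p ⬝ᵥ frame M a 0 p)
      + (∑ k, θ p i k * frame M a 1 p k) * (ς p ⬝ᵥ frame M a 1 p) := by
    intro i
    simp only [sharpDot, hInv_eq ha hp, dotProduct, Finset.sum_mul_sum]
    rw [Finset.sum_comm, ← Finset.sum_add_distrib]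
    refine Finset.sum_congr rfl fun _ _ => ?_
    rw [← Finset.sum_add_distrib]
    exact Finset.sum_congr rfl fun _ _ => by ring
  rw [show sharpDot M a θ ς p = _ from funext h, dotProduct]
  simp only [bil, Finset.sum_mul, add_mul, Finset.sum_add_distrib]
  congr 1 <;> exact Finset.sum_congr rfl fun _ _ => Finset.sum_congr rfl fun _ _ => by ring

theorem hStar_dotProduct (ς : OneForm) (b : Fin 4) :
    hStar M a ς p ⬝ᵥ frame M a b p = area4 b 0 * (ς p ⬝ᵥ frame M a 0 p)
      + area4 b 1 * (ς p ⬝ᵥ frame M a 1 p) := by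
  have h : hStar M a ς p = sharpDot M a (eps a) ς p := by
    funext i
    simp only [hStar, sharpDot]
    exact Finset.sum_congr rfl fun _ _ => Finset.sum_congr rfl fun _ _ => by ring
  rw [h, sharpDot_dotProduct ha hp]
  simp only [bil, eps_frame M hp]

theorem secondFund_frame (V : VecField) (b c : Fin 4) (hb : b = 0 ∨ b = 1) (hc : c = 0 ∨ c = 1) :
    bil (secondFund M a V p) (frame M a b p) (frame M a c p)
      = inner4 M a p (covAlong M a (frame M a b) V p) (frame M a c p) := by
  have h : secondFund M a V p = fun i j => ∑ k, ∑ l, proj M a p k i * proj M a p l j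
      * ∑ m, metric M a p m l * covVec M a V p k m := by
    funext i j
    simp only [secondFund, Finset.mul_sum]
    exact Finset.sum_congr rfl fun _ _ => Finset.sum_congr rfl fun _ _ =>
      Finset.sum_congr rfl fun _ _ => by ring
  rw [h, bil_proj ha hp _ b c hb hc]
  simp only [bil, inner4, covAlong, Finset.sum_mul, Finset.mul_sum]
  have h1 : ∀ k, ∑ l, ∑ m, metric M a p m l * covVec M a V p k m * frame M a b p k
      * frame M a c p l = ∑ m, ∑ l, metric M a p m l * covVec M a V p k m * frame M a b p k
      * frame M a c p l := fun k => Finset.sum_comm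
  simp only [h1]
  rw [Finset.sum_comm]
  refine Finset.sum_congr rfl fun _ _ => ?_
  rw [Finset.sum_comm]
  exact Finset.sum_congr rfl fun _ _ => Finset.sum_congr rfl fun _ _ => by ring

/-- A horizontal covector sees only the e₁ and e₂ parts of a vector. When v is a covariant
derivative of a frame field, only connection coefficients with a horizontal last index survive. -/
theorem dotProduct_eq_of_horizontal {u : Fin 4 → ℝ} (h3 : u ⬝ᵥ e3 p = 0) (h4 : u ⬝ᵥ e4 M a p = 0)
    (v : Fin 4 → ℝ) :
    u ⬝ᵥ v = inner4 M a p v (frame M a 0 p) * (u ⬝ᵥ frame M a 0 p)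
      + inner4 M a p v (frame M a 1 p) * (u ⬝ᵥ frame M a 1 p) := by
  conv_lhs => rw [frame_expansion ha hp v]
  simp only [dotProduct_add, dotProduct_sub, dotProduct_smul, h3, h4, smul_eq_mul]
  ring

end Pointwise

section Coefficients

variable (ha : |a| ≤ M) (hp : p ∈ region M a)

include ha hp

theorem connCoeff_antisymm (b c d : Fin 4) :
    connCoeff M a p b c d = -connCoeff M a p b d c := by
  rw [connCoeff_eq hp ha, connCoeff_eq hp ha]
  have h : structureConst M a p d c = -structureConst M a p c d := by
    fin_cases d <;> fin_cases c <;> simp [structureConst]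
  simp only [h, Pi.neg_apply, neg_mul, Finset.sum_neg_distrib]
  ring

/-- The components of χ and χ̲ are frame connection coefficients g(∇_A e₄, e_B), g(∇_A e₃, e_B), so
this and the next three values are read off the brackets by Koszul's formula. -/
theorem trChi_eq : trChi M a p = 2 * rad p * bigDelta M a p / bigSigma a p ^ 2 := by
  rw [trChi, hTr_eq ha hp.2, chi, secondFund_frame ha hp.2 _ _ _ (by simp) (by simp),
    secondFund_frame ha hp.2 _ _ _ (by simp) (by simp), ← frame_three, ← connCoeff, ← connCoeff,
    connCoeff_eq hp ha, connCoeff_eq hp ha]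
  simp [Fin.sum_univ_four, structureConst, eta4]
  ring

theorem epsChi_eq : epsChi M a p = 2 * a * cosTheta p * bigDelta M a p / bigSigma a p ^ 2 := by
  rw [epsChi, epsDot_eq ha hp.2, chi, secondFund_frame ha hp.2 _ _ _ (by simp) (by simp),
    secondFund_frame ha hp.2 _ _ _ (by simp) (by simp), ← frame_three, ← connCoeff, ← connCoeff,
    connCoeff_eq hp ha, connCoeff_eq hp ha]
  simp [Fin.sum_univ_four, structureConst, eta4]
  ring

theorem trChiBar_eq : trChiBar M a p = -(2 * rad p / bigSigma a p) := by
  rw [trChiBar, hTr_eq ha hp.2, chiBar, secondFund_frame ha hp.2 _ _ _ (by simp) (by simp),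
    secondFund_frame ha hp.2 _ _ _ (by simp) (by simp), ← frame_two M a, ← connCoeff, ← connCoeff,
    connCoeff_eq hp ha, connCoeff_eq hp ha]
  simp [Fin.sum_univ_four, structureConst, eta4]
  ring

theorem epsChiBar_eq : epsChiBar M a p = 2 * a * cosTheta p / bigSigma a p := by
  rw [epsChiBar, epsDot_eq ha hp.2, chiBar, secondFund_frame ha hp.2 _ _ _ (by simp) (by simp),
    secondFund_frame ha hp.2 _ _ _ (by simp) (by simp), ← frame_two M a, ← connCoeff, ← connCoeff,
    connCoeff_eq hp ha, connCoeff_eq hp ha]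
  simp [Fin.sum_univ_four, structureConst, eta4]
  ring

/-- `χ` is shear-free. -/
theorem chi_frame (b c : Fin 4) (hb : b = 0 ∨ b = 1) (hc : c = 0 ∨ c = 1) :
    bil (chi M a p) (frame M a b p) (frame M a c p)
      = (if b = c then trChi M a p / 2 else 0) + area4 b c * (epsChi M a p / 2) := by
  rw [chi, secondFund_frame ha hp.2 _ _ _ hb hc, trChi_eq ha hp, epsChi_eq ha hp, ← frame_three,
    ← connCoeff, connCoeff_eq hp ha]
  rcases hb with rfl | rfl <;> rcases hc with rfl | rfl <;>
    simp [Fin.sum_univ_four, structureConst, eta4, area4] <;> ring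

/-- `χ̲` is shear-free. -/
theorem chiBar_frame (b c : Fin 4) (hb : b = 0 ∨ b = 1) (hc : c = 0 ∨ c = 1) :
    bil (chiBar M a p) (frame M a b p) (frame M a c p)
      = (if b = c then trChiBar M a p / 2 else 0) + area4 b c * (epsChiBar M a p / 2) := by
  rw [chiBar, secondFund_frame ha hp.2 _ _ _ hb hc, trChiBar_eq ha hp, epsChiBar_eq ha hp,
    ← frame_two M a, ← connCoeff, connCoeff_eq hp ha]
  rcases hb with rfl | rfl <;> rcases hc with rfl | rfl <;>
    simp [Fin.sum_univ_four, structureConst, eta4, area4] <;> ring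

omit ha hp in
theorem flat_dotProduct (V : VecField) (w : Fin 4 → ℝ) :
    flat M a V p ⬝ᵥ w = inner4 M a p (V p) w := by
  simp only [inner4, flat, dotProduct, Finset.sum_mul]
  rw [Finset.sum_comm]

theorem eta_frame (b : Fin 4) : eta M a p ⬝ᵥ frame M a b p
    = if b = 0 ∨ b = 1 then (1 / 2) * connCoeff M a p 2 3 b else 0 := by
  have : eta M a p
      = (1 / 2 : ℝ) • horiz M a (flat M a (covAlong M a e3 (e4 M a))) p := rfl
  rw [this, smul_dotProduct, horiz_dotProduct ha hp.2, flat_dotProduct, connCoeff,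
    frame_two, frame_three]
  split_ifs <;> simp

theorem etaBar_frame (b : Fin 4) : etaBar M a p ⬝ᵥ frame M a b p
    = if b = 0 ∨ b = 1 then (1 / 2) * connCoeff M a p 3 2 b else 0 := by
  have : etaBar M a p
      = (1 / 2 : ℝ) • horiz M a (flat M a (covAlong M a (e4 M a) e3)) p := rfl
  rw [this, smul_dotProduct, horiz_dotProduct ha hp.2, flat_dotProduct, connCoeff,
    frame_two, frame_three]
  split_ifs <;> simp

end Coefficients

open Complex in
/-- The complex component `ς(e₁) + i ς(e₂)`. -/
noncomputable def cx (M a : ℝ) (ς : OneForm) (p : Pt) : ℂ :=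
  ((ς p ⬝ᵥ frame M a 0 p : ℝ) : ℂ) + ((ς p ⬝ᵥ frame M a 1 p : ℝ) : ℂ) * I

open Complex in
/-- The derivative along `m = e₁ + i e₂`. -/
noncomputable def mDeriv (M a : ℝ) (f : Pt → ℂ) (p : Pt) : ℂ :=
  fderiv ℝ f p (frame M a 0 p) + fderiv ℝ f p (frame M a 1 p) * I

open Complex in
/-- The derivative along `m̄ = e₁ - i e₂`. -/
noncomputable def mBarDeriv (M a : ℝ) (f : Pt → ℂ) (p : Pt) : ℂ :=
  fderiv ℝ f p (frame M a 0 p) - fderiv ℝ f p (frame M a 1 p) * I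

/-- `ς` vanishes on `e₃` and `e₄` at the point `p`. -/
def HorizontalAt (M a : ℝ) (ς : OneForm) (p : Pt) : Prop :=
  ς p ⬝ᵥ e3 p = 0 ∧ ς p ⬝ᵥ e4 M a p = 0

theorem hasFDerivAt_ofReal {f : Pt → ℝ} (hf : DifferentiableAt ℝ f p) :
    HasFDerivAt (fun q => (f q : ℂ)) (Complex.ofRealCLM.comp (fderiv ℝ f p)) p :=
  Complex.ofRealCLM.hasFDerivAt.comp p hf.hasFDerivAt

theorem differentiableAt_ofReal_add {f g : Pt → ℝ} (hf : DifferentiableAt ℝ f p)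
    (hg : DifferentiableAt ℝ g p) :
    DifferentiableAt ℝ (fun q => (f q : ℂ) + (g q : ℂ) * Complex.I) p :=
  (hasFDerivAt_ofReal hf).differentiableAt.fun_add
    ((hasFDerivAt_ofReal hg).differentiableAt.mul_const _)

theorem fderiv_ofReal_apply {f : Pt → ℝ} (hf : DifferentiableAt ℝ f p) (v : Fin 4 → ℝ) :
    fderiv ℝ (fun q => (f q : ℂ)) p v = fderiv ℝ f p v := by
  rw [(hasFDerivAt_ofReal hf).fderiv]; rfl

theorem fderiv_ofReal_add {f g : Pt → ℝ} (hf : DifferentiableAt ℝ f p)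
    (hg : DifferentiableAt ℝ g p) (v : Fin 4 → ℝ) :
    fderiv ℝ (fun q => (f q : ℂ) + (g q : ℂ) * Complex.I) p v
      = fderiv ℝ f p v + fderiv ℝ g p v * Complex.I := by
  have h2 := (hasFDerivAt_ofReal hg).differentiableAt
  rw [fderiv_fun_add (hasFDerivAt_ofReal hf).differentiableAt (h2.mul_const _),
    fderiv_mul_const h2]
  simp [fderiv_ofReal_apply hf, fderiv_ofReal_apply hg]
  ring

theorem differentiableAt_dotProduct {u v : Pt → Fin 4 → ℝ} (hu : DifferentiableAt ℝ u p)
    (hv : DifferentiableAt ℝ v p) : DifferentiableAt ℝ (fun q => u q ⬝ᵥ v q) p := by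
  simp only [dotProduct]
  exact .fun_sum fun i _ => (differentiableAt_pi.1 hu i).fun_mul (differentiableAt_pi.1 hv i)

/-- Duality of the two covariant derivatives: (∇_X ς)(Y) = X(ς(Y)) - ς(∇_X Y). -/
theorem covForm_apply (hp : p ∈ region M a) (X : VecField) {ς : OneForm} {Y : VecField}
    (hς : DifferentiableAt ℝ ς p) (hY : DifferentiableAt ℝ Y p) :
    ∑ j, (∑ i, X p i * covForm M a ς p i j) * Y p j
      = fderiv ℝ (fun q => ς q ⬝ᵥ Y q) p (X p) - ς p ⬝ᵥ covAlong M a X Y p := by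
  have hς' := fun i => differentiableAt_pi.1 hς i
  have hY' := fun i => differentiableAt_pi.1 hY i
  have h1 : fderiv ℝ (fun q => ς q ⬝ᵥ Y q) p (X p)
      = ∑ j, fderiv ℝ (fun q => ς q j) p (X p) * Y p j + ς p ⬝ᵥ fderiv ℝ Y p (X p) := by
    simp only [dotProduct]
    rw [fderiv_fun_sum fun j _ => (hς' j).fun_mul (hY' j), sum_apply, ← Finset.sum_add_distrib]
    refine Finset.sum_congr rfl fun j _ => ?_
    have h2 : fderiv ℝ Y p (X p) j = fderiv ℝ (fun q => Y q j) p (X p) := by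
      rw [fderiv_apply hY]; rfl
    rw [fderiv_fun_mul (hς' j) (hY' j), h2]
    simp
    ring
  have h3 : ∀ j, fderiv ℝ (fun q => ς q j) p (X p) = ∑ i, X p i * pd M a i (fun q => ς q j) p := by
    intro j
    rw [clm_apply_eq_sum (fderiv ℝ (fun q => ς q j) p)]
    simp [pd_eq_fderiv hp]
  have h4 : ς p ⬝ᵥ covAlong M a X Y p = ς p ⬝ᵥ fderiv ℝ Y p (X p)
      + ∑ j, (∑ i, X p i * ∑ k, christoffel M a k i j p * ς p k) * Y p j := by
    have : covAlong M a X Y p = fderiv ℝ Y p (X p)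
        + fun k => ∑ i, ∑ j, X p i * christoffel M a k i j p * Y p j :=
      funext fun k => covAlong_apply hp X hY k
    rw [this, dotProduct_add]
    congr 1
    simp only [dotProduct, Finset.mul_sum, Finset.sum_mul]
    have e1 : ∀ k, ∑ i, ∑ j, ς p k * (X p i * christoffel M a k i j p * Y p j)
        = ∑ j, ∑ i, ς p k * (X p i * christoffel M a k i j p * Y p j) :=
      fun k => Finset.sum_comm
    simp only [e1]
    rw [Finset.sum_comm]
    refine Finset.sum_congr rfl fun j _ => ?_
    rw [Finset.sum_comm]
    exact Finset.sum_congr rfl fun _ _ => Finset.sum_congr rfl fun _ _ => by ring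
  rw [h1, h4]
  simp only [h3, covForm, mul_sub, sub_mul, Finset.sum_sub_distrib]
  ring

section Complex

open Complex

variable (ha : |a| ≤ M) (hp : p ∈ region M a)

include hp

theorem differentiableAt_cx {ς : OneForm} (hς : DifferentiableAt ℝ ς p) :
    DifferentiableAt ℝ (cx M a ς) p :=
  differentiableAt_ofReal_add
    (differentiableAt_dotProduct hς (differentiableAt_frame M a hp.2 0))
    (differentiableAt_dotProduct hς (differentiableAt_frame M a hp.2 1))

theorem fderiv_cx {ς : OneForm} (hς : DifferentiableAt ℝ ς p) (v : Fin 4 → ℝ) :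
    fderiv ℝ (cx M a ς) p v = fderiv ℝ (fun q => ς q ⬝ᵥ frame M a 0 q) p v
      + fderiv ℝ (fun q => ς q ⬝ᵥ frame M a 1 q) p v * I :=
  fderiv_ofReal_add
    (differentiableAt_dotProduct hς (differentiableAt_frame M a hp.2 0))
    (differentiableAt_dotProduct hς (differentiableAt_frame M a hp.2 1)) v

include ha

theorem horizontalAt_horiz (ς : OneForm) : HorizontalAt M a (horiz M a ς) p := by
  constructor
  · rw [← frame_two M a, horiz_dotProduct ha hp.2]; simp
  · rw [← frame_three, horiz_dotProduct ha hp.2]; simp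

theorem horizontalAt_hStar (ς : OneForm) : HorizontalAt M a (hStar M a ς) p := by
  constructor
  · rw [← frame_two M a, hStar_dotProduct ha hp.2]; simp [area4]
  · rw [← frame_three, hStar_dotProduct ha hp.2]; simp [area4]

theorem dotProduct_covAlong {ς : OneForm} (hh : HorizontalAt M a ς p) (b c : Fin 4) :
    ς p ⬝ᵥ covAlong M a (frame M a b) (frame M a c) p
      = connCoeff M a p b c 0 * (ς p ⬝ᵥ frame M a 0 p)
      + connCoeff M a p b c 1 * (ς p ⬝ᵥ frame M a 1 p) :=
  dotProduct_eq_of_horizontal ha hp.2 hh.1 hh.2 _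

theorem connCoeff_self (b c : Fin 4) : connCoeff M a p b c c = 0 := by
  linarith [connCoeff_antisymm ha hp b c c]

/-- The induced connection is metric on a bundle of rank two, so its connection form is an
infinitesimal rotation, that is, multiplication by i times the real number g(∇_X e₁, e₂). -/
theorem cx_nab {ς : OneForm} (hς : DifferentiableAt ℝ ς p) (hh : HorizontalAt M a ς p)
    (b : Fin 4) :
    cx M a (nab M a (frame M a b) ς) p
      = fderiv ℝ (cx M a ς) p (frame M a b p) + I * connCoeff M a p b 0 1 * cx M a ς p := by
  have key : ∀ c, (c = 0 ∨ c = 1) → nab M a (frame M a b) ς p ⬝ᵥ frame M a c p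
      = fderiv ℝ (fun q => ς q ⬝ᵥ frame M a c q) p (frame M a b p)
        - (connCoeff M a p b c 0 * (ς p ⬝ᵥ frame M a 0 p)
          + connCoeff M a p b c 1 * (ς p ⬝ᵥ frame M a 1 p)) := by
    intro c hc
    rw [nab, horiz_dotProduct ha hp.2, if_pos hc, ← dotProduct_covAlong ha hp hh,
      ← covForm_apply hp _ hς (differentiableAt_frame M a hp.2 c)]
    rfl
  rw [fderiv_cx hp hς, cx, key 0 (by simp), key 1 (by simp), connCoeff_self ha hp,
    connCoeff_self ha hp, connCoeff_antisymm ha hp b 1 0, cx]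
  push_cast
  linear_combination (-(connCoeff M a p b 0 1 : ℂ) * (ς p ⬝ᵥ frame M a 1 p : ℝ)) * I_sq

theorem cx_hStar (ς : OneForm) : cx M a (hStar M a ς) p = -I * cx M a ς p := by
  rw [cx, hStar_dotProduct ha hp.2, hStar_dotProduct ha hp.2, cx]
  simp [area4]
  linear_combination ((ς p ⬝ᵥ frame M a 1 p : ℝ) : ℂ) * I_sq

theorem cx_grad {f : Pt → ℝ} (hf : DifferentiableAt ℝ f p) :
    cx M a (grad M a f) p = mDeriv M a (fun q => (f q : ℂ)) p := by
  have key : ∀ c, (c = 0 ∨ c = 1) → grad M a f p ⬝ᵥ frame M a c p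
      = fderiv ℝ f p (frame M a c p) := by
    intro c hc
    rw [grad, horiz_dotProduct ha hp.2, if_pos hc, ← dirDeriv_eq_fderiv hp, dirDeriv, dotProduct]
    exact Finset.sum_congr rfl fun _ _ => mul_comm _ _
  rw [cx, key 0 (by simp), key 1 (by simp), mDeriv, fderiv_ofReal_apply hf,
    fderiv_ofReal_apply hf]

/-- To leading order, (e₁ - ie₂)(ς₁ + iς₂) has real part e₁ς₁ + e₂ς₂ and imaginary part e₁ς₂ - e₂ς₁;
the connection terms combine into the zeroth-order coefficient. -/
theorem div_add_curl {ς : OneForm} (hς : DifferentiableAt ℝ ς p) (hh : HorizontalAt M a ς p) :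
    (hDiv M a ς p : ℂ) + hCurl M a ς p * I = mBarDeriv M a (cx M a ς) p
      + (I * connCoeff M a p 0 0 1 + connCoeff M a p 1 0 1) * cx M a ς p := by
  have key : ∀ b c, (b = 0 ∨ b = 1) → (c = 0 ∨ c = 1) →
      bil (nabTensor M a ς p) (frame M a b p) (frame M a c p)
      = fderiv ℝ (fun q => ς q ⬝ᵥ frame M a c q) p (frame M a b p)
        - (connCoeff M a p b c 0 * (ς p ⬝ᵥ frame M a 0 p)
          + connCoeff M a p b c 1 * (ς p ⬝ᵥ frame M a 1 p)) := by
    intro b c hb hc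
    have : nabTensor M a ς p = fun i j => ∑ k, ∑ l, proj M a p k i * proj M a p l j
      * covForm M a ς p k l := rfl
    rw [this, bil_proj ha hp.2 _ b c hb hc, ← dotProduct_covAlong ha hp hh,
      ← covForm_apply hp _ hς (differentiableAt_frame M a hp.2 c), bil, Finset.sum_comm]
    refine Finset.sum_congr rfl fun _ _ => ?_
    rw [Finset.sum_mul]
    exact Finset.sum_congr rfl fun _ _ => by ring
  rw [hDiv, hCurl, hTr_eq ha hp.2, epsDot_eq ha hp.2, key 0 0 (by simp) (by simp),
    key 0 1 (by simp) (by simp), key 1 0 (by simp) (by simp), key 1 1 (by simp) (by simp),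
    mBarDeriv, fderiv_cx hp hς, fderiv_cx hp hς, cx]
  simp only [connCoeff_self ha hp, connCoeff_antisymm ha hp _ 1 0]
  push_cast
  ring_nf
  simp only [I_sq]
  ring

end Complex

end

/-! ### The functions ζ and ζ̄, and the commutators with m -/

section

open Complex

variable {p : Pt} {M a : ℝ}

/-- `ζ = r + i a cos θ`. -/
noncomputable def zeta (a : ℝ) (p : Pt) : ℂ := rad p + a * cosTheta p * I

/-- `ζ̄ = r - i a cos θ`. -/
noncomputable def zetaBar (a : ℝ) (p : Pt) : ℂ := rad p - a * cosTheta p * I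

/-- `i a sin θ`. -/
noncomputable def iaSin (a : ℝ) (p : Pt) : ℂ := a * sinTheta p * I

theorem zeta_mul_zetaBar (a : ℝ) (p : Pt) : zeta a p * zetaBar a p = bigSigma a p := by
  rw [zeta, zetaBar, bigSigma]
  push_cast
  linear_combination (-(a * cosTheta p) ^ 2 : ℂ) * I_sq

theorem rad_eq_zeta (a : ℝ) (p : Pt) : (rad p : ℂ) = (zeta a p + zetaBar a p) / 2 := by
  rw [zeta, zetaBar]; ring

theorem cosTheta_eq_zeta (a : ℝ) (p : Pt) :
    (a * cosTheta p : ℂ) * I = (zeta a p - zetaBar a p) / 2 := by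
  rw [zeta, zetaBar]; ring

theorem zeta_ne_zero (a : ℝ) (hr : 0 < rad p) : zeta a p ≠ 0 := by
  intro h
  have := zeta_mul_zetaBar a p
  rw [h, zero_mul] at this
  exact (bigSigma_pos a hr).ne' (by exact_mod_cast this.symm)

theorem zetaBar_ne_zero (a : ℝ) (hr : 0 < rad p) : zetaBar a p ≠ 0 := by
  intro h
  have := zeta_mul_zetaBar a p
  rw [h, mul_zero] at this
  exact (bigSigma_pos a hr).ne' (by exact_mod_cast this.symm)

section Derivatives

variable (hp : 0 < p 1 ^ 2 + p 2 ^ 2)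

include hp

theorem hasSphDeriv_zeta (a : ℝ) : HasSphDeriv (zeta a) 1 (-iaSin a p) p := by
  have h := (hasSphDeriv_rad hp).ofReal.add
    (((hasSphDeriv_cosTheta hp).ofReal.const_mul (a : ℂ)).mul (.const I))
  exact h.congr (by push_cast; ring) (by push_cast; rw [iaSin]; ring)

theorem hasSphDeriv_zetaBar (a : ℝ) : HasSphDeriv (zetaBar a) 1 (iaSin a p) p := by
  have h := (hasSphDeriv_rad hp).ofReal.sub
    (((hasSphDeriv_cosTheta hp).ofReal.const_mul (a : ℂ)).mul (.const I))
  exact h.congr (by push_cast; ring) (by push_cast; rw [iaSin]; ring)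

theorem hasSphDeriv_iaSin (a : ℝ) :
    HasSphDeriv (iaSin a) 0 ((zeta a p - zetaBar a p) / 2) p := by
  have h := ((hasSphDeriv_sinTheta hp).ofReal.const_mul (a : ℂ)).mul (.const I)
  exact h.congr (by push_cast; ring) (by rw [← cosTheta_eq_zeta]; ring)

theorem hasSphDeriv_bigDelta_complex (M a : ℝ) :
    HasSphDeriv (fun q => (bigDelta M a q : ℂ)) ((2 * rad p - 2 * M : ℝ) : ℂ) 0 p :=
  (hasSphDeriv_bigDelta hp M a).ofReal.congr rfl (by simp)

variable {f : Pt → ℂ} {fr fθ : ℂ}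

/-- The field m has no r-component, and its θ-component is (r - ia cos θ)/Σ = ζ̄/Σ = 1/ζ. -/
theorem HasSphDeriv.mDeriv_eq (h : HasSphDeriv f fr fθ p) : mDeriv M a f p = fθ / zeta a p := by
  have hr := rad_pos_of_offAxis hp
  have hz := zeta_ne_zero a hr
  have hz' := zetaBar_ne_zero a hr
  rw [mDeriv, frame, frame, h.fderiv_sph, h.fderiv_sph]
  simp [frameComp, e1Comp, e2Comp, ← zeta_mul_zetaBar]
  rw [zetaBar] at hz'
  rw [zetaBar]
  field_simp
  ring

theorem HasSphDeriv.mBarDeriv_eq (h : HasSphDeriv f fr fθ p) :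
    mBarDeriv M a f p = fθ / zetaBar a p := by
  have hr := rad_pos_of_offAxis hp
  have hz := zeta_ne_zero a hr
  have hz' := zetaBar_ne_zero a hr
  rw [mBarDeriv, frame, frame, h.fderiv_sph, h.fderiv_sph]
  simp [frameComp, e1Comp, e2Comp, ← zeta_mul_zetaBar]
  rw [zeta] at hz
  rw [zeta]
  field_simp

omit hp in
theorem HasSphDeriv.fderiv_frame_two (h : HasSphDeriv f fr fθ p) :
    fderiv ℝ f p (frame M a 2 p) = -fr := by
  rw [frame, h.fderiv_sph]
  simp [frameComp, e3Comp]

omit hp in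
theorem HasSphDeriv.fderiv_frame_three (h : HasSphDeriv f fr fθ p) :
    fderiv ℝ f p (frame M a 3 p) = bigDelta M a p / (zeta a p * zetaBar a p) * fr := by
  rw [frame, h.fderiv_sph, zeta_mul_zetaBar]
  simp [frameComp, e4Comp]

end Derivatives

theorem two_le_infty : (2 : ℕ∞ω) ≤ ∞ := WithTop.coe_le_coe.2 (le_top : (2 : ℕ∞) ≤ ⊤)

section Operators

variable {f g : Pt → ℂ}

theorem mDeriv_add (hf : DifferentiableAt ℝ f p) (hg : DifferentiableAt ℝ g p) :
    mDeriv M a (fun q => f q + g q) p = mDeriv M a f p + mDeriv M a g p := by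
  simp only [mDeriv, fderiv_fun_add hf hg, add_apply]
  ring

theorem mDeriv_mul (hf : DifferentiableAt ℝ f p) (hg : DifferentiableAt ℝ g p) :
    mDeriv M a (fun q => f q * g q) p = mDeriv M a f p * g p + f p * mDeriv M a g p := by
  simp only [mDeriv, fderiv_fun_mul hf hg, add_apply, smul_apply, smul_eq_mul]
  ring

theorem mBarDeriv_mul (hf : DifferentiableAt ℝ f p) (hg : DifferentiableAt ℝ g p) :
    mBarDeriv M a (fun q => f q * g q) p = mBarDeriv M a f p * g p + f p * mBarDeriv M a g p := by
  simp only [mBarDeriv, fderiv_fun_mul hf hg, add_apply, smul_apply, smul_eq_mul]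
  ring

theorem fderiv_mul_apply (hf : DifferentiableAt ℝ f p) (hg : DifferentiableAt ℝ g p)
    (v : Fin 4 → ℝ) :
    fderiv ℝ (fun q => f q * g q) p v = fderiv ℝ f p v * g p + f p * fderiv ℝ g p v := by
  simp only [fderiv_fun_mul hf hg, add_apply, smul_apply, smul_eq_mul]
  ring

theorem fderiv_add_apply (hf : DifferentiableAt ℝ f p) (hg : DifferentiableAt ℝ g p)
    (v : Fin 4 → ℝ) :
    fderiv ℝ (fun q => f q + g q) p v = fderiv ℝ f p v + fderiv ℝ g p v := by
  simp only [fderiv_fun_add hf hg, add_apply]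

variable (ha : |a| ≤ M) (hp : 0 < p 1 ^ 2 + p 2 ^ 2) {ψ : Pt → ℂ} (hψ : ContDiffAt ℝ ∞ ψ p)

include hp hψ

theorem differentiableAt_fderiv_frame (b : Fin 4) :
    DifferentiableAt ℝ (fun q => fderiv ℝ ψ q (frame M a b q)) p := by
  have h : ContDiffAt ℝ 1 (fderiv ℝ ψ) p := hψ.fderiv_right (m := 1)
    (by simpa [one_add_one_eq_two] using two_le_infty)
  exact (h.differentiableAt one_ne_zero).clm_apply (differentiableAt_frame M a hp b)

theorem differentiableAt_mDeriv : DifferentiableAt ℝ (mDeriv M a ψ) p :=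
  (differentiableAt_fderiv_frame hp hψ 0).fun_add
    ((differentiableAt_fderiv_frame hp hψ 1).mul_const _)

include ha

/-- Symmetry of the second derivative of ψ turns the commutator of two frame derivatives into the
derivative along their bracket. -/
theorem fderiv_frame_comm (b c : Fin 4) :
    fderiv ℝ (fun q => fderiv ℝ ψ q (frame M a c q)) p (frame M a b p)
      - fderiv ℝ (fun q => fderiv ℝ ψ q (frame M a b q)) p (frame M a c p)
      = ∑ d, structureConst M a p b c d * fderiv ℝ ψ p (frame M a d p) := by
  rw [← VectorField.fderiv_apply_lieBracket hψ (by simpa using two_le_infty) (differentiableAt_frame M a hp c)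
    (differentiableAt_frame M a hp b), lieBracket_frame ha hp]
  simp

theorem fderiv_mDeriv (b : Fin 4) :
    fderiv ℝ (mDeriv M a ψ) p (frame M a b p)
      = mDeriv M a (fun q => fderiv ℝ ψ q (frame M a b q)) p
        + ∑ d, (structureConst M a p b 0 d + structureConst M a p b 1 d * I)
          * fderiv ℝ ψ p (frame M a d p) := by
  have h0 := differentiableAt_fderiv_frame (M := M) (a := a) hp hψ 0
  have h1 := differentiableAt_fderiv_frame (M := M) (a := a) hp hψ 1
  have e : fderiv ℝ (mDeriv M a ψ) p (frame M a b p)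
      = fderiv ℝ (fun q => fderiv ℝ ψ q (frame M a 0 q)) p (frame M a b p)
      + fderiv ℝ (fun q => fderiv ℝ ψ q (frame M a 1 q)) p (frame M a b p) * I := by
    rw [show mDeriv M a ψ = fun q => fderiv ℝ ψ q (frame M a 0 q)
      + fderiv ℝ ψ q (frame M a 1 q) * I from rfl, fderiv_add_apply h0 (h1.mul_const _),
      fderiv_mul_const h1]
    simp
    ring
  have c0 := fderiv_frame_comm ha hp hψ b 0
  have c1 := fderiv_frame_comm ha hp hψ b 1
  rw [e, mDeriv]
  simp only [add_mul, Finset.sum_add_distrib]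
  have e2 : ∑ d, (structureConst M a p b 1 d : ℂ) * I * fderiv ℝ ψ p (frame M a d p)
      = (∑ d, (structureConst M a p b 1 d : ℂ) * fderiv ℝ ψ p (frame M a d p)) * I := by
    rw [Finset.sum_mul]
    exact Finset.sum_congr rfl fun _ _ => by ring
  rw [e2]
  linear_combination c0 + I * c1

/-- The commutator `[e₃, m] = ζ⁻¹ m`. -/
theorem fderiv_e3_mDeriv :
    fderiv ℝ (mDeriv M a ψ) p (frame M a 2 p)
      = mDeriv M a (fun q => fderiv ℝ ψ q (frame M a 2 q)) p + mDeriv M a ψ p / zeta a p := by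
  have hr := rad_pos_of_offAxis hp
  have hz := zeta_ne_zero a hr
  have hz' := zetaBar_ne_zero a hr
  rw [fderiv_mDeriv ha hp hψ, add_right_inj, mDeriv]
  simp [Fin.sum_univ_four, structureConst, ← zeta_mul_zetaBar]
  have hzb : zetaBar a p = rad p - a * cosTheta p * I := rfl
  field_simp
  rw [hzb]
  linear_combination ((a * cosTheta p * fderiv ℝ ψ p (frame M a 1 p)) : ℂ) * I_sq

/-- The commutator `[e₄, m]`. -/
theorem fderiv_e4_mDeriv :
    fderiv ℝ (mDeriv M a ψ) p (frame M a 3 p)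
      = mDeriv M a (fun q => fderiv ℝ ψ q (frame M a 3 q)) p
        - bigDelta M a p / (zeta a p ^ 2 * zetaBar a p) * mDeriv M a ψ p
        + iaSin a p * (zeta a p - zetaBar a p) / (zeta a p ^ 2 * zetaBar a p)
          * fderiv ℝ ψ p (frame M a 3 p) := by
  have hr := rad_pos_of_offAxis hp
  have hz := zeta_ne_zero a hr
  have hz' := zetaBar_ne_zero a hr
  have hS := (bigSigma_pos a hr).ne'
  have hS' : (bigSigma a p : ℂ) ≠ 0 := by exact_mod_cast hS
  -- Making the denominators real leaves ζ and ζ̄ only in numerators, where they can be expanded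
  -- into r and a cos θ.
  have hinv : ∀ x : ℂ, x / (zeta a p ^ 2 * zetaBar a p) = x * zetaBar a p / bigSigma a p ^ 2 := by
    intro x
    rw [← zeta_mul_zetaBar]
    field_simp
  have hsum : ∑ d, ((structureConst M a p 3 0 d : ℂ) + structureConst M a p 3 1 d * I)
      * fderiv ℝ ψ p (frame M a d p)
      = -(bigDelta M a p / (zeta a p ^ 2 * zetaBar a p) * mDeriv M a ψ p)
        + iaSin a p * (zeta a p - zetaBar a p) / (zeta a p ^ 2 * zetaBar a p)
          * fderiv ℝ ψ p (frame M a 3 p) := by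
    rw [hinv, hinv, mDeriv, iaSin, zeta, zetaBar]
    simp [Fin.sum_univ_four, structureConst]
    field_simp
    linear_combination (-(bigDelta M a p * a * cosTheta p * fderiv ℝ ψ p (frame M a 1 p))
      - 2 * rad p * a ^ 2 * cosTheta p * sinTheta p * fderiv ℝ ψ p (frame M a 3 p)
      + 2 * a ^ 3 * cosTheta p ^ 2 * I * sinTheta p * fderiv ℝ ψ p (frame M a 3 p)) * I_sq
  rw [fderiv_mDeriv ha hp hψ, hsum]
  ring

end Operators

end

/-! ### Commutation of m + 2τ with the transport operators -/

section

open Complex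

variable {p : Pt} {M a : ℝ}

/-- The complex component of `η`. -/
noncomputable def etaC (a : ℝ) (p : Pt) : ℂ := iaSin a p / (zeta a p * zetaBar a p)

/-- The complex component of `η̲`. -/
noncomputable def etaBarC (a : ℝ) (p : Pt) : ℂ := -iaSin a p / zeta a p ^ 2

/-- The operator `m + 2τ` on complex functions. -/
noncomputable def mShift (M a : ℝ) (τ ψ : Pt → ℂ) (p : Pt) : ℂ :=
  mDeriv M a ψ p + 2 * τ p * ψ p

section Identities

variable (hp : 0 < p 1 ^ 2 + p 2 ^ 2)

include hp

theorem hasSphDeriv_etaC (a : ℝ) : HasSphDeriv (etaC a)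
    (-(iaSin a p * (zeta a p + zetaBar a p)) / (zeta a p * zetaBar a p) ^ 2)
    ((zeta a p - zetaBar a p) * (zeta a p * zetaBar a p - 2 * iaSin a p ^ 2)
      / (2 * (zeta a p * zetaBar a p) ^ 2)) p := by
  have hr := rad_pos_of_offAxis hp
  have hz := zeta_ne_zero a hr
  have hz' := zetaBar_ne_zero a hr
  exact ((hasSphDeriv_iaSin hp a).div ((hasSphDeriv_zeta hp a).mul (hasSphDeriv_zetaBar hp a))
    (mul_ne_zero hz hz')).congr (by field_simp; ring) (by field_simp; ring)

theorem hasSphDeriv_etaBarC (a : ℝ) : HasSphDeriv (etaBarC a)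
    (2 * iaSin a p / zeta a p ^ 3)
    (-((zeta a p - zetaBar a p) * zeta a p + 4 * iaSin a p ^ 2) / (2 * zeta a p ^ 3)) p := by
  have hr := rad_pos_of_offAxis hp
  have hz := zeta_ne_zero a hr
  exact ((hasSphDeriv_iaSin hp a).neg.div (hasSphDeriv_zeta hp a).sq
    (pow_ne_zero 2 hz)).congr (by field_simp; ring) (by field_simp; ring)

variable {ψ : Pt → ℂ} (hψ : ContDiffAt ℝ ∞ ψ p)

include hψ

theorem fderiv_mShift {τ : Pt → ℂ} (hτ : DifferentiableAt ℝ τ p) (v : Fin 4 → ℝ) :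
    fderiv ℝ (mShift M a τ ψ) p v = fderiv ℝ (mDeriv M a ψ) p v
      + 2 * (fderiv ℝ τ p v * ψ p + τ p * fderiv ℝ ψ p v) := by
  have hd := hψ.differentiableAt (by simp)
  have h2 : DifferentiableAt ℝ (fun q => 2 * τ q) p := hτ.const_mul 2
  rw [show mShift M a τ ψ = fun q => mDeriv M a ψ q + 2 * τ q * ψ q from rfl,
    fderiv_add_apply (differentiableAt_mDeriv hp hψ) (h2.fun_mul hd), fderiv_mul_apply h2 hd,
    fderiv_const_mul hτ]
  simp
  ring

theorem differentiableAt_mShift {τ : Pt → ℂ} (hτ : DifferentiableAt ℝ τ p) :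
    DifferentiableAt ℝ (mShift M a τ ψ) p :=
  (differentiableAt_mDeriv hp hψ).fun_add
    ((hτ.const_mul 2).fun_mul (hψ.differentiableAt (by simp)))

/-- Leibniz rule for m on s(e_b + y)ψ. The weight s is Σ in the two e₄ identities and 1 in the two
e₃ identities. -/
theorem mDeriv_transport {s y : Pt → ℂ} (hs : DifferentiableAt ℝ s p)
    (hy : DifferentiableAt ℝ y p) (b : Fin 4) :
    mDeriv M a (fun q => s q * (fderiv ℝ ψ q (frame M a b q) + y q * ψ q)) p
      = mDeriv M a s p * (fderiv ℝ ψ p (frame M a b p) + y p * ψ p)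
        + s p * (mDeriv M a (fun q => fderiv ℝ ψ q (frame M a b q)) p
          + (mDeriv M a y p * ψ p + y p * mDeriv M a ψ p)) := by
  have hd := hψ.differentiableAt (by simp)
  have hb := differentiableAt_fderiv_frame (M := M) (a := a) hp hψ b
  rw [mDeriv_mul hs (hb.fun_add (hy.fun_mul hd)), mDeriv_add hb (hy.fun_mul hd), mDeriv_mul hy hd]

variable (ha : |a| ≤ M)

include ha

/-- The e₄ part of [e₄, m] equals (mΣ/Σ)e₄, produced on the right by m acting on the factor Σ. For
the terms in mψ, the coefficient -Δζ̄/Σ² of [e₄, m] lowers Δ(2ζ + ζ̄)/Σ² to 2Δζ/Σ² = 2Δ/(ζζ̄²). -/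
theorem e4_mShift_etaC :
    (zeta a p * zetaBar a p) * (fderiv ℝ (mShift M a (etaC a) ψ) p (frame M a 3 p)
      + bigDelta M a p * (2 * zeta a p + zetaBar a p) / (zeta a p * zetaBar a p) ^ 2
        * mShift M a (etaC a) ψ p)
      = mShift M a (etaC a) (fun q => (zeta a q * zetaBar a q)
        * (fderiv ℝ ψ q (frame M a 3 q)
          + 2 * bigDelta M a q / (zeta a q * zetaBar a q ^ 2) * ψ q)) p := by
  have hr := rad_pos_of_offAxis hp
  have hz := zeta_ne_zero a hr
  have hz' := zetaBar_ne_zero a hr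
  have hZ := hasSphDeriv_zeta hp a
  have hZ' := hasSphDeriv_zetaBar hp a
  have hs := hZ.mul hZ'
  have hy := ((hasSphDeriv_bigDelta_complex hp M a).const_mul 2).div (hZ.mul hZ'.sq)
    (mul_ne_zero hz (pow_ne_zero 2 hz'))
  have hη := hasSphDeriv_etaC hp a
  rw [fderiv_mShift hp hψ hη.1, mShift, mShift, mDeriv_transport hp hψ hs.1 hy.1,
    fderiv_e4_mDeriv ha hp hψ, hs.mDeriv_eq hp, hy.mDeriv_eq hp, hη.fderiv_frame_three, etaC]
  field_simp
  ring

/-- In the terms with mψ the commutator [e₃, m] = ζ⁻¹m changes -3/ζ to -2/ζ. The terms in ψ match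
because e₃η̲ = 2η̲/ζ and m(-2/ζ) = 2η̲/ζ. -/
theorem e3_mShift_etaBarC :
    fderiv ℝ (mShift M a (etaBarC a) ψ) p (frame M a 2 p)
      + -3 / zeta a p * mShift M a (etaBarC a) ψ p
      = mShift M a (etaBarC a) (fun q => fderiv ℝ ψ q (frame M a 2 q)
          + -2 / zeta a q * ψ q) p := by
  have hr := rad_pos_of_offAxis hp
  have hz := zeta_ne_zero a hr
  have hy := (HasSphDeriv.const (-2 : ℂ)).div (hasSphDeriv_zeta hp a) hz
  have hη := hasSphDeriv_etaBarC hp a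
  have h1 := mDeriv_transport (M := M) (a := a) hp hψ (differentiableAt_const (1 : ℂ)) hy.1 2
  simp only [one_mul] at h1
  rw [fderiv_mShift hp hψ hη.1, mShift, mShift, h1,
    fderiv_e3_mDeriv ha hp hψ, (HasSphDeriv.const (1 : ℂ)).mDeriv_eq hp, hy.mDeriv_eq hp,
    hη.fderiv_frame_two, etaBarC]
  field_simp
  ring

/-- Differentiating the weight gives e₃Σ/Σ = -1/ζ - 1/ζ̄. The commutator cancels -1/ζ, and the
explicit -1/ζ̄ completes the coefficient -2/ζ̄. -/
theorem e3_mShift_etaC :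
    fderiv ℝ (fun q => (zeta a q * zetaBar a q) * mShift M a (etaC a) ψ q) p (frame M a 2 p)
      + -1 / zetaBar a p * ((zeta a p * zetaBar a p) * mShift M a (etaC a) ψ p)
      = (zeta a p * zetaBar a p) * mShift M a (etaC a) (fun q => fderiv ℝ ψ q (frame M a 2 q)
          + -2 / zetaBar a q * ψ q) p := by
  have hr := rad_pos_of_offAxis hp
  have hz := zeta_ne_zero a hr
  have hz' := zetaBar_ne_zero a hr
  have hs := (hasSphDeriv_zeta hp a).mul (hasSphDeriv_zetaBar hp a)
  have hy := (HasSphDeriv.const (-2 : ℂ)).div (hasSphDeriv_zetaBar hp a) hz'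
  have hη := hasSphDeriv_etaC hp a
  have h1 := mDeriv_transport (M := M) (a := a) hp hψ (differentiableAt_const (1 : ℂ)) hy.1 2
  simp only [one_mul] at h1
  rw [fderiv_mul_apply hs.1 (differentiableAt_mShift hp hψ hη.1), fderiv_mShift hp hψ hη.1,
    mShift, mShift, h1,
    fderiv_e3_mDeriv ha hp hψ, (HasSphDeriv.const (1 : ℂ)).mDeriv_eq hp, hy.mDeriv_eq hp,
    hη.fderiv_frame_two, hs.fderiv_frame_two, etaC]
  field_simp
  ring

/-- The coefficient of mψ, relative to Σ, collects Δ(ζ + ζ̄)/Σ² from e₄Σ, -Δζ̄/Σ² from the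
commutator and the explicit Δ(2ζ̄ - ζ)/Σ², in total 2Δζ̄/Σ² = 2Δ/(ζ²ζ̄). -/
theorem e4_mShift_etaBarC :
    fderiv ℝ (fun q => (zeta a q * zetaBar a q) * mShift M a (etaBarC a) ψ q) p (frame M a 3 p)
      + bigDelta M a p * (2 * zetaBar a p - zeta a p) / (zeta a p * zetaBar a p) ^ 2
        * ((zeta a p * zetaBar a p) * mShift M a (etaBarC a) ψ p)
      = mShift M a (etaBarC a) (fun q => (zeta a q * zetaBar a q)
        * (fderiv ℝ ψ q (frame M a 3 q)
          + 2 * bigDelta M a q / (zeta a q ^ 2 * zetaBar a q) * ψ q)) p := by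
  have hr := rad_pos_of_offAxis hp
  have hz := zeta_ne_zero a hr
  have hz' := zetaBar_ne_zero a hr
  have hZ := hasSphDeriv_zeta hp a
  have hZ' := hasSphDeriv_zetaBar hp a
  have hs := hZ.mul hZ'
  have hy := ((hasSphDeriv_bigDelta_complex hp M a).const_mul 2).div (hZ.sq.mul hZ')
    (mul_ne_zero (pow_ne_zero 2 hz) hz')
  have hη := hasSphDeriv_etaBarC hp a
  rw [fderiv_mul_apply hs.1 (differentiableAt_mShift hp hψ hη.1), fderiv_mShift hp hψ hη.1,
    mShift, mShift, mDeriv_transport hp hψ hs.1 hy.1,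
    fderiv_e4_mDeriv ha hp hψ, hs.mDeriv_eq hp, hy.mDeriv_eq hp, hη.fderiv_frame_three,
    hs.fderiv_frame_three, etaBarC]
  field_simp
  ring

end Identities

end

/-! ### Complex form of the coefficients and of the operators -/

section

open Complex

variable {p : Pt} {M a : ℝ}

/-- The complex component `u(e₁) + i u(e₂)` of a covector at `p`. -/
noncomputable def cxAt (M a : ℝ) (p : Pt) (u : Fin 4 → ℝ) : ℂ :=
  ((u ⬝ᵥ frame M a 0 p : ℝ) : ℂ) + ((u ⬝ᵥ frame M a 1 p : ℝ) : ℂ) * I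

theorem cx_eq_cxAt (M a : ℝ) (ς : OneForm) (p : Pt) : cx M a ς p = cxAt M a p (ς p) := rfl

theorem cxAt_add (u v : Fin 4 → ℝ) : cxAt M a p (u + v) = cxAt M a p u + cxAt M a p v := by
  simp only [cxAt, add_dotProduct]; push_cast; ring

theorem cxAt_sub (u v : Fin 4 → ℝ) : cxAt M a p (u - v) = cxAt M a p u - cxAt M a p v := by
  simp only [cxAt, sub_dotProduct]; push_cast; ring

theorem cxAt_neg (u : Fin 4 → ℝ) : cxAt M a p (-u) = -cxAt M a p u := by
  simp only [cxAt, neg_dotProduct]; push_cast; ring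

theorem cxAt_smul (c : ℝ) (u : Fin 4 → ℝ) : cxAt M a p (c • u) = c * cxAt M a p u := by
  simp only [cxAt, smul_dotProduct, smul_eq_mul]; push_cast; ring

section Operators

variable (ha : |a| ≤ M) (hp : p ∈ region M a)

include ha hp

theorem eq_zero_of_cxAt_eq_zero {u : Fin 4 → ℝ} (h3 : u ⬝ᵥ e3 p = 0) (h4 : u ⬝ᵥ e4 M a p = 0)
    (h : cxAt M a p u = 0) : u = 0 := by
  have h0 : u ⬝ᵥ frame M a 0 p = 0 := by simpa [cxAt] using congrArg re h
  have h1 : u ⬝ᵥ frame M a 1 p = 0 := by simpa [cxAt] using congrArg im h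
  refine oneForm_ext ha hp.2 fun b => ?_
  rw [zero_dotProduct]
  fin_cases b
  · exact h0
  · exact h1
  · simpa [frame_two] using h3
  · simpa [frame_three] using h4

theorem trChi_complex : (trChi M a p : ℂ)
    = bigDelta M a p * (zeta a p + zetaBar a p) / (zeta a p * zetaBar a p) ^ 2 := by
  rw [trChi_eq ha hp, zeta_mul_zetaBar]
  push_cast
  rw [rad_eq_zeta a]
  ring

theorem epsChi_complex : (epsChi M a p : ℂ) * I
    = bigDelta M a p * (zeta a p - zetaBar a p) / (zeta a p * zetaBar a p) ^ 2 := by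
  rw [epsChi_eq ha hp, zeta_mul_zetaBar]
  push_cast
  linear_combination (2 * bigDelta M a p / bigSigma a p ^ 2 : ℂ) * cosTheta_eq_zeta a p

theorem trChiBar_complex : (trChiBar M a p : ℂ)
    = -(zeta a p + zetaBar a p) / (zeta a p * zetaBar a p) := by
  rw [trChiBar_eq ha hp, zeta_mul_zetaBar]
  push_cast
  rw [rad_eq_zeta a]
  ring

theorem epsChiBar_complex : (epsChiBar M a p : ℂ) * I
    = (zeta a p - zetaBar a p) / (zeta a p * zetaBar a p) := by
  rw [epsChiBar_eq ha hp, zeta_mul_zetaBar]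
  push_cast
  linear_combination (2 / bigSigma a p : ℂ) * cosTheta_eq_zeta a p

theorem eta_frame_zero : eta M a p ⬝ᵥ frame M a 0 p = 0 := by
  rw [eta_frame ha hp, connCoeff_eq hp ha]
  simp [Fin.sum_univ_four, structureConst, eta4]
  ring

theorem eta_frame_one : eta M a p ⬝ᵥ frame M a 1 p = a * sinTheta p / bigSigma a p := by
  have hS := bigSigma_pos a (rad_pos_of_offAxis hp.2)
  rw [eta_frame ha hp, connCoeff_eq hp ha]
  simp [Fin.sum_univ_four, structureConst, eta4]
  field_simp
  rw [bigSigma]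
  ring

theorem etaBar_frame_zero : etaBar M a p ⬝ᵥ frame M a 0 p
    = -(2 * a ^ 2 * rad p * sinTheta p * cosTheta p) / bigSigma a p ^ 2 := by
  rw [etaBar_frame ha hp, connCoeff_eq hp ha]
  simp [Fin.sum_univ_four, structureConst, eta4]
  ring

theorem etaBar_frame_one : etaBar M a p ⬝ᵥ frame M a 1 p
    = -(a * sinTheta p * (rad p ^ 2 - a ^ 2 * cosTheta p ^ 2)) / bigSigma a p ^ 2 := by
  rw [etaBar_frame ha hp, connCoeff_eq hp ha]
  simp [Fin.sum_univ_four, structureConst, eta4]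
  ring

theorem cx_eta : cx M a (eta M a) p = etaC a p := by
  rw [cx, eta_frame_zero ha hp, eta_frame_one ha hp, etaC, iaSin, zeta_mul_zetaBar]
  push_cast
  ring

theorem cx_etaBar : cx M a (etaBar M a) p = etaBarC a p := by
  have hr := rad_pos_of_offAxis hp.2
  have hz := zeta_ne_zero a hr
  have hz' := zetaBar_ne_zero a hr
  have h : etaBarC a p = -iaSin a p * zetaBar a p ^ 2 / (bigSigma a p : ℂ) ^ 2 := by
    rw [etaBarC, ← zeta_mul_zetaBar]; field_simp
  rw [cx, etaBar_frame_zero ha hp, etaBar_frame_one ha hp, h, iaSin, zetaBar]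
  push_cast
  linear_combination ((a * sinTheta p * (a ^ 2 * cosTheta p ^ 2 * I - 2 * a * rad p * cosTheta p))
    / bigSigma a p ^ 2 : ℂ) * I_sq

theorem horizontalAt_op3 (c d : ℝ) {ς : OneForm} (hh : HorizontalAt M a ς p) :
    HorizontalAt M a (op3 M a c d ς) p := by
  have h1 : HorizontalAt M a (nab M a e3 ς) p := horizontalAt_horiz ha hp _
  have h2 := horizontalAt_hStar ha hp ς
  constructor
  · rw [op3, add_dotProduct, add_dotProduct, smul_dotProduct, smul_dotProduct, h1.1, hh.1, h2.1]
    simp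
  · rw [op3, add_dotProduct, add_dotProduct, smul_dotProduct, smul_dotProduct, h1.2, hh.2, h2.2]
    simp

theorem horizontalAt_op4 (c d : ℝ) {ς : OneForm} (hh : HorizontalAt M a ς p) :
    HorizontalAt M a (op4 M a c d ς) p := by
  have h1 : HorizontalAt M a (nab M a (e4 M a) ς) p := horizontalAt_horiz ha hp _
  have h2 := horizontalAt_hStar ha hp ς
  constructor
  · rw [op4, add_dotProduct, add_dotProduct, smul_dotProduct, smul_dotProduct, h1.1, hh.1, h2.1]
    simp
  · rw [op4, add_dotProduct, add_dotProduct, smul_dotProduct, smul_dotProduct, h1.2, hh.2, h2.2]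
    simp

theorem horizontalAt_eta : HorizontalAt M a (eta M a) p := by
  constructor
  · rw [← frame_two M a, eta_frame ha hp]; simp
  · rw [← frame_three, eta_frame ha hp]; simp

theorem horizontalAt_etaBar : HorizontalAt M a (etaBar M a) p := by
  constructor
  · rw [← frame_two M a, etaBar_frame ha hp]; simp
  · rw [← frame_three, etaBar_frame ha hp]; simp

theorem horizontalAt_gradShift {τ : OneForm} (hτ : HorizontalAt M a τ p) (f : Pt → ℝ) :
    HorizontalAt M a (gradShift M a τ f) p := by
  have h1 : HorizontalAt M a (grad M a f) p := horizontalAt_horiz ha hp _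
  constructor
  · rw [gradShift, add_dotProduct, smul_dotProduct, h1.1, hτ.1]; simp
  · rw [gradShift, add_dotProduct, smul_dotProduct, h1.2, hτ.2]; simp

omit ha hp in
theorem horizontalAt_scal (f : Pt → ℝ) {ς : OneForm} (hh : HorizontalAt M a ς p) :
    HorizontalAt M a (scal f ς) p := by
  constructor
  · rw [scal, smul_dotProduct, hh.1, smul_zero]
  · rw [scal, smul_dotProduct, hh.2, smul_zero]

/-- The frame (e₁, e₂) rotates along e₃ at the rate ε·χ̲, which accounts for the first summand (ζ -
ζ̄)/Σ = i ε·χ̲; the other two are tr χ̲ and the action of ⋆ as -i. -/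
theorem cx_op3 (c d : ℝ) {ς : OneForm} (hς : DifferentiableAt ℝ ς p) (hh : HorizontalAt M a ς p) :
    cx M a (op3 M a c d ς) p = fderiv ℝ (cx M a ς) p (frame M a 2 p)
      + ((zeta a p - zetaBar a p) - c * (zeta a p + zetaBar a p) - d * (zeta a p - zetaBar a p))
        / (zeta a p * zetaBar a p) * cx M a ς p := by
  have h1 := cx_nab ha hp hς hh 2
  have h2 := cx_hStar ha hp ς
  have hG : I * connCoeff M a p 2 0 1 = (zeta a p - zetaBar a p) / (zeta a p * zetaBar a p) := by
    rw [← epsChiBar_complex ha hp, epsChiBar_eq ha hp, connCoeff_eq hp ha]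
    simp [Fin.sum_univ_four, structureConst, eta4]
    ring
  rw [frame_two, cx_eq_cxAt] at h1
  rw [cx_eq_cxAt] at h2
  rw [cx_eq_cxAt, op3, cxAt_add, cxAt_add, cxAt_smul, cxAt_smul, h1, h2, hG, ← cx_eq_cxAt]
  push_cast
  rw [trChiBar_complex ha hp, frame_two]
  linear_combination (-d * cx M a ς p) * epsChiBar_complex ha hp

/-- Unlike along e₃, the frame (e₁, e₂) does not rotate along e₄ (`hG`), so no connection term
appears. -/
theorem cx_op4 (c d : ℝ) {ς : OneForm} (hς : DifferentiableAt ℝ ς p) (hh : HorizontalAt M a ς p) :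
    cx M a (op4 M a c d ς) p = fderiv ℝ (cx M a ς) p (frame M a 3 p)
      + bigDelta M a p * (c * (zeta a p + zetaBar a p) - d * (zeta a p - zetaBar a p))
        / (zeta a p * zetaBar a p) ^ 2 * cx M a ς p := by
  have h1 := cx_nab ha hp hς hh 3
  have h2 := cx_hStar ha hp ς
  have hG : connCoeff M a p 3 0 1 = 0 := by
    rw [connCoeff_eq hp ha]
    simp [Fin.sum_univ_four, structureConst, eta4]
    ring
  rw [frame_three, cx_eq_cxAt, hG] at h1
  rw [cx_eq_cxAt] at h2
  rw [cx_eq_cxAt, op4, cxAt_add, cxAt_add, cxAt_smul, cxAt_smul, h1, h2, ← cx_eq_cxAt]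
  push_cast
  rw [trChi_complex ha hp, frame_three]
  linear_combination (-d * cx M a ς p) * epsChi_complex ha hp

/-- With no shear, χ̲ acts on horizontal one-forms as ½ tr χ̲ + ½(ε·χ̲)⋆, hence as a complex scalar;
a shear would bring in the conjugate of `cx`. -/
theorem cx_sharpDot_chiBar (ς : OneForm) : cx M a (sharpDot M a (chiBar M a) ς) p
    = -(1 / zetaBar a p) * cx M a ς p := by
  have hr := rad_pos_of_offAxis hp.2
  have hz := zeta_ne_zero a hr
  have hz' := zetaBar_ne_zero a hr
  have h : -(1 / zetaBar a p) = (trChiBar M a p - epsChiBar M a p * I : ℂ) / 2 := by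
    rw [trChiBar_complex ha hp, epsChiBar_complex ha hp]; field_simp; ring
  rw [h, cx, sharpDot_dotProduct ha hp.2, sharpDot_dotProduct ha hp.2, cx]
  simp only [chiBar_frame ha hp _ _ (Or.inl rfl) (Or.inl rfl),
    chiBar_frame ha hp _ _ (Or.inl rfl) (Or.inr rfl),
    chiBar_frame ha hp _ _ (Or.inr rfl) (Or.inl rfl),
    chiBar_frame ha hp _ _ (Or.inr rfl) (Or.inr rfl)]
  simp [area4]
  linear_combination (epsChiBar M a p / 2 * (ς p ⬝ᵥ frame M a 1 p : ℝ) : ℂ) * I_sq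

theorem cx_sharpDot_chi (ς : OneForm) : cx M a (sharpDot M a (chi M a) ς) p
    = bigDelta M a p / (zeta a p ^ 2 * zetaBar a p) * cx M a ς p := by
  have hr := rad_pos_of_offAxis hp.2
  have hz := zeta_ne_zero a hr
  have hz' := zetaBar_ne_zero a hr
  have h : (bigDelta M a p : ℂ) / (zeta a p ^ 2 * zetaBar a p)
      = (trChi M a p - epsChi M a p * I : ℂ) / 2 := by
    rw [trChi_complex ha hp, epsChi_complex ha hp]; field_simp; ring
  rw [h, cx, sharpDot_dotProduct ha hp.2, sharpDot_dotProduct ha hp.2, cx]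
  simp only [chi_frame ha hp _ _ (Or.inl rfl) (Or.inl rfl),
    chi_frame ha hp _ _ (Or.inl rfl) (Or.inr rfl),
    chi_frame ha hp _ _ (Or.inr rfl) (Or.inl rfl),
    chi_frame ha hp _ _ (Or.inr rfl) (Or.inr rfl)]
  simp [area4]
  linear_combination (epsChi M a p / 2 * (ς p ⬝ᵥ frame M a 1 p : ℝ) : ℂ) * I_sq

theorem cx_gradShift {f : Pt → ℝ} (hf : DifferentiableAt ℝ f p) (τ : OneForm) :
    cx M a (gradShift M a τ f) p
      = mDeriv M a (fun q => (f q : ℂ)) p + 2 * f p * cx M a τ p := by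
  rw [← cx_grad ha hp hf, cx_eq_cxAt, gradShift, cxAt_add, cxAt_smul]
  push_cast
  rfl

/-- The combination `(∇̸ + 2τ) f₁ + ε i (∇̸ + 2τ) f₂` only depends on `f₁ + ε i f₂`. -/
theorem cx_gradShift_add {f₁ f₂ : Pt → ℝ} (h1 : DifferentiableAt ℝ f₁ p)
    (h2 : DifferentiableAt ℝ f₂ p) {τ : OneForm} {τC g : Pt → ℂ} (hτ : cx M a τ p = τC p) (ε : ℂ)
    (h : (fun q => (f₁ q : ℂ) + ε * f₂ q) =ᶠ[nhds p] g) :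
    cx M a (gradShift M a τ f₁) p + ε * cx M a (gradShift M a τ f₂) p = mShift M a τC g p := by
  have d1 := (hasFDerivAt_ofReal h1).differentiableAt
  have d2 := (hasFDerivAt_ofReal h2).differentiableAt
  have hg : mDeriv M a g p = mDeriv M a (fun q => (f₁ q : ℂ)) p
      + ε * mDeriv M a (fun q => (f₂ q : ℂ)) p := by
    rw [mDeriv, ← h.fderiv_eq, ← mDeriv, mDeriv_add d1 (d2.const_mul ε)]
    simp only [mDeriv, fderiv_const_mul d2, smul_apply, smul_eq_mul]
    ring
  rw [cx_gradShift ha hp h1, cx_gradShift ha hp h2, mShift, hg, hτ, ← h.eq_of_nhds]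
  ring

omit ha hp in
theorem cx_scal (f : Pt → ℝ) (ς : OneForm) : cx M a (scal f ς) p = f p * cx M a ς p := by
  rw [cx_eq_cxAt, scal, cxAt_smul, ← cx_eq_cxAt]

end Operators

end

/-! ### Maxwell's equations in complex form and the four identities on `region` -/

section

open Complex

variable {p : Pt} {M a : ℝ} {U : Set Pt}

theorem IsRelOpen.isOpen_inter_region (hU : IsRelOpen M a U) : IsOpen (U ∩ region M a) := by
  obtain ⟨V, hV, rfl⟩ := hU
  have : V ∩ exterior M a ∩ region M a = V ∩ region M a := by
    rw [Set.inter_assoc, Set.inter_eq_right.2 (region_subset M a)]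
  rw [this]
  exact hV.inter (isOpen_region M a)

theorem IsRelOpen.contDiffAt {E : Type*} [NormedAddCommGroup E] [NormedSpace ℝ E]
    (hU : IsRelOpen M a U) (hp : p ∈ U ∩ region M a) {f : Pt → E} (hf : ContDiffOn ℝ ∞ f U) :
    ContDiffAt ℝ ∞ f p :=
  (hf.mono Set.inter_subset_left).contDiffAt (hU.isOpen_inter_region.mem_nhds hp)

theorem IsRelOpen.differentiableAt {E : Type*} [NormedAddCommGroup E] [NormedSpace ℝ E]
    (hU : IsRelOpen M a U) (hp : p ∈ U ∩ region M a) {f : Pt → E} (hf : ContDiffOn ℝ ∞ f U) :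
    DifferentiableAt ℝ f p :=
  (hU.contDiffAt hp hf).differentiableAt (by simp)

/-- `ρ + ε i σ`. -/
noncomputable def scalarPart (ρ σ : Pt → ℝ) (ε : ℂ) (p : Pt) : ℂ := ρ p + ε * σ p * I

theorem contDiffOn_scalarPart {ρ σ : Pt → ℝ} (hρ : ContDiffOn ℝ ∞ ρ U) (hσ : ContDiffOn ℝ ∞ σ U)
    (ε : ℂ) : ContDiffOn ℝ ∞ (scalarPart ρ σ ε) U :=
  (ofRealCLM.contDiff.comp_contDiffOn hρ).add
    ((contDiffOn_const.mul (ofRealCLM.contDiff.comp_contDiffOn hσ)).mul contDiffOn_const)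

theorem fderiv_scalarPart {ρ σ : Pt → ℝ} (hρ : DifferentiableAt ℝ ρ p)
    (hσ : DifferentiableAt ℝ σ p) (ε : ℂ) (v : Fin 4 → ℝ) :
    fderiv ℝ (scalarPart ρ σ ε) p v = fderiv ℝ ρ p v + ε * fderiv ℝ σ p v * I := by
  have h1 := (hasFDerivAt_ofReal hρ).differentiableAt
  have h2 := (hasFDerivAt_ofReal hσ).differentiableAt
  have h : scalarPart ρ σ ε = fun q => (ρ q : ℂ) + (ε * I) * σ q := by
    funext q; rw [scalarPart]; ring
  rw [h, fderiv_add_apply h1 (h2.const_mul _), fderiv_const_mul h2]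
  simp [fderiv_ofReal_apply hρ, fderiv_ofReal_apply hσ]
  ring

theorem mDeriv_scalarPart {ρ σ : Pt → ℝ} (hρ : DifferentiableAt ℝ ρ p)
    (hσ : DifferentiableAt ℝ σ p) (ε : ℂ) :
    mDeriv M a (scalarPart ρ σ ε) p = mDeriv M a (fun q => (ρ q : ℂ)) p
      + ε * mDeriv M a (fun q => (σ q : ℂ)) p * I := by
  simp only [mDeriv, fderiv_scalarPart hρ hσ, fderiv_ofReal_apply hρ, fderiv_ofReal_apply hσ]
  ring

theorem mShift_neg (τ ψ : Pt → ℂ) (p : Pt) :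
    mShift M a τ (fun q => -ψ q) p = -mShift M a τ ψ p := by
  simp only [mShift, mDeriv, fderiv_fun_neg, neg_apply]
  ring

namespace IsMaxwellSolution

variable {α αb : OneForm} {ρ σ : Pt → ℝ} (hsol : IsMaxwellSolution M a U α αb ρ σ)
  (ha : |a| ≤ M) (hU : IsRelOpen M a U) (hp : p ∈ U ∩ region M a)

include hsol hU hp

theorem contDiffAt_scalarPart (ε : ℂ) : ContDiffAt ℝ ∞ (scalarPart ρ σ ε) p :=
  hU.contDiffAt hp (contDiffOn_scalarPart hsol.smooth_rho hsol.smooth_sigma ε)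

include ha

/-- The equation for `∇̸₃ α`. -/
theorem cx_op3_alpha :
    cx M a (op3 M a (1 / 2) (1 / 2) α) p = mShift M a (etaC a) (scalarPart ρ σ (-1)) p := by
  have hα := hU.differentiableAt hp hsol.smooth_alpha
  have hρ := hU.differentiableAt hp hsol.smooth_rho
  have hσ := hU.differentiableAt hp hsol.smooth_sigma
  have hh : HorizontalAt M a α p := hsol.horizontal_alpha p hp.1
  have hz := zeta_ne_zero a (rad_pos_of_offAxis hp.2.2)
  have hz' := zetaBar_ne_zero a (rad_pos_of_offAxis hp.2.2)
  have h := congrArg (cxAt M a p) (hsol.e3_alpha p hp.1)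
  simp only [cxAt_add, cxAt_smul, ← cx_eq_cxAt] at h
  rw [cx_sharpDot_chiBar ha hp.2, cx_grad ha hp.2 hρ, cx_hStar ha hp.2, cx_hStar ha hp.2,
    cx_grad ha hp.2 hσ, cx_eta ha hp.2] at h
  have h2 := cx_nab ha hp.2 hα hh 2
  have h3 := cx_op3 ha hp.2 (1 / 2) (1 / 2) hα hh
  have h4 := cx_op3 ha hp.2 0 0 hα hh
  have h5 : cx M a (op3 M a 0 0 α) p = cx M a (nab M a e3 α) p := by
    rw [cx_eq_cxAt, cx_eq_cxAt, op3]; simp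
  rw [h5] at h4
  rw [mShift, mDeriv_scalarPart hρ hσ, scalarPart, h3]
  push_cast at h h4 ⊢
  -- The two coefficients ½ are exactly the shear-free action of χ̲, so the operator is ∇̸₃ +
  -- χ̲^{♯₂}, the left side of the Maxwell equation.
  have e : ((zeta a p - zetaBar a p) - (1 / 2) * (zeta a p + zetaBar a p)
      - (1 / 2) * (zeta a p - zetaBar a p)) / (zeta a p * zetaBar a p) * cx M a α p
      = (zeta a p - zetaBar a p - 0 * (zeta a p + zetaBar a p) - 0 * (zeta a p - zetaBar a p))
        / (zeta a p * zetaBar a p) * cx M a α p + -(1 / zetaBar a p) * cx M a α p := by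
    field_simp; ring
  rw [e]
  linear_combination h - h4

/-- The equation for `∇̸₄ α̲`. -/
theorem cx_op4_alphaBar :
    cx M a (op4 M a (1 / 2) (1 / 2) αb + scal (omegaHat M a) αb) p
      = -mShift M a (etaBarC a) (scalarPart ρ σ 1) p := by
  have hα := hU.differentiableAt hp hsol.smooth_alphaBar
  have hρ := hU.differentiableAt hp hsol.smooth_rho
  have hσ := hU.differentiableAt hp hsol.smooth_sigma
  have hh : HorizontalAt M a αb p := hsol.horizontal_alphaBar p hp.1
  have hz := zeta_ne_zero a (rad_pos_of_offAxis hp.2.2)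
  have hz' := zetaBar_ne_zero a (rad_pos_of_offAxis hp.2.2)
  have h := congrArg (cxAt M a p) (hsol.e4_alphaBar p hp.1)
  simp only [cxAt_add, cxAt_sub, cxAt_neg, cxAt_smul, ← cx_eq_cxAt] at h
  rw [cx_sharpDot_chi ha hp.2, cx_grad ha hp.2 hρ, cx_hStar ha hp.2, cx_hStar ha hp.2,
    cx_grad ha hp.2 hσ, cx_etaBar ha hp.2] at h
  have h3 := cx_op4 ha hp.2 (1 / 2) (1 / 2) hα hh
  have h4 := cx_op4 ha hp.2 0 0 hα hh
  have h5 : cx M a (op4 M a 0 0 αb) p = cx M a (nab M a (e4 M a) αb) p := by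
    rw [cx_eq_cxAt, cx_eq_cxAt, op4]; simp
  rw [h5] at h4
  -- The value of ω̂ is not needed: the same term ω̂α̲ occurs in the Maxwell equation.
  rw [cx_eq_cxAt, Pi.add_apply, cxAt_add, ← cx_eq_cxAt, ← cx_eq_cxAt, cx_scal, mShift,
    mDeriv_scalarPart hρ hσ, scalarPart, h3]
  push_cast at h h4 ⊢
  have e : bigDelta M a p * ((1 / 2) * (zeta a p + zetaBar a p)
      - (1 / 2) * (zeta a p - zetaBar a p)) / (zeta a p * zetaBar a p) ^ 2 * cx M a αb p
      = bigDelta M a p * (0 * (zeta a p + zetaBar a p) - 0 * (zeta a p - zetaBar a p))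
        / (zeta a p * zetaBar a p) ^ 2 * cx M a αb p
        + bigDelta M a p / (zeta a p ^ 2 * zetaBar a p) * cx M a αb p := by
    field_simp; ring
  rw [e]
  linear_combination h - h4

/-- The equations for `∇̸₃ ρ` and `∇̸₃ σ`. -/
theorem div_add_curl_alphaBar :
    (hDiv M a αb p : ℂ) + I * hCurl M a αb p
      = -(fderiv ℝ (scalarPart ρ σ 1) p (frame M a 2 p)
        + -2 / zeta a p * scalarPart ρ σ 1 p) ∧
    (hDiv M a αb p : ℂ) + -I * hCurl M a αb p
      = -(fderiv ℝ (scalarPart ρ σ (-1)) p (frame M a 2 p)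
        + -2 / zetaBar a p * scalarPart ρ σ (-1) p) := by
  have hρ := hU.differentiableAt hp hsol.smooth_rho
  have hσ := hU.differentiableAt hp hsol.smooth_sigma
  have hz := zeta_ne_zero a (rad_pos_of_offAxis hp.2.2)
  have hz' := zetaBar_ne_zero a (rad_pos_of_offAxis hp.2.2)
  have h1 := congrArg (fun x : ℝ => (x : ℂ)) (hsol.e3_sigma p hp.1)
  have h2 := congrArg (fun x : ℝ => (x : ℂ)) (hsol.e3_rho p hp.1)
  simp only [dirDeriv_eq_fderiv hp.2, ← frame_two M a] at h1 h2
  push_cast at h1 h2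
  have e1 : -2 / zeta a p = trChiBar M a p + epsChiBar M a p * I := by
    rw [trChiBar_complex ha hp.2, epsChiBar_complex ha hp.2]; field_simp; ring
  have e2 : -2 / zetaBar a p = trChiBar M a p - epsChiBar M a p * I := by
    rw [trChiBar_complex ha hp.2, epsChiBar_complex ha hp.2]; field_simp; ring
  rw [fderiv_scalarPart hρ hσ, fderiv_scalarPart hρ hσ, e1, e2, scalarPart, scalarPart]
  constructor
  · linear_combination h2 + I * h1 + (epsChiBar M a p * σ p : ℂ) * I_sq
  · linear_combination h2 - I * h1 + (epsChiBar M a p * σ p : ℂ) * I_sq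

/-- The equations for `∇̸₄ ρ` and `∇̸₄ σ`. -/
theorem div_add_curl_alpha :
    (hDiv M a (scal (bigSigma a) α) p : ℂ) + I * hCurl M a (scal (bigSigma a) α) p
      = (zeta a p * zetaBar a p) * (fderiv ℝ (scalarPart ρ σ (-1)) p (frame M a 3 p)
        + 2 * bigDelta M a p / (zeta a p * zetaBar a p ^ 2) * scalarPart ρ σ (-1) p) ∧
    (hDiv M a (scal (bigSigma a) α) p : ℂ) + -I * hCurl M a (scal (bigSigma a) α) p
      = (zeta a p * zetaBar a p) * (fderiv ℝ (scalarPart ρ σ 1) p (frame M a 3 p)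
        + 2 * bigDelta M a p / (zeta a p ^ 2 * zetaBar a p) * scalarPart ρ σ 1 p) := by
  have hα := hU.differentiableAt hp hsol.smooth_alpha
  have hρ := hU.differentiableAt hp hsol.smooth_rho
  have hσ := hU.differentiableAt hp hsol.smooth_sigma
  have hh : HorizontalAt M a α p := hsol.horizontal_alpha p hp.1
  have hr := rad_pos_of_offAxis hp.2.2
  have hz := zeta_ne_zero a hr
  have hz' := zetaBar_ne_zero a hr
  have hs := (hasSphDeriv_zeta hp.2.2 a).mul (hasSphDeriv_zetaBar hp.2.2 a)
  have hSd := (contDiffAt_bigSigma (n := 1) a hr).differentiableAt one_ne_zero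
  have h1 := congrArg (fun x : ℝ => (x : ℂ)) (hsol.e4_sigma p hp.1)
  have h2 := congrArg (fun x : ℝ => (x : ℂ)) (hsol.e4_rho p hp.1)
  simp only [dirDeriv_eq_fderiv hp.2, ← frame_three, hDot_eq ha hp.2.2, hWedge_eq ha hp.2.2,
    Pi.add_apply, add_dotProduct] at h1 h2
  push_cast at h1 h2
  have hA := div_add_curl ha hp.2 hα hh
  have hSA := div_add_curl ha hp.2 (ς := scal (bigSigma a) α) (hSd.smul hα)
    (horizontalAt_scal (bigSigma a) hh)
  have hcx : cx M a (scal (bigSigma a) α) = fun q => (zeta a q * zetaBar a q) * cx M a α q := by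
    funext q; rw [cx_scal, zeta_mul_zetaBar]
  rw [hcx, mBarDeriv_mul hs.1 (differentiableAt_cx hp.2 hα), hs.mBarDeriv_eq hp.2.2] at hSA
  have e1 : 2 * bigDelta M a p / (zeta a p * zetaBar a p ^ 2)
      = trChi M a p + epsChi M a p * I := by
    rw [trChi_complex ha hp.2, epsChi_complex ha hp.2]; field_simp; ring
  have e2 : 2 * bigDelta M a p / (zeta a p ^ 2 * zetaBar a p)
      = trChi M a p - epsChi M a p * I := by
    rw [trChi_complex ha hp.2, epsChi_complex ha hp.2]; field_simp; ring
  -- The horizontal gradient of log Σ is η + η̲; this is its conjugate component, times Σ.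
  -- Consequently div(Σα) and curl(Σα) absorb the terms (η + η̲, α) and (η + η̲) ∧ α of the Maxwell
  -- equations.
  have hconj : (-iaSin a p * zetaBar a p + zeta a p * iaSin a p) / zetaBar a p
      = (zeta a p * zetaBar a p) * ((eta M a p ⬝ᵥ frame M a 0 p + etaBar M a p ⬝ᵥ frame M a 0 p : ℝ)
        - (eta M a p ⬝ᵥ frame M a 1 p + etaBar M a p ⬝ᵥ frame M a 1 p : ℝ) * I) := by
    rw [eta_frame_zero ha hp.2, eta_frame_one ha hp.2, etaBar_frame_zero ha hp.2,
      etaBar_frame_one ha hp.2]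
    have hS' : (bigSigma a p : ℂ) ≠ 0 := by exact_mod_cast (bigSigma_pos a hr).ne'
    have hinv : ∀ x : ℂ, x / zetaBar a p = x * zeta a p / bigSigma a p := by
      intro x
      rw [← zeta_mul_zetaBar]
      field_simp
    have hS2 : (bigSigma a p : ℂ) = rad p ^ 2 + a ^ 2 * cosTheta p ^ 2 := by
      rw [bigSigma]; push_cast; rfl
    rw [hinv, zeta_mul_zetaBar]
    push_cast
    field_simp
    rw [hS2, iaSin, zeta, zetaBar]
    ring_nf
    simp only [I_sq, I_pow_three]
    ring
  have main : (hDiv M a (scal (bigSigma a) α) p : ℂ) + hCurl M a (scal (bigSigma a) α) p * I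
      = bigSigma a p * ((fderiv ℝ ρ p (frame M a 3 p) - fderiv ℝ σ p (frame M a 3 p) * I)
        + (trChi M a p + epsChi M a p * I) * (ρ p - σ p * I)) := by
    rw [hSA, hconj, ← zeta_mul_zetaBar]
    have hcxp : cx M a α p
      = (α p ⬝ᵥ frame M a 0 p : ℝ) + (α p ⬝ᵥ frame M a 1 p : ℝ) * I := rfl
    beta_reduce
    rw [hcxp] at hA ⊢
    push_cast
    linear_combination (zeta a p * zetaBar a p) * (-hA - h2 + I * h1 + I_sq * (
      -(eta M a p ⬝ᵥ frame M a 1 p : ℝ) * (α p ⬝ᵥ frame M a 1 p : ℝ)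
      - (etaBar M a p ⬝ᵥ frame M a 1 p : ℝ) * (α p ⬝ᵥ frame M a 1 p : ℝ)
      + epsChi M a p * σ p))
  -- Since div, curl, ρ, σ and the coefficients are real, the second identity is the conjugate of
  -- the first.
  have main' := congrArg (starRingEnd ℂ) main
  simp only [map_add, map_sub, map_mul, conj_ofReal, conj_I] at main'
  rw [fderiv_scalarPart hρ hσ, fderiv_scalarPart hρ hσ, e1, e2, scalarPart, scalarPart,
    zeta_mul_zetaBar]
  constructor
  · linear_combination main
  · linear_combination main'

omit hU hp in
theorem contDiffOn_op4_alphaBar (hU : IsRelOpen M a U) (hM : 0 < M) :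
    ContDiffOn ℝ ∞ (op4 M a (1 / 2) (1 / 2) αb + scal (omegaHat M a) αb) U := by
  have hα := contDiffOn_pi.1 hsol.smooth_alphaBar
  exact contDiffOn_pi.2 fun i => (contDiffOn_op4 hM ha hU _ _ hα i).add
    (contDiffOn_scal (contDiffOn_omegaHat hM ha hU) hα i)

omit hU in
theorem horizontalAt_op4_alphaBar :
    HorizontalAt M a (op4 M a (1 / 2) (1 / 2) αb + scal (omegaHat M a) αb) p := by
  have hh : HorizontalAt M a αb p := hsol.horizontal_alphaBar p hp.1
  have h1 := horizontalAt_op4 ha hp.2 (1 / 2) (1 / 2) hh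
  have h2 := horizontalAt_scal (omegaHat M a) hh
  constructor
  · rw [Pi.add_apply, add_dotProduct, h1.1, h2.1, add_zero]
  · rw [Pi.add_apply, add_dotProduct, h1.2, h2.2, add_zero]

variable (hM : 0 < M)

include hM

/-- As ⋆ is -i, the last two terms form -(m + 2η)(div + i curl)(Σα). With ψ = ρ - iσ, the
first-order operator on α gives (m + 2η)ψ, and (div + i curl)(Σα) is Σ times an e₄-transport of ψ,
so the claim is `e4_mShift_etaC`. -/
theorem teukolsky_alpha_of_mem_region :
    bigSigma a p • op4 M a (3 / 2) (-(1 / 2)) (op3 M a (1 / 2) (1 / 2) α) p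
      - gradShift M a (eta M a) (hDiv M a (scal (bigSigma a) α)) p
      + hStar M a (gradShift M a (eta M a) (hCurl M a (scal (bigSigma a) α))) p = 0 := by
  have hα := contDiffOn_pi.1 hsol.smooth_alpha
  have hSα := contDiffOn_scal (contDiffOn_bigSigma (a := a) hM hU) hα
  have hdiv := hU.differentiableAt hp (contDiffOn_hDiv hM ha hU hSα)
  have hcurl := hU.differentiableAt hp (contDiffOn_hCurl hM ha hU hSα)
  have hd := hU.differentiableAt hp
    (contDiffOn_pi.2 fun i => contDiffOn_op3 hM ha hU (1 / 2) (1 / 2) hα i)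
  have hh := horizontalAt_op3 ha hp.2 (1 / 2) (1 / 2)
    (show HorizontalAt M a α p from hsol.horizontal_alpha p hp.1)
  have hnhds := hU.isOpen_inter_region.mem_nhds hp
  -- The outer operator differentiates, so the equation for ∇̸₃α is needed near p and not only at p.
  have hev : cx M a (op3 M a (1 / 2) (1 / 2) α) =ᶠ[nhds p]
      mShift M a (etaC a) (scalarPart ρ σ (-1)) := by
    filter_upwards [hnhds] with q hq using hsol.cx_op3_alpha ha hU hq
  have key := cx_gradShift_add ha hp.2 hdiv hcurl (cx_eta ha hp.2) I
    (by filter_upwards [hnhds] with q hq using (hsol.div_add_curl_alpha ha hU hq).1)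
  have hcomm := e4_mShift_etaC hp.2.2 (hsol.contDiffAt_scalarPart hU hp (-1)) ha
  have h1 := cx_op4 ha hp.2 (3 / 2) (-(1 / 2)) hd hh
  rw [hev.fderiv_eq, hev.eq_of_nhds] at h1
  have hh1 := horizontalAt_op4 ha hp.2 (3 / 2) (-(1 / 2)) hh
  have hh2 := horizontalAt_gradShift ha hp.2 (horizontalAt_eta ha hp.2)
    (hDiv M a (scal (bigSigma a) α))
  have hh3 := horizontalAt_hStar ha hp.2
    (gradShift M a (eta M a) (hCurl M a (scal (bigSigma a) α)))
  refine eq_zero_of_cxAt_eq_zero ha hp.2 ?_ ?_ ?_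
  · rw [add_dotProduct, sub_dotProduct, smul_dotProduct, hh1.1, hh2.1, hh3.1]; simp
  · rw [add_dotProduct, sub_dotProduct, smul_dotProduct, hh1.2, hh2.2, hh3.2]; simp
  rw [cxAt_add, cxAt_sub, cxAt_smul, ← cx_eq_cxAt, ← cx_eq_cxAt, ← cx_eq_cxAt,
    cx_hStar ha hp.2, h1, ← zeta_mul_zetaBar]
  push_cast
  linear_combination hcomm - key

/-- The same scheme with ψ = ρ + iσ, η̲ and e₃-transport; the commutation is `e3_mShift_etaBarC`. -/
theorem teukolsky_alphaBar_of_mem_region :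
    op3 M a (3 / 2) (-(1 / 2)) (op4 M a (1 / 2) (1 / 2) αb + scal (omegaHat M a) αb) p
      - gradShift M a (etaBar M a) (hDiv M a αb) p
      + hStar M a (gradShift M a (etaBar M a) (hCurl M a αb)) p = 0 := by
  have hα := contDiffOn_pi.1 hsol.smooth_alphaBar
  have hdiv := hU.differentiableAt hp (contDiffOn_hDiv hM ha hU hα)
  have hcurl := hU.differentiableAt hp (contDiffOn_hCurl hM ha hU hα)
  have hd := hU.differentiableAt hp (hsol.contDiffOn_op4_alphaBar ha hU hM)
  have hh := hsol.horizontalAt_op4_alphaBar ha hp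
  have hz := zeta_ne_zero a (rad_pos_of_offAxis hp.2.2)
  have hz' := zetaBar_ne_zero a (rad_pos_of_offAxis hp.2.2)
  have hnhds := hU.isOpen_inter_region.mem_nhds hp
  have hev : cx M a (op4 M a (1 / 2) (1 / 2) αb + scal (omegaHat M a) αb) =ᶠ[nhds p]
      fun q => -mShift M a (etaBarC a) (scalarPart ρ σ 1) q := by
    filter_upwards [hnhds] with q hq using hsol.cx_op4_alphaBar ha hU hq
  have key := cx_gradShift_add ha hp.2 hdiv hcurl (cx_etaBar ha hp.2) I
    (by filter_upwards [hnhds] with q hq using (hsol.div_add_curl_alphaBar ha hU hq).1)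
  rw [mShift_neg] at key
  have hcomm := e3_mShift_etaBarC hp.2.2 (hsol.contDiffAt_scalarPart hU hp 1) ha
  have h1 := cx_op3 ha hp.2 (3 / 2) (-(1 / 2)) hd hh
  rw [hev.fderiv_eq, hev.eq_of_nhds, fderiv_fun_neg, neg_apply] at h1
  have hh1 := horizontalAt_op3 ha hp.2 (3 / 2) (-(1 / 2)) hh
  have hh2 := horizontalAt_gradShift ha hp.2 (horizontalAt_etaBar ha hp.2) (hDiv M a αb)
  have hh3 := horizontalAt_hStar ha hp.2 (gradShift M a (etaBar M a) (hCurl M a αb))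
  refine eq_zero_of_cxAt_eq_zero ha hp.2 ?_ ?_ ?_
  · rw [add_dotProduct, sub_dotProduct, hh1.1, hh2.1, hh3.1]; simp
  · rw [add_dotProduct, sub_dotProduct, hh1.2, hh2.2, hh3.2]; simp
  have hcoef : (zeta a p - zetaBar a p - ((3 / 2 : ℝ) : ℂ) * (zeta a p + zetaBar a p)
      - ((-(1 / 2) : ℝ) : ℂ) * (zeta a p - zetaBar a p)) / (zeta a p * zetaBar a p)
      = -3 / zeta a p := by
    push_cast; field_simp; ring
  rw [cxAt_add, cxAt_sub, ← cx_eq_cxAt, ← cx_eq_cxAt, ← cx_eq_cxAt, cx_hStar ha hp.2, h1, hcoef]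
  linear_combination -hcomm - key

/-- The sign of ⋆curl now selects (div - i curl)α̲, an e₃-transport of ρ - iσ, the function that
also governs ∇̸₃α. Through it α and α̲ are related, by `e3_mShift_etaC`. -/
theorem starobinsky_alpha_of_mem_region :
    (1 / bigSigma a p) •
        op3 M a (1 / 2) (3 / 2) (scal (bigSigma a) (op3 M a (1 / 2) (1 / 2) α)) p
      - (-gradShift M a (eta M a) (hDiv M a αb) p
        - hStar M a (gradShift M a (eta M a) (hCurl M a αb)) p) = 0 := by
  have hα := contDiffOn_pi.1 hsol.smooth_alpha
  have hαb := contDiffOn_pi.1 hsol.smooth_alphaBar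
  have hdiv := hU.differentiableAt hp (contDiffOn_hDiv hM ha hU hαb)
  have hcurl := hU.differentiableAt hp (contDiffOn_hCurl hM ha hU hαb)
  have hd := hU.differentiableAt hp (contDiffOn_pi.2 (contDiffOn_scal
    (contDiffOn_bigSigma (a := a) hM hU) (contDiffOn_op3 hM ha hU (1 / 2) (1 / 2) hα)))
  have hh := horizontalAt_scal (bigSigma a) (horizontalAt_op3 ha hp.2 (1 / 2) (1 / 2)
    (show HorizontalAt M a α p from hsol.horizontal_alpha p hp.1))
  have hz := zeta_ne_zero a (rad_pos_of_offAxis hp.2.2)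
  have hz' := zetaBar_ne_zero a (rad_pos_of_offAxis hp.2.2)
  have hnhds := hU.isOpen_inter_region.mem_nhds hp
  have hev : cx M a (scal (bigSigma a) (op3 M a (1 / 2) (1 / 2) α)) =ᶠ[nhds p]
      fun q => (zeta a q * zetaBar a q) * mShift M a (etaC a) (scalarPart ρ σ (-1)) q := by
    filter_upwards [hnhds] with q hq
    rw [cx_scal, hsol.cx_op3_alpha ha hU hq, zeta_mul_zetaBar]
  have key := cx_gradShift_add ha hp.2 hdiv hcurl (cx_eta ha hp.2) (-I)
    (by filter_upwards [hnhds] with q hq using (hsol.div_add_curl_alphaBar ha hU hq).2)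
  rw [mShift_neg] at key
  have hcomm := e3_mShift_etaC hp.2.2 (hsol.contDiffAt_scalarPart hU hp (-1)) ha
  have h1 := cx_op3 ha hp.2 (1 / 2) (3 / 2) hd hh
  rw [hev.fderiv_eq, hev.eq_of_nhds] at h1
  have hh1 := horizontalAt_op3 ha hp.2 (1 / 2) (3 / 2) hh
  have hh2 := horizontalAt_gradShift ha hp.2 (horizontalAt_eta ha hp.2) (hDiv M a αb)
  have hh3 := horizontalAt_hStar ha hp.2 (gradShift M a (eta M a) (hCurl M a αb))
  refine eq_zero_of_cxAt_eq_zero ha hp.2 ?_ ?_ ?_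
  · rw [sub_dotProduct, sub_dotProduct, neg_dotProduct, smul_dotProduct, hh1.1, hh2.1, hh3.1]
    simp
  · rw [sub_dotProduct, sub_dotProduct, neg_dotProduct, smul_dotProduct, hh1.2, hh2.2, hh3.2]
    simp
  have hcoef : (zeta a p - zetaBar a p - ((1 / 2 : ℝ) : ℂ) * (zeta a p + zetaBar a p)
      - ((3 / 2 : ℝ) : ℂ) * (zeta a p - zetaBar a p)) / (zeta a p * zetaBar a p)
      = -1 / zetaBar a p := by
    push_cast; field_simp; ring
  rw [cxAt_sub, cxAt_sub, cxAt_neg, cxAt_smul, ← cx_eq_cxAt, ← cx_eq_cxAt, ← cx_eq_cxAt,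
    cx_hStar ha hp.2, h1, hcoef, hcomm]
  push_cast
  rw [← zeta_mul_zetaBar, one_div, inv_mul_cancel_left₀ (mul_ne_zero hz hz')]
  linear_combination key

/-- Here (div - i curl)(Σα) and the ∇̸₄ equation for α̲ both involve ρ + iσ, and `e4_mShift_etaBarC`
relates them. -/
theorem starobinsky_alphaBar_of_mem_region :
    op4 M a (1 / 2) (3 / 2)
        (scal (bigSigma a) (op4 M a (1 / 2) (1 / 2) αb + scal (omegaHat M a) αb)) p
      - (-gradShift M a (etaBar M a) (hDiv M a (scal (bigSigma a) α)) p
        - hStar M a (gradShift M a (etaBar M a) (hCurl M a (scal (bigSigma a) α))) p) = 0 := by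
  have hα := contDiffOn_pi.1 hsol.smooth_alpha
  have hSα := contDiffOn_scal (contDiffOn_bigSigma (a := a) hM hU) hα
  have hdiv := hU.differentiableAt hp (contDiffOn_hDiv hM ha hU hSα)
  have hcurl := hU.differentiableAt hp (contDiffOn_hCurl hM ha hU hSα)
  have hd := hU.differentiableAt hp (contDiffOn_pi.2 (contDiffOn_scal
    (contDiffOn_bigSigma (a := a) hM hU)
    (contDiffOn_pi.1 (hsol.contDiffOn_op4_alphaBar ha hU hM))))
  have hh := horizontalAt_scal (bigSigma a) (hsol.horizontalAt_op4_alphaBar ha hp)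
  have hnhds := hU.isOpen_inter_region.mem_nhds hp
  have hev : cx M a (scal (bigSigma a) (op4 M a (1 / 2) (1 / 2) αb + scal (omegaHat M a) αb))
      =ᶠ[nhds p]
      fun q => -((zeta a q * zetaBar a q) * mShift M a (etaBarC a) (scalarPart ρ σ 1) q) := by
    filter_upwards [hnhds] with q hq
    rw [cx_scal, hsol.cx_op4_alphaBar ha hU hq, zeta_mul_zetaBar, mul_neg]
  have key := cx_gradShift_add ha hp.2 hdiv hcurl (cx_etaBar ha hp.2) (-I)
    (by filter_upwards [hnhds] with q hq using (hsol.div_add_curl_alpha ha hU hq).2)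
  have hcomm := e4_mShift_etaBarC hp.2.2 (hsol.contDiffAt_scalarPart hU hp 1) ha
  have h1 := cx_op4 ha hp.2 (1 / 2) (3 / 2) hd hh
  rw [hev.fderiv_eq, hev.eq_of_nhds, fderiv_fun_neg, neg_apply] at h1
  have hh1 := horizontalAt_op4 ha hp.2 (1 / 2) (3 / 2) hh
  have hh2 := horizontalAt_gradShift ha hp.2 (horizontalAt_etaBar ha hp.2)
    (hDiv M a (scal (bigSigma a) α))
  have hh3 := horizontalAt_hStar ha hp.2
    (gradShift M a (etaBar M a) (hCurl M a (scal (bigSigma a) α)))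
  refine eq_zero_of_cxAt_eq_zero ha hp.2 ?_ ?_ ?_
  · rw [sub_dotProduct, sub_dotProduct, neg_dotProduct, hh1.1, hh2.1, hh3.1]; simp
  · rw [sub_dotProduct, sub_dotProduct, neg_dotProduct, hh1.2, hh2.2, hh3.2]; simp
  rw [cxAt_sub, cxAt_sub, cxAt_neg, ← cx_eq_cxAt, ← cx_eq_cxAt, ← cx_eq_cxAt,
    cx_hStar ha hp.2, h1]
  push_cast
  linear_combination key - hcomm

end IsMaxwellSolution

/-- A smooth one-form on `U` vanishes if it does so off the horizon and the axis. -/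
theorem oneForm_eq_zero_of_eq_zero_on_region (hM : 0 < M) (hU : IsRelOpen M a U) {ς : OneForm}
    (hς : ∀ i, ContDiffOn ℝ ∞ (fun p => ς p i) U) (h : ∀ q ∈ U ∩ region M a, ς q = 0) :
    ∀ p ∈ U, ς p = 0 := fun _ hp =>
  funext fun i => eq_zero_of_eq_zero_on_region hM hU (hς i) (fun q hq => congrFun (h q hq) i) hp

end

end KerrMaxwell

/-! ### Extension to the horizon and the axis by density -/

theorem proposition3p1 (M a : ℝ) (hM : 0 < M) (ha : |a| ≤ M)
    (U : Set Pt) (hU : ∃ V : Set Pt, IsOpen V ∧ U = V ∩ exterior M a)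
    (α αb : OneForm) (ρ σ : Pt → ℝ) (hsol : IsMaxwellSolution M a U α αb ρ σ) :
    -- the Teukolsky equation of spin `+1`
    (∀ p ∈ U,
      bigSigma a p • op4 M a (3 / 2) (-(1 / 2)) (op3 M a (1 / 2) (1 / 2) α) p
        - gradShift M a (eta M a) (hDiv M a (scal (bigSigma a) α)) p
        + hStar M a (gradShift M a (eta M a) (hCurl M a (scal (bigSigma a) α))) p = 0) ∧
    -- the Teukolsky equation of spin `-1`
    (∀ p ∈ U,
      op3 M a (3 / 2) (-(1 / 2))
          (op4 M a (1 / 2) (1 / 2) αb + scal (omegaHat M a) αb) p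
        - gradShift M a (etaBar M a) (hDiv M a αb) p
        + hStar M a (gradShift M a (etaBar M a) (hCurl M a αb)) p = 0) ∧
    -- the first Teukolsky–Starobinsky identity
    (∀ p ∈ U,
      (1 / bigSigma a p) •
          op3 M a (1 / 2) (3 / 2) (scal (bigSigma a) (op3 M a (1 / 2) (1 / 2) α)) p
        = -gradShift M a (eta M a) (hDiv M a αb) p
          - hStar M a (gradShift M a (eta M a) (hCurl M a αb)) p) ∧
    -- the second Teukolsky–Starobinsky identity
    (∀ p ∈ U,
      op4 M a (1 / 2) (3 / 2)
          (scal (bigSigma a) (op4 M a (1 / 2) (1 / 2) αb + scal (omegaHat M a) αb)) p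
        = -gradShift M a (etaBar M a) (hDiv M a (scal (bigSigma a) α)) p
          - hStar M a (gradShift M a (etaBar M a) (hCurl M a (scal (bigSigma a) α))) p) := by
  have hU' : IsRelOpen M a U := hU
  have hα := contDiffOn_pi.1 hsol.smooth_alpha
  have hαb := contDiffOn_pi.1 hsol.smooth_alphaBar
  have hS : ContDiffOn ℝ ∞ (bigSigma a) U := contDiffOn_bigSigma hM hU'
  have hSα := contDiffOn_scal hS hα
  have hA := contDiffOn_op3 hM ha hU' (1 / 2) (1 / 2) hα
  have hB := contDiffOn_pi.1 (hsol.contDiffOn_op4_alphaBar ha hU' hM)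
  have hη := contDiffOn_eta hM ha hU'
  have hηb := contDiffOn_etaBar hM ha hU'
  have hS0 : ∀ q ∈ U, bigSigma a q ≠ 0 := fun q hq =>
    (bigSigma_pos a (rad_pos_of_mem hM (hU'.subset hq))).ne'
  have hg {τ : OneForm} (hτ : ∀ i, ContDiffOn ℝ ∞ (fun p => τ p i) U) {f : Pt → ℝ}
      (hf : ContDiffOn ℝ ∞ f U) := contDiffOn_gradShift hM hU' hτ hf
  have hs {τ : OneForm} (hτ : ∀ i, ContDiffOn ℝ ∞ (fun p => τ p i) U) {f : Pt → ℝ}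
      (hf : ContDiffOn ℝ ∞ f U) := contDiffOn_hStar hM ha hU' (hg hτ hf)
  have hdiv {ς : OneForm} (hς : ∀ i, ContDiffOn ℝ ∞ (fun p => ς p i) U) :=
    contDiffOn_hDiv hM ha hU' hς
  have hcurl {ς : OneForm} (hς : ∀ i, ContDiffOn ℝ ∞ (fun p => ς p i) U) :=
    contDiffOn_hCurl hM ha hU' hς
  -- The pattern matches only the two Teukolsky–Starobinsky identities, whose right sides are
  -- differences; all four claims then say that a smooth one-form vanishes.
  simp only [← sub_eq_zero (b := _ - _)]
  refine ⟨?_, ?_, ?_, ?_⟩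
  · refine oneForm_eq_zero_of_eq_zero_on_region hM hU'
      (fun i => ((hS.mul (contDiffOn_op4 hM ha hU' _ _ hA i)).sub (hg hη (hdiv hSα) i)).add
        (hs hη (hcurl hSα) i))
      (fun q hq => hsol.teukolsky_alpha_of_mem_region ha hU' hq hM)
  · refine oneForm_eq_zero_of_eq_zero_on_region hM hU'
      (fun i => ((contDiffOn_op3 hM ha hU' _ _ hB i).sub (hg hηb (hdiv hαb) i)).add
        (hs hηb (hcurl hαb) i))
      (fun q hq => hsol.teukolsky_alphaBar_of_mem_region ha hU' hq hM)
  · refine oneForm_eq_zero_of_eq_zero_on_region hM hU'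
      (fun i => ((contDiffOn_const.div hS hS0).mul
        (contDiffOn_op3 hM ha hU' _ _ (contDiffOn_scal hS hA) i)).sub
          ((hg hη (hdiv hαb) i).neg.sub (hs hη (hcurl hαb) i)))
      (fun q hq => hsol.starobinsky_alpha_of_mem_region ha hU' hq hM)
  · refine oneForm_eq_zero_of_eq_zero_on_region hM hU'
      (fun i => (contDiffOn_op4 hM ha hU' _ _ (contDiffOn_scal hS hB) i).sub
          ((hg hηb (hdiv hSα) i).neg.sub (hs hηb (hcurl hSα) i)))
      (fun q hq => hsol.starobinsky_alphaBar_of_mem_region ha hU' hq hM)
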